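/- Let $k\ge 1$ and $H=(H_1,\dots,H_k)\in[\tfrac12,1)^k$. Put $C^{(=)}=\{i:H_i=\tfrac12\}$, $C^{(>)}=\{i:H_i>\tfrac12\}$, with cardinals $c^{(=)}$, $c^{(>)}$. Let $B^H=\{B^H(x),x\in\mathbb R^k\}$ be a fractional Brownian field on a probability space $(\Omega,\mathcal F,\mathbb P)$: a centred Gaussian process with covariance $$R_H(x,y)=\prod_{i=1}^k \tfrac12\left(|x_i|^{2H_i}+|y_i|^{2H_i}-|x_i-y_i|^{2H_i}\right).$$ A standard Wiener field $W$ on $\mathbb R^k$ is a centred Gaussian process indexed by $\mathbb R^k$ with $\mathbb E(W(x)W(y))=\prod_{i=1}^k (x_i\wedge y_i)$, where $s\wedge t$ here means $\min(s,t)$ if $s,t>0$, $\min(-s,-t)$ if $s,t<0$, and $0$ otherwise. Let $1_{[0,x]}(\eta)=\prod_i 1_{[0,x_i]}(\eta_i)$ with the sign convention that, for $x_i<0$, $1_{[0,x_i]}=-1$ on $[x_i,0]$ and $0$ elsewhere. The Wiener integral $f\mapsto\int f\,dW$ is the linear isometry $L^2(\mathbb R^k)\to L^2(\Omega)$ that maps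 $1_{[0,x]}$ to $W(x)$. With $t_+^a=t^a$ for $t>0$ and $t_+^a=0$ for $t\le 0$, and $c_h=\sqrt{\Gamma(2h+1)\sin(\pi h)}\,/\,\Gamma(h+\tfrac12)$, let $$K_H(x,y)=\prod_{i=1}^k c_{H_i}\left\{(x_i-y_i)_+^{H_i-\frac12}-(-y_i)_+^{H_i-\frac12}\right\}.$$ For $\varphi:\mathbb R^k\to\mathbb R$ let $K^*_{H_i}\varphi=\varphi$ if $H_i=\frac12$, and $$(K^*_{H_i}\varphi)(\eta)=(H_i-\tfrac12)\,c_{H_i}\int_{\mathbb R}\varphi(\eta_1,\dots,\eta_{i-1},u,\eta_{i+1},\dots,\eta_k)\,(u-\eta_i)_+^{H_i-\frac32}\,du$$ if $H_i>\frac12$, and put $K_H^{*,(k)}\varphi=K^*_{H_k}(\cdots(K^*_{H_1}\varphi)\cdots)$. Let $\mathcal E$ be the linear span of the functions $1_{[0,x]}$, $x\in\mathbb R^k$, with the inner product determined by $\langle 1_{[0,x]},1_{[0,y]}\rangle_{\mathcal H^H}=R_H(x,y)$; let $\mathcal H^H$ be the Hilbert space completion of $\mathcal E$; and let $\mathcal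 I$ be the continuous linear extension to $\mathcal H^H$ of $1_{[0,x]}\mapsto B^H(x)\in L^2(\Omega)$. For $u\in\mathbb R^k$ and $v\in\mathbb R^{C^{(>)}}$ let $w(u,v)\in\mathbb R^k$ have coordinates $w_i=v_i$ for $i\in C^{(>)}$ and $w_i=u_i$ for $i\in C^{(=)}$. Let $|\mathcal H^H|$ be the set of Lebesgue measurable $\varphi:\mathbb R^k\to\mathbb R$ such that $$\int_{\mathbb R^{k}\times\mathbb R^{c^{(>)}}}|\varphi(u)|\,|\varphi(w(u,v))|\prod_{i\in C^{(>)}}H_i(2H_i-1)|u_i-v_i|^{2H_i-2}\,du\,dv<\infty .$$ Then there is a standard Wiener field $W$ on $\mathbb R^k$, defined on the same probability space, such that the following hold. 1. For every $x\in\mathbb R^k$, the functions $K_H(x,\cdot)$ and $K_H^{*,(k)}1_{[0,x]}$ are in $L^2(\mathbb R^k)$ and, almost surely, $$B^H(x)=\int_{\mathbb R^k}K_H(x,y)\,W(dy)=\int_{\mathbb R^k}\left(K_H^{*,(k)}1_{[0,x]}\right)(y)\,W(dy).$$ 2. $K_H^{*,(k)}$ maps $\mathcal E$ into $L^2(\mathbb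 R^k)$ and extends to a linear isometry $\mathcal H^H\to L^2(\mathbb R^k)$; $\mathcal I:\mathcal H^H\to L^2(\Omega)$ is a linear isometry with $\mathcal I(1_{[0,x]})=B^H(x)$; and for every $\varphi\in\mathcal H^H$, $$\mathcal I(\varphi)=\int_{\mathbb R^k}\left(K_H^{*,(k)}\varphi\right)(y)\,W(dy)\in L^2(\Omega).$$ 3. For every $\varphi\in|\mathcal H^H|$ the function $K_H^{*,(k)}\varphi$ (defined by the integrals above) is in $L^2(\mathbb R^k)$ and is the image under the extended $K_H^{*,(k)}$ of exactly one element of $\mathcal H^H$, again denoted by $\varphi$. For all $\varphi_1,\varphi_2\in|\mathcal H^H|$, $$\mathbb E\left(\mathcal I(\varphi_1)\mathcal I(\varphi_2)\right)=\int_{\mathbb R^k}\left(K_H^{*,(k)}\varphi_1\right)(y)\left(K_H^{*,(k)}\varphi_2\right)(y)\,dy$$ $$=\int_{\mathbb R^{k}\times\mathbb R^{c^{(>)}}}\varphi_1(u)\,\varphi_2(w(u,v))\prod_{i\in C^{(>)}}H_i(2H_i-1)|u_i-v_i|^{2H_i-2}\,du\,dv,$$ where the last integral converges absolutely. In particular,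 if $H_i>\frac12$ for all $i$, then $$\mathbb E\left(\mathcal I(\varphi_1)\mathcal I(\varphi_2)\right)=\int_{\mathbb R^{2k}}\varphi_1(u)\varphi_2(v)\prod_{i=1}^k H_i(2H_i-1)|u_i-v_i|^{2H_i-2}\,du\,dv .$$ -/

import Mathlib

open MeasureTheory ProbabilityTheory Set

noncomputable section

namespace FracField

/-! ### Fractional Brownian fields and standard Wiener fields -/

/-- The Hurst parameters `H ∈ [1/2, 1)`. -/
abbrev Hurst : Type := Set.Ico (1 / 2 : ℝ) 1

/-- `R_h(s,t) = (|s|^{2h} + |t|^{2h} - |s-t|^{2h}) / 2`. -/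
def covR (h s t : ℝ) : ℝ := (|s| ^ (2 * h) + |t| ^ (2 * h) - |s - t| ^ (2 * h)) / 2

/-- `R_H(x,y) = ∏ i, R_{H i}(x i, y i)`. -/
def fieldCov {k : ℕ} (H : Fin k → Hurst) (x y : Fin k → ℝ) : ℝ :=
  ∏ i, covR (H i) (x i) (y i)

/-- `B` is a fractional Brownian field with Hurst parameter `H`. -/
structure IsFractionalBrownianField {k : ℕ} {Ω : Type*} [MeasurableSpace Ω]
    (H : Fin k → Hurst) (P : Measure Ω) (B : (Fin k → ℝ) → Ω → ℝ) : Prop where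
  gaussian : IsGaussianProcess B P
  mean : ∀ x, ∫ ω, B x ω ∂P = 0
  cov : ∀ x y, ∫ ω, B x ω * B y ω ∂P = fieldCov H x y

/-- The one-dimensional covariance `s ∧ t` of a two-sided Brownian motion. -/
def wedge (s t : ℝ) : ℝ :=
  if 0 < s ∧ 0 < t then min s t else if s < 0 ∧ t < 0 then min (-s) (-t) else 0

/-- `W` is a standard Wiener field on `ℝ^k`. -/
structure IsStandardWienerField {k : ℕ} {Ω : Type*} [MeasurableSpace Ω]
    (P : Measure Ω) (W : (Fin k → ℝ) → Ω → ℝ) : Prop where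
  gaussian : IsGaussianProcess W P
  mean : ∀ x, ∫ ω, W x ω ∂P = 0
  cov : ∀ x y, ∫ ω, W x ω * W y ω ∂P = ∏ i, wedge (x i) (y i)

/-! ### Kernels and the operator `K_H^{*,(k)}` -/

/-- `t_+^a`, equal to `t^a` for `t > 0` and to `0` for `t ≤ 0` (also when `a = 0`). -/
def posPow (t a : ℝ) : ℝ := if 0 < t then t ^ a else 0

/-- The normalising constant of the Mandelbrot–van Ness representation;
it equals `1` for `h = 1/2`. -/
def mvnConst (h : ℝ) : ℝ :=
  √(Real.Gamma (2 * h + 1) * Real.sin (Real.pi * h)) / Real.Gamma (h + 1 / 2)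

/-- The one-dimensional Mandelbrot–van Ness kernel. -/
def mvnKernel (h x y : ℝ) : ℝ :=
  mvnConst h * (posPow (x - y) (h - 1 / 2) - posPow (-y) (h - 1 / 2))

/-- `K_H(x,y) = ∏ i, K_{H i}(x i, y i)`. -/
def fieldKernel {k : ℕ} (H : Fin k → Hurst) (x y : Fin k → ℝ) : ℝ :=
  ∏ i, mvnKernel (H i) (x i) (y i)

/-- The operator `K_h^*` acting in the `i`-th variable. Its constant `(h - 1/2) * mvnConst h`
is the derivative normalisation of the constant in `mvnKernel`. -/
def kStarOne {k : ℕ} (h : ℝ) (i : Fin k) (φ : (Fin k → ℝ) → ℝ) (η : Fin k → ℝ) : ℝ :=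
  if h = 1 / 2 then φ η
  else (h - 1 / 2) * mvnConst h *
    ∫ u : ℝ, φ (Function.update η i u) * posPow (u - η i) (h - 3 / 2)

/-- The iterated operator `K_H^{*,(k)} φ = K_{H_k}^* (K_{H_{k-1}}^* ⋯ (K_{H_1}^* φ) ⋯ )`. -/
def kStar {k : ℕ} (H : Fin k → Hurst) (φ : (Fin k → ℝ) → ℝ) : (Fin k → ℝ) → ℝ :=
  (List.finRange k).foldl (fun ψ i => kStarOne (H i) i ψ) φ

/-! ### Elementary functions and the Hilbert space `𝓗^H` -/

/-- The signed indicator `1_{[0,x]}` of an interval of the line. -/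
def signedInd (x t : ℝ) : ℝ :=
  if 0 ≤ t ∧ t ≤ x then 1 else if x ≤ t ∧ t ≤ 0 then -1 else 0

/-- The signed indicator `1_{[0,x]}` of a rectangle in `ℝ^k`. -/
def boxInd {k : ℕ} (x η : Fin k → ℝ) : ℝ := ∏ i, signedInd (x i) (η i)

theorem integrableOn_cosKernel (h : ℝ) (h0 : 0 < h) (h1 : h < 1) (x : ℝ) :
    IntegrableOn (fun ξ : ℝ => (1 - Real.cos (x * ξ)) * ξ ^ (-1 - 2 * h)) (Ioi 0) := by
  have hm : Measurable fun ξ : ℝ => (1 - Real.cos (x * ξ)) * ξ ^ (-1 - 2 * h) := by fun_prop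
  rw [← Ioc_union_Ioi_eq_Ioi (zero_le_one' ℝ)]
  refine IntegrableOn.union ?_ ?_
  · have hi : IntegrableOn (fun ξ : ℝ => x ^ 2 / 2 * ξ ^ (1 - 2 * h)) (Ioc 0 1) :=
      (((intervalIntegrable_iff_integrableOn_Ioc_of_le zero_le_one).1
        (intervalIntegral.intervalIntegrable_rpow' (by linarith)))).const_mul _
    refine hi.mono' hm.aestronglyMeasurable ?_
    filter_upwards [ae_restrict_mem measurableSet_Ioc] with ξ hξ
    have e : ξ ^ (1 - 2 * h) = ξ ^ 2 * ξ ^ (-1 - 2 * h) := by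
      rw [← Real.rpow_natCast, ← Real.rpow_add hξ.1]; congr 1; push_cast; ring
    have p : 0 ≤ ξ ^ (-1 - 2 * h) := Real.rpow_nonneg hξ.1.le _
    have c1 := Real.cos_le_one (x * ξ)
    have c2 := Real.one_sub_sq_div_two_le_cos (x := x * ξ)
    rw [Real.norm_of_nonneg (mul_nonneg (by linarith) p), e, ← mul_assoc]
    exact mul_le_mul_of_nonneg_right (by nlinarith) p
  · have hi : IntegrableOn (fun ξ : ℝ => 2 * ξ ^ (-1 - 2 * h)) (Ioi 1) :=
      (integrableOn_Ioi_rpow_of_lt (by linarith) one_pos).const_mul _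
    refine hi.mono' hm.aestronglyMeasurable ?_
    filter_upwards [ae_restrict_mem measurableSet_Ioi] with ξ hξ
    have hξ' : (0 : ℝ) < ξ := lt_trans one_pos hξ
    have p : 0 ≤ ξ ^ (-1 - 2 * h) := Real.rpow_nonneg hξ'.le _
    have c1 := Real.cos_le_one (x * ξ)
    have c2 := Real.neg_one_le_cos (x * ξ)
    rw [Real.norm_of_nonneg (mul_nonneg (by linarith) p)]
    exact mul_le_mul_of_nonneg_right (by linarith) p

theorem integral_cosKernel (h : ℝ) (h0 : 0 < h) (x : ℝ) :
    ∫ ξ in Ioi (0 : ℝ), (1 - Real.cos (x * ξ)) * ξ ^ (-1 - 2 * h) =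
      |x| ^ (2 * h) * ∫ ξ in Ioi (0 : ℝ), (1 - Real.cos ξ) * ξ ^ (-1 - 2 * h) := by
  rcases eq_or_ne x 0 with rfl | hx
  · simp [Real.zero_rpow (by linarith : 2 * h ≠ 0)]
  have hx' : 0 < |x| := abs_pos.2 hx
  have := integral_comp_mul_left_Ioi (fun ξ : ℝ => (1 - Real.cos ξ) * ξ ^ (-1 - 2 * h)) 0 hx'
  rw [mul_zero, smul_eq_mul] at this
  have e : ∫ ξ in Ioi (0 : ℝ), (1 - Real.cos (|x| * ξ)) * (|x| * ξ) ^ (-1 - 2 * h) =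
      |x| ^ (-1 - 2 * h) * ∫ ξ in Ioi (0 : ℝ), (1 - Real.cos (x * ξ)) * ξ ^ (-1 - 2 * h) := by
    rw [← integral_const_mul]
    refine setIntegral_congr_fun measurableSet_Ioi fun ξ hξ => ?_
    have hc : Real.cos (|x| * ξ) = Real.cos (x * ξ) := by
      rw [← Real.cos_abs (x * ξ), abs_mul, abs_of_pos (show (0 : ℝ) < ξ from hξ)]
    simp only [hc]
    rw [Real.mul_rpow hx'.le (le_of_lt hξ)]; ring
  have e2 : |x| ^ (-1 - 2 * h) * |x| ^ (2 * h) = |x|⁻¹ := by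
    rw [← Real.rpow_add hx', ← Real.rpow_neg_one]; congr 1; ring
  have hp : |x| ^ (-1 - 2 * h) ≠ 0 := (Real.rpow_pos_of_pos hx' _).ne'
  apply mul_left_cancel₀ hp
  rw [← e, this, ← mul_assoc, e2]

theorem integral_cosKernel_pos (h : ℝ) (h0 : 0 < h) (h1 : h < 1) :
    0 < ∫ ξ in Ioi (0 : ℝ), (1 - Real.cos ξ) * ξ ^ (-1 - 2 * h) := by
  have hi : IntegrableOn (fun ξ : ℝ => (1 - Real.cos ξ) * ξ ^ (-1 - 2 * h)) (Ioi 0) := by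
    simpa using integrableOn_cosKernel h h0 h1 1
  have hn : ∀ ξ ∈ Ioi (0 : ℝ), 0 ≤ (1 - Real.cos ξ) * ξ ^ (-1 - 2 * h) := fun ξ hξ =>
    mul_nonneg (by linarith [Real.cos_le_one ξ]) (Real.rpow_nonneg (le_of_lt hξ) _)
  rw [setIntegral_pos_iff_support_of_nonneg_ae
    ((ae_restrict_iff' measurableSet_Ioi).2 (.of_forall hn)) hi]
  refine lt_of_lt_of_le (b := volume (Ioo (0 : ℝ) 1)) (by simp) (measure_mono fun ξ hξ => ?_)
  refine ⟨?_, hξ.1⟩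
  have : Real.cos ξ < 1 := by
    have := Real.cos_lt_cos_of_nonneg_of_le_pi (le_refl 0)
      (by linarith [Real.pi_gt_three, hξ.2]) hξ.1
    simpa using this
  exact (mul_pos (by linarith) (Real.rpow_pos_of_pos hξ.1 _)).ne'

/-- The covariance of fractional Brownian motion on the line is a positive semidefinite kernel. -/
theorem posSemidef_covR (h : ℝ) (h0 : 0 < h) (h1 : h < 1) :
    (Matrix.of (covR h)).PosSemidef := by
  set A : ℝ := ∫ ξ in Ioi (0 : ℝ), (1 - Real.cos ξ) * ξ ^ (-1 - 2 * h) with hA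
  have hApos : 0 < A := integral_cosKernel_pos h h0 h1
  set G : ℝ → ℝ → ℝ := fun x ξ => (1 - Real.cos (x * ξ)) * ξ ^ (-1 - 2 * h) with hG
  have hGi : ∀ x, IntegrableOn (G x) (Ioi 0) := integrableOn_cosKernel h h0 h1
  have hGA : ∀ x, |x| ^ (2 * h) = A⁻¹ * ∫ ξ in Ioi (0 : ℝ), G x ξ := fun x => by
    rw [integral_cosKernel h h0 x, ← hA]; field_simp
  have hcov : ∀ s t, covR h s t = (2 * A)⁻¹ * ∫ ξ in Ioi (0 : ℝ), (G s ξ + G t ξ - G (s - t) ξ) := by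
    intro s t
    have e1 : ∫ ξ in Ioi (0 : ℝ), (G s ξ + G t ξ - G (s - t) ξ) =
        (∫ ξ in Ioi (0 : ℝ), (G s ξ + G t ξ)) - ∫ ξ in Ioi (0 : ℝ), G (s - t) ξ :=
      integral_sub ((hGi s).add (hGi t)) (hGi _)
    have e2 : ∫ ξ in Ioi (0 : ℝ), (G s ξ + G t ξ) =
        (∫ ξ in Ioi (0 : ℝ), G s ξ) + ∫ ξ in Ioi (0 : ℝ), G t ξ :=
      integral_add (hGi s) (hGi t)
    rw [e1, e2, covR, hGA s, hGA t, hGA (s - t)]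
    field_simp
  refine ⟨?_, fun c => ?_⟩
  · ext s t
    simp only [Matrix.conjTranspose_apply, Matrix.of_apply, star_trivial, covR]
    rw [abs_sub_comm]; ring
  · simp only [star_trivial, Matrix.of_apply]
    have hsum : (c.sum fun s a => c.sum fun t b => a * covR h s t * b) =
        (2 * A)⁻¹ * ∫ ξ in Ioi (0 : ℝ), ∑ s ∈ c.support, ∑ t ∈ c.support,
          c s * c t * (G s ξ + G t ξ - G (s - t) ξ) := by
      have hI : ∀ s t, IntegrableOn (fun ξ => c s * c t * (G s ξ + G t ξ - G (s - t) ξ))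
          (Ioi 0) := fun s t => (((hGi s).add (hGi t)).sub (hGi _)).const_mul _
      rw [integral_finsetSum _ fun s _ => integrable_finsetSum _ fun t _ => hI s t,
        Finset.mul_sum, Finsupp.sum]
      refine Finset.sum_congr rfl fun s _ => ?_
      rw [integral_finsetSum _ fun t _ => hI s t, Finset.mul_sum, Finsupp.sum]
      refine Finset.sum_congr rfl fun t _ => ?_
      rw [integral_const_mul, hcov]; ring
    rw [hsum]
    refine mul_nonneg (by positivity) (setIntegral_nonneg measurableSet_Ioi fun ξ hξ => ?_)
    have : ∑ s ∈ c.support, ∑ t ∈ c.support, c s * c t * (G s ξ + G t ξ - G (s - t) ξ) =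
        ((∑ s ∈ c.support, c s * (1 - Real.cos (s * ξ))) ^ 2 +
          (∑ s ∈ c.support, c s * Real.sin (s * ξ)) ^ 2) * ξ ^ (-1 - 2 * h) := by
      rw [sq, sq, Finset.sum_mul_sum, Finset.sum_mul_sum]
      simp only [← Finset.sum_add_distrib, hG]
      rw [Finset.sum_mul]
      simp only [Finset.sum_mul]
      refine Finset.sum_congr rfl fun s _ => Finset.sum_congr rfl fun t _ => ?_
      rw [sub_mul s t ξ, Real.cos_sub]; ring
    rw [this]
    exact mul_nonneg (by positivity) (Real.rpow_nonneg (le_of_lt hξ) _)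

theorem posSemidef_fieldCov {k : ℕ} (H : Fin k → Hurst) :
    (Matrix.of (fieldCov H)).PosSemidef := by
  classical
  have key : ∀ s : Finset (Fin k),
      (Matrix.of fun x y : Fin k → ℝ => ∏ i ∈ s, covR (H i) (x i) (y i)).PosSemidef := by
    intro s
    induction s using Finset.induction_on with
    | empty =>
      refine ⟨by ext; simp, fun c => ?_⟩
      simp only [Finset.prod_empty, Matrix.of_apply, mul_one, star_trivial]
      have : (c.sum fun _ a => c.sum fun _ b => a * b) = (c.sum fun _ a => a) ^ 2 := by
        simp only [Finsupp.sum, sq, Finset.sum_mul_sum]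
      rw [this]
      positivity
    | insert a s ha ih =>
      have h1 := (posSemidef_covR (H a) (lt_of_lt_of_le (by norm_num) (H a).2.1)
        (H a).2.2).submatrix (fun x : Fin k → ℝ => x a)
      have h2 := h1.hadamard ih
      simpa only [Finset.prod_insert ha] using! h2
  exact key Finset.univ

/-- The bilinear form on formal linear combinations of points with Gram matrix `R_H`. -/
def gram {k : ℕ} (H : Fin k → Hurst) (c d : (Fin k → ℝ) →₀ ℝ) : ℝ :=
  c.sum fun x a => d.sum fun y b => a * fieldCov H x y * b

theorem gram_comm {k : ℕ} (H : Fin k → Hurst) (c d : (Fin k → ℝ) →₀ ℝ) :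
    gram H d c = gram H c d := by
  unfold gram
  rw [Finsupp.sum_comm]
  refine Finsupp.sum_congr fun x _ => Finsupp.sum_congr fun y _ => ?_
  have := (posSemidef_fieldCov H).isHermitian.apply x y
  simp only [Matrix.of_apply, star_trivial] at this
  rw [this]; ring

theorem gram_add {k : ℕ} (H : Fin k → Hurst) (c d e : (Fin k → ℝ) →₀ ℝ) :
    gram H (c + d) e = gram H c e + gram H d e := by
  unfold gram
  rw [Finsupp.sum_add_index'] <;> simp [← Finsupp.sum_add, add_mul]

theorem gram_smul {k : ℕ} (H : Fin k → Hurst) (r : ℝ) (c d : (Fin k → ℝ) →₀ ℝ) :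
    gram H (r • c) d = r * gram H c d := by
  unfold gram
  rw [Finsupp.sum_smul_index] <;> simp [Finsupp.mul_sum, mul_assoc]

theorem gram_self_nonneg {k : ℕ} (H : Fin k → Hurst) (c : (Fin k → ℝ) →₀ ℝ) :
    0 ≤ gram H c c := by
  simpa [gram] using (posSemidef_fieldCov H).2 c

/-- Elementary functions: finite linear combinations of the signed indicators `1_{[0,x]}`,
stored by their coefficients. -/
def Elem {k : ℕ} (_H : Fin k → Hurst) : Type := (Fin k → ℝ) →₀ ℝ

namespace Elem

variable {k : ℕ} {H : Fin k → Hurst}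

instance : AddCommGroup (Elem H) := inferInstanceAs (AddCommGroup ((Fin k → ℝ) →₀ ℝ))

instance : Module ℝ (Elem H) := inferInstanceAs (Module ℝ ((Fin k → ℝ) →₀ ℝ))

/-- The elementary function `1_{[0,x]}`. -/
def box (x : Fin k → ℝ) : Elem H := (Finsupp.single x 1 : (Fin k → ℝ) →₀ ℝ)

/-- The linear map on elementary functions with prescribed values `f x` at `1_{[0,x]}`. -/
def lift {M : Type*} [AddCommGroup M] [Module ℝ M] (f : (Fin k → ℝ) → M) : Elem H →ₗ[ℝ] M :=
  (Finsupp.linearCombination ℝ f : ((Fin k → ℝ) →₀ ℝ) →ₗ[ℝ] M)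

/-- The function on `ℝ^k` given by an elementary function. -/
def toFun (c : Elem H) : (Fin k → ℝ) → ℝ := lift boxInd c

/-- The elementary function `1_{[x,y]}`: the increment on the rectangle `[x,y]` of
`z ↦ 1_{[0,z]}`, an alternating sum over the vertices of the rectangle. -/
def rect (x y : Fin k → ℝ) : Elem H :=
  ∑ s : Finset (Fin k), (-1 : ℝ) ^ s.card • box (s.piecewise x y)

/-- The bilinear form determined by `⟨1_{[0,x]}, 1_{[0,y]}⟩ = R_H(x,y)`. -/
instance core : PreInnerProductSpace.Core ℝ (Elem H) where
  inner c d := gram H c d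
  conj_inner_symm c d := gram_comm H c d
  re_inner_nonneg c := gram_self_nonneg H c
  add_left c d e := gram_add H c d e
  smul_left c d r := gram_smul H r c d

instance : SeminormedAddCommGroup (Elem H) :=
  InnerProductSpace.Core.toSeminormedAddCommGroup (𝕜 := ℝ)

instance : InnerProductSpace ℝ (Elem H) := .ofCore _

theorem inner_box (x y : Fin k → ℝ) :
    inner ℝ (box x : Elem H) (box y) = fieldCov H x y := by
  change gram H (Finsupp.single x 1) (Finsupp.single y 1) = _
  simp [gram]

theorem toFun_box (x : Fin k → ℝ) : (box x : Elem H).toFun = boxInd x := by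
  change Finsupp.linearCombination ℝ boxInd (Finsupp.single x (1 : ℝ)) = _
  simp

/-- Indicators of arbitrary rectangles are elementary functions. -/
theorem toFun_rect_ae {x y : Fin k → ℝ} (hxy : x ≤ y) :
    (rect x y : Elem H).toFun =ᵐ[volume] (Set.Icc x y).indicator 1 := by
  classical
  have hne : ∀ (z : Fin k → ℝ) (i : Fin k), ∀ᵐ η : Fin k → ℝ, η i ≠ z i := fun z i =>
    (Measure.quasiMeasurePreserving_eval (fun _ : Fin k => (volume : Measure ℝ)) i).ae
      (Measure.ae_ne volume (z i))
  filter_upwards [ae_all_iff.2 (hne x), ae_all_iff.2 (hne y), ae_all_iff.2 (hne 0)]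
    with η hx hy h0
  have h1 : (rect x y : Elem H).toFun η =
      ∑ s : Finset (Fin k), (-1 : ℝ) ^ s.card * boxInd (s.piecewise x y) η := by
    have : (rect x y : Elem H).toFun =
        ∑ s : Finset (Fin k), (-1 : ℝ) ^ s.card • boxInd (s.piecewise x y) := by
      simp only [rect, toFun, map_sum, map_smul]
      simp only [← toFun_box (H := H), toFun]
    rw [this]
    simp
  have h2 : ∀ i, signedInd (y i) (η i) - signedInd (x i) (η i) =
      if x i ≤ η i ∧ η i ≤ y i then 1 else 0 := by
    intro i
    have := hxy i; have := hx i; have := hy i; have := h0 i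
    simp only [signedInd, Pi.zero_apply] at *
    grind
  have h3 : ∏ i, (signedInd (y i) (η i) - signedInd (x i) (η i)) =
      ∑ s : Finset (Fin k), (-1 : ℝ) ^ s.card * boxInd (s.piecewise x y) η := by
    rw [Finset.prod_sub, Finset.powerset_univ]
    refine Finset.sum_congr rfl fun s _ => ?_
    rw [mul_assoc, mul_comm (∏ i ∈ _ \ _, _), boxInd, ← Finset.prod_mul_prod_compl s]
    congr 2
    · exact Finset.prod_congr rfl fun i hi => by simp [hi]
    · rw [← Finset.compl_eq_univ_sdiff]
      exact Finset.prod_congr rfl fun i hi => by simp [Finset.mem_compl.1 hi]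
  rw [h1, ← h3, Finset.prod_congr rfl fun i _ => h2 i, Finset.prod_ite_zero]
  simp [Set.indicator, Set.mem_Icc, Pi.le_def, forall_and]

end Elem

/-- The Hilbert space `𝓗^H`: the closure (completion) of the elementary functions for the
norm of the inner product `⟨1_{[0,x]}, 1_{[0,y]}⟩ = R_H(x,y)`. -/
abbrev HSpace {k : ℕ} (H : Fin k → Hurst) : Type := UniformSpace.Completion (Elem H)

/-- The class in `L²(μ)` of a square integrable function (and `0` for any other function). -/
def toL2 {α : Type*} [MeasurableSpace α] (μ : Measure α) (f : α → ℝ) : Lp ℝ 2 μ :=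
  open Classical in if hf : MemLp f 2 μ then hf.toLp f else 0

/-! ### Wiener integrals as extensions by continuity -/

/-- The Wiener integral `f ↦ ∫ f dW` on `L²(ℝ^k)`: the continuous linear extension of
`1_{[0,x]} ↦ W x`. -/
def wienerIntegral {k : ℕ} {Ω : Type*} [MeasurableSpace Ω] (P : Measure Ω)
    (W : (Fin k → ℝ) → Ω → ℝ) : Lp ℝ 2 (volume : Measure (Fin k → ℝ)) →L[ℝ] Lp ℝ 2 P :=
  (Finsupp.linearCombination ℝ fun x => toL2 P (W x)).extendOfNorm
    (Finsupp.linearCombination ℝ fun x => toL2 volume (boxInd x))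

/-- The integral `𝓘` with respect to `B` on `𝓗^H`: the continuous linear extension of
`1_{[0,x]} ↦ B x`. -/
def fieldIntegral {k : ℕ} {Ω : Type*} [MeasurableSpace Ω] (H : Fin k → Hurst) (P : Measure Ω)
    (B : (Fin k → ℝ) → Ω → ℝ) : HSpace H →L[ℝ] Lp ℝ 2 P :=
  (Elem.lift fun x => toL2 P (B x)).extendOfNorm
    (UniformSpace.Completion.toComplL : Elem H →L[ℝ] HSpace H).toLinearMap

/-- The continuous linear extension to `𝓗^H` of the operator `K_H^{*,(k)}` on elementary
functions. -/
def kStarExt {k : ℕ} (H : Fin k → Hurst) :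
    HSpace H →L[ℝ] Lp ℝ 2 (volume : Measure (Fin k → ℝ)) :=
  (Elem.lift fun x => toL2 volume (kStar H (boxInd x))).extendOfNorm
    (UniformSpace.Completion.toComplL : Elem H →L[ℝ] HSpace H).toLinearMap

/-! ### The space `|𝓗^H|` -/

/-- The index set `C^{(>)}`. -/
abbrev Big {k : ℕ} (H : Fin k → Hurst) : Type := {i : Fin k // (1 / 2 : ℝ) < H i}

/-- The point `w` with `w i = v i` for `i ∈ C^{(>)}` and `w i = u i` for `i ∈ C^{(=)}`. -/
def mix {k : ℕ} (H : Fin k → Hurst) (u : Fin k → ℝ) (v : Big H → ℝ) (i : Fin k) : ℝ :=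
  if hi : (1 / 2 : ℝ) < H i then v ⟨i, hi⟩ else u i

/-- `∏_{i ∈ C^{(>)}} H_i (2 H_i - 1) |u_i - v_i|^{2 H_i - 2}`. -/
def weight {k : ℕ} (H : Fin k → Hurst) (u : Fin k → ℝ) (v : Big H → ℝ) : ℝ :=
  ∏ i : Big H, (H i : ℝ) * (2 * H i - 1) * |u i - v i| ^ (2 * (H i : ℝ) - 2)

/-- Membership in `|𝓗^H|`. The integration variable is `(u, v)` with `u ∈ ℝ^k` and
`v` indexed by `C^{(>)}`. -/
structure MemAbsHSpace {k : ℕ} (H : Fin k → Hurst) (φ : (Fin k → ℝ) → ℝ) : Prop where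
  aemeasurable : AEMeasurable φ volume
  lintegral_lt_top :
    ∫⁻ p : (Fin k → ℝ) × (Big H → ℝ),
      ENNReal.ofReal (weight H p.1 p.2 * (|φ p.1| * |φ (mix H p.1 p.2)|)) < ⊤

end FracField

end

/-!
Everything rests on two facts about the operator `K_h^*` on the line, with `a = h - 1/2`.

For `1/2 < h < 1` it is, up to the constant `c_h Γ(h + 1/2)`, the backward fractional integral of
order `a`. The Beta integral `∫ (u - y)_+^{a-1} (v - y)_+^{a-1} dy = B(a, 1 - 2a) |u - v|^{2a-1}`
and the reflection formula for `Γ` show that composing its kernel with the transpose gives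
`h (2h - 1) |u - v|^{2h-2}` (`lintegral_kKer_mul_kKer`). Hence `K_h^*` turns the energy of a pair of
functions into an `L²` pairing; applied to indicators, whose images are the Mandelbrot–van Ness
kernels, this is the covariance of fractional Brownian motion (`integral_mvnKernel_mul_mvnKernel`).

The images of the indicators are total in `L²(ℝ)` (`ae_eq_zero_of_integral_mul_mvnKernel_eq_zero`).
A function `f` orthogonal to all of them has a vanishing forward fractional integral. Pairing that
with `(b - u)_+^{-a} - (a' - u)_+^{-a}`, whose backward fractional integral is a multiple of the
indicator of `[a', b)`, gives `∫_{a'}^b f = 0` for all `a' < b`, so `f = 0`. For `h = 1/2` both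
facts are immediate.

In `ℝ^k` the image of `1_{[0,x]}` is a tensor product of the one-dimensional images, so its Gram
matrix is `R_H` (`inner_kStar_boxInd`) and totality passes to tensor products
(`dense_span_kStar_boxInd`). Therefore `K_H^{*,(k)}` extends to an isometry of `𝓗^H` *onto*
`L²(ℝ^k)`, and `𝓘 ∘ (K_H^{*,(k)})⁻¹` is an isometry `L²(ℝ^k) → L²(Ω)`. The field `W` is its value at
`1_{[0,x]}`. Its covariance is `⟨1_{[0,x]}, 1_{[0,y]}⟩`, and it is Gaussian because it lies in the
closed linear span of `B`, where characteristic functions pass to `L²` limits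
(`map_eq_gaussianReal_of_mem_topologicalClosure`). By uniqueness of extensions the isometry is the
Wiener integral of `W` (`wienerIntegral_eq`), and `𝓘 = (∫ · dW) ∘ K_H^{*,(k)}` holds by construction.

On `|𝓗^H|` one works with the positive operators and Tonelli's theorem: the energy identity in each
coordinate, together with the commutation of operators in different coordinates, gives
`∫ K f · K g = ∬ f(u) g(w(u,v)) ∏ H_i (2 H_i - 1) |u_i - v_i|^{2 H_i - 2}` for nonnegative `f, g`
(`lintegral_sliceOps_mul_sliceOps`, `energy_eq_lintegral_kOps_mul_kOps`). Finite energy makes the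
images square integrable and all intermediate integrals finite almost everywhere, so the signed case
follows by taking differences (`MemAbsHSpace.exists_sub`, `MemAbsHSpace.integrable_weight`).
-/

namespace FracField

/-! ### Beta integrals -/

@[fun_prop]
theorem measurable_posPow (a : ℝ) : Measurable fun t => posPow t a :=
  Measurable.ite measurableSet_Ioi (by fun_prop) measurable_const

theorem posPow_nonneg (t a : ℝ) : 0 ≤ posPow t a := by
  unfold posPow
  split_ifs with h
  · exact Real.rpow_nonneg h.le _
  · exact le_rfl

theorem posPow_of_pos {t : ℝ} (ht : 0 < t) (a : ℝ) : posPow t a = t ^ a := if_pos ht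

theorem posPow_of_nonpos {t : ℝ} (ht : t ≤ 0) (a : ℝ) : posPow t a = 0 := if_neg ht.not_gt

theorem lintegral_rpow_mul_one_sub_rpow {p q : ℝ} (hp : 0 < p) (hq : 0 < q) :
    ∫⁻ x in Ioo (0 : ℝ) 1, ENNReal.ofReal (x ^ (p - 1) * (1 - x) ^ (q - 1)) =
      ENNReal.ofReal (beta p q) := by
  have hb := beta_pos hp hq
  have h := lintegral_betaPDF_eq_one hp hq
  rw [lintegral_betaPDF] at h
  have : ∀ x : ℝ, ENNReal.ofReal (1 / beta p q * x ^ (p - 1) * (1 - x) ^ (q - 1)) =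
      ENNReal.ofReal (1 / beta p q) * ENNReal.ofReal (x ^ (p - 1) * (1 - x) ^ (q - 1)) :=
      fun x => by
    rw [← ENNReal.ofReal_mul (by positivity), mul_assoc]
  simp_rw [this] at h
  rw [lintegral_const_mul' _ _ ENNReal.ofReal_ne_top, one_div, ENNReal.ofReal_inv_of_pos hb,
    mul_comm, ← div_eq_mul_inv,
    ENNReal.div_eq_one_iff (by simpa using hb) ENNReal.ofReal_ne_top] at h
  exact h

/-- `∫_y^b (u - y)^{a-1} (b - u)^{-a} du` does not depend on `y < b`. -/
theorem lintegral_posPow_mul_posPow_compl {a : ℝ} (h0 : 0 < a) (h1 : a < 1) (y b : ℝ) :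
    ∫⁻ u, ENNReal.ofReal (posPow (b - u) (-a)) * ENNReal.ofReal (posPow (u - y) (a - 1)) =
      (Iio b).indicator (fun _ => ENNReal.ofReal (beta a (1 - a))) y := by
  rcases lt_or_ge y b with hy | hy
  · rw [indicator_of_mem (by exact hy), ← lintegral_rpow_mul_one_sub_rpow h0 (by linarith)]
    have hd : 0 < b - y := by linarith
    have hs : (fun x => y + (b - y) * x) '' Ioo 0 1 = Ioo y b := by
      ext u
      constructor
      · rintro ⟨x, ⟨hx0, hx1⟩, rfl⟩
        constructor <;> nlinarith
      · rintro ⟨hu0, hu1⟩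
        refine ⟨(u - y) / (b - y), ⟨div_pos (by linarith) hd, ?_⟩, ?_⟩
        · rw [div_lt_one hd]; linarith
        · field_simp; ring
    rw [← setLIntegral_eq_of_support_subset (s := Ioo y b), ← hs,
      lintegral_image_eq_lintegral_abs_deriv_mul (f' := fun _ => b - y) measurableSet_Ioo]
    · refine setLIntegral_congr_fun measurableSet_Ioo fun x hx => ?_
      have e1 : b - (y + (b - y) * x) = (b - y) * (1 - x) := by ring
      have e2 : y + (b - y) * x - y = (b - y) * x := by ring
      have h1x : 0 < 1 - x := by linarith [hx.2]
      have hx0 := hx.1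
      rw [e1, e2, posPow_of_pos (by positivity), posPow_of_pos (by positivity), abs_of_pos hd,
        ← ENNReal.ofReal_mul (by positivity), ← ENNReal.ofReal_mul (by positivity),
        Real.mul_rpow hd.le h1x.le, Real.mul_rpow hd.le hx0.le]
      congr 1
      have : (b - y) * ((b - y) ^ (-a) * (b - y) ^ (a - 1)) = 1 := by
        rw [← Real.rpow_add hd, show -a + (a - 1) = -1 by ring, Real.rpow_neg_one]
        field_simp
      have e3 : 1 - a - 1 = -a := by ring
      rw [e3]
      linear_combination (1 - x) ^ (-a) * x ^ (a - 1) * this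
    · intro x _
      simpa using ((hasDerivAt_id x).const_mul (b - y)).const_add y |>.hasDerivWithinAt
    · intro x _ x' _ hxx
      have : (b - y) * (x - x') = 0 := by simp only at hxx; linarith
      rcases mul_eq_zero.1 this with h | h <;> linarith
    · intro u hu
      simp only [Function.mem_support, ne_eq, mul_eq_zero, ENNReal.ofReal_eq_zero, not_or,
        not_le] at hu
      constructor
      · by_contra! h
        rw [posPow_of_nonpos (t := u - y) (by linarith)] at hu
        exact lt_irrefl _ hu.2
      · by_contra! h
        rw [posPow_of_nonpos (t := b - u) (by linarith)] at hu
        exact lt_irrefl _ hu.1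
  · rw [indicator_of_notMem (by simpa using hy)]
    refine (lintegral_congr fun u => ?_).trans lintegral_zero
    rcases le_or_gt b u with h | h
    · rw [posPow_of_nonpos (t := b - u) (by linarith)]; simp
    · rw [posPow_of_nonpos (t := u - y) (by linarith)]; simp

theorem lintegral_posPow_mul_posPow_of_lt {a : ℝ} (h0 : 0 < a) (h1 : a < 1 / 2) {u v : ℝ}
    (huv : u < v) :
    ∫⁻ y, ENNReal.ofReal (posPow (u - y) (a - 1)) * ENNReal.ofReal (posPow (v - y) (a - 1)) =
      ENNReal.ofReal (|u - v| ^ (2 * a - 1) * beta a (1 - 2 * a)) := by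
  have hd : 0 < v - u := by linarith
  have hbeta := beta_pos h0 (by linarith : 0 < 1 - 2 * a)
  rw [ENNReal.ofReal_mul (by positivity), ← lintegral_rpow_mul_one_sub_rpow h0 (by linarith),
    ← lintegral_const_mul' _ _ ENNReal.ofReal_ne_top]
  -- The substitution `y = u - (v - u) x / (1 - x)` maps the unit interval onto `(-∞, u)`.
  have hs : (fun x => u - (v - u) * (x / (1 - x))) '' Ioo 0 1 = Iio u := by
    ext y
    constructor
    · rintro ⟨x, ⟨hx0, hx1⟩, rfl⟩
      have : 0 < 1 - x := by linarith
      have : 0 < (v - u) * (x / (1 - x)) := by positivity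
      simp only [mem_Iio]; linarith
    · intro hy
      have hy : y < u := hy
      have h1 : 0 < u - y := by linarith
      have h2 : 0 < v - y := by linarith
      refine ⟨(u - y) / (v - y), ⟨by positivity, ?_⟩, ?_⟩
      · rw [div_lt_one h2]; linarith
      · have : 1 - (u - y) / (v - y) = (v - u) / (v - y) := by field_simp; ring
        simp only [this]
        field_simp; ring
  rw [← setLIntegral_eq_of_support_subset (s := Iio u), ← hs,
    lintegral_image_eq_lintegral_abs_deriv_mul (f' := fun x => -((v - u) * (1 / (1 - x) ^ 2)))
      measurableSet_Ioo]
  · refine setLIntegral_congr_fun measurableSet_Ioo fun x hx => ?_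
    have hx0 := hx.1
    have h1x : 0 < 1 - x := by linarith [hx.2]
    have e1 : u - (u - (v - u) * (x / (1 - x))) = (v - u) * (x * (1 - x)⁻¹) := by
      field_simp; ring
    have e2 : v - (u - (v - u) * (x / (1 - x))) = (v - u) * (1 - x)⁻¹ := by
      field_simp; ring
    rw [e1, e2, posPow_of_pos (by positivity), posPow_of_pos (by positivity), abs_neg,
      abs_of_pos (by positivity), ← ENNReal.ofReal_mul (by positivity),
      ← ENNReal.ofReal_mul (by positivity), ← ENNReal.ofReal_mul (by positivity),
      Real.mul_rpow hd.le (by positivity), Real.mul_rpow hd.le (by positivity),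
      Real.mul_rpow hx0.le (by positivity), Real.inv_rpow h1x.le, ← Real.rpow_neg h1x.le,
      abs_sub_comm, abs_of_pos hd]
    congr 1
    have f1 : (v - u) * ((v - u) ^ (a - 1) * (v - u) ^ (a - 1)) = (v - u) ^ (2 * a - 1) := by
      rw [← Real.rpow_add hd]
      nth_rewrite 1 [← Real.rpow_one (v - u)]
      rw [← Real.rpow_add hd]
      congr 1; ring
    have f2 : 1 / (1 - x) ^ 2 * ((1 - x) ^ (-(a - 1)) * (1 - x) ^ (-(a - 1))) =
        (1 - x) ^ (1 - 2 * a - 1) := by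
      rw [one_div, ← Real.rpow_natCast, ← Real.rpow_neg h1x.le, ← Real.rpow_add h1x,
        ← Real.rpow_add h1x]
      congr 1; push_cast; ring
    rw [← f1, ← f2]; ring
  · intro x hx
    have h1x : 1 - x ≠ 0 := by linarith [hx.2]
    have := (((hasDerivAt_id x).div ((hasDerivAt_id x).const_sub 1) h1x).const_mul
      (v - u)).const_sub u |>.hasDerivWithinAt (s := Ioo 0 1)
    convert! this using 1
    simp
  · intro x hx x' hx' hxx
    have h1x : 1 - x ≠ 0 := by linarith [hx.2]
    have h1x' : 1 - x' ≠ 0 := by linarith [hx'.2]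
    have : x / (1 - x) = x' / (1 - x') := by
      apply mul_left_cancel₀ hd.ne'
      simp only at hxx; linarith
    rw [div_eq_div_iff h1x h1x'] at this
    linarith
  · intro y hy
    by_contra! h
    rw [Function.mem_support, posPow_of_nonpos (t := u - y) (by simpa using h)] at hy
    simp at hy

/-- The Beta integral behind the covariance: `∫ (u - y)_+^{a-1} (v - y)_+^{a-1} dy` equals
`B(a, 1 - 2a) |u - v|^{2a-1}`. -/
theorem lintegral_posPow_mul_posPow {a : ℝ} (h0 : 0 < a) (h1 : a < 1 / 2) {u v : ℝ}
    (huv : u ≠ v) :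
    ∫⁻ y, ENNReal.ofReal (posPow (u - y) (a - 1)) * ENNReal.ofReal (posPow (v - y) (a - 1)) =
      ENNReal.ofReal (|u - v| ^ (2 * a - 1) * beta a (1 - 2 * a)) := by
  rcases lt_or_gt_of_ne huv with h | h
  · exact lintegral_posPow_mul_posPow_of_lt h0 h1 h
  · rw [abs_sub_comm, ← lintegral_posPow_mul_posPow_of_lt h0 h1 h]
    exact lintegral_congr fun y => mul_comm _ _

/-! ### The normalising constant -/

/-- The constant of the operator `K_h^*`. -/
noncomputable def kConst (h : ℝ) : ℝ := (h - 1 / 2) * mvnConst h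

theorem mvnConst_pos {h : ℝ} (h0 : 1 / 2 ≤ h) (h1 : h < 1) : 0 < mvnConst h := by
  unfold mvnConst
  have : 0 < Real.sin (Real.pi * h) := Real.sin_pos_of_pos_of_lt_pi
    (by have := Real.pi_pos; positivity) (by nlinarith [Real.pi_pos])
  have := Real.Gamma_pos_of_pos (by linarith : 0 < 2 * h + 1)
  have := Real.Gamma_pos_of_pos (by linarith : 0 < h + 1 / 2)
  positivity

theorem kConst_pos {h : ℝ} (h0 : 1 / 2 < h) (h1 : h < 1) : 0 < kConst h :=
  mul_pos (by linarith) (mvnConst_pos h0.le h1)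

/-- The reflection formula for `Γ` turns the Beta factor of the composed kernel into
`h (2h - 1)`. -/
theorem kConst_sq_mul_beta {h : ℝ} (h0 : 1 / 2 < h) (h1 : h < 1) :
    kConst h ^ 2 * beta (h - 1 / 2) (1 - 2 * (h - 1 / 2)) = h * (2 * h - 1) := by
  have hs : 0 < Real.sin (Real.pi * h) := Real.sin_pos_of_pos_of_lt_pi
    (by have := Real.pi_pos; positivity) (by nlinarith [Real.pi_pos])
  have hG1 := Real.Gamma_pos_of_pos (by linarith : 0 < h - 1 / 2)
  have hG2 := Real.Gamma_pos_of_pos (by linarith : 0 < 1 - (h - 1 / 2))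
  have hG3 := Real.Gamma_pos_of_pos (by linarith : 0 < 2 * h - 1)
  have hG4 := Real.Gamma_pos_of_pos (by linarith : 0 < 1 - (2 * h - 1))
  have g1 : Real.Gamma (h + 1 / 2) = (h - 1 / 2) * Real.Gamma (h - 1 / 2) := by
    rw [← Real.Gamma_add_one (by linarith)]; congr 1; ring
  have g2 : Real.Gamma (2 * h + 1) = 2 * h * ((2 * h - 1) * Real.Gamma (2 * h - 1)) := by
    rw [Real.Gamma_add_one (by linarith), ← Real.Gamma_add_one (s := 2 * h - 1) (by linarith)]
    congr 2; ring
  have r1 := Real.Gamma_mul_Gamma_one_sub (h - 1 / 2)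
  have r2 := Real.Gamma_mul_Gamma_one_sub (2 * h - 1)
  have s1 : Real.sin (Real.pi * (h - 1 / 2)) = - Real.cos (Real.pi * h) := by
    rw [show Real.pi * (h - 1 / 2) = Real.pi * h - Real.pi / 2 by ring, Real.sin_sub_pi_div_two]
  have s2 : Real.sin (Real.pi * (2 * h - 1)) =
      - (2 * Real.sin (Real.pi * h) * Real.cos (Real.pi * h)) := by
    rw [show Real.pi * (2 * h - 1) = 2 * (Real.pi * h) - Real.pi by ring, Real.sin_sub_pi,
      Real.sin_two_mul]
  have hc : 0 < - Real.cos (Real.pi * h) := by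
    rw [← s1]
    exact Real.sin_pos_of_pos_of_lt_pi (by nlinarith [Real.pi_pos]) (by nlinarith [Real.pi_pos])
  rw [s1] at r1
  rw [s2] at r2
  have hc' : Real.cos (Real.pi * h) ≠ 0 := by linarith
  have e1 : kConst h ^ 2 = Real.Gamma (2 * h + 1) * Real.sin (Real.pi * h) /
      Real.Gamma (h - 1 / 2) ^ 2 := by
    have hpos : 0 ≤ Real.Gamma (2 * h + 1) * Real.sin (Real.pi * h) :=
      mul_nonneg (Real.Gamma_pos_of_pos (by linarith)).le hs.le
    unfold kConst mvnConst
    rw [mul_pow, div_pow, Real.sq_sqrt hpos, g1]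
    have : h - 1 / 2 ≠ 0 := by linarith
    have := hG1.ne'
    generalize Real.Gamma (h - 1 / 2) = G at *
    generalize h - 1 / 2 = a at *
    field_simp
  have e2 : beta (h - 1 / 2) (1 - 2 * (h - 1 / 2)) = Real.Gamma (h - 1 / 2) *
      Real.Gamma (1 - (2 * h - 1)) / Real.Gamma (1 - (h - 1 / 2)) := by
    unfold beta
    congr 2
    · congr 1; ring
    · ring
  rw [e1, e2, g2]
  have r1' : Real.Gamma (1 - (h - 1 / 2)) = Real.pi / (-Real.cos (Real.pi * h)) /
      Real.Gamma (h - 1 / 2) := by rw [← r1, mul_div_cancel_left₀ _ hG1.ne']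
  have r2' : Real.Gamma (1 - (2 * h - 1)) =
      Real.pi / (-(2 * Real.sin (Real.pi * h) * Real.cos (Real.pi * h))) /
      Real.Gamma (2 * h - 1) := by rw [← r2, mul_div_cancel_left₀ _ hG3.ne']
  rw [r1', r2']
  have := Real.pi_pos.ne'
  have := hG1.ne'
  have := hG3.ne'
  have := hs.ne'
  generalize Real.Gamma (h - 1 / 2) = G at *
  generalize Real.Gamma (2 * h - 1) = G' at *
  generalize Real.sin (Real.pi * h) = S at *
  generalize Real.cos (Real.pi * h) = C at *
  field_simp

/-- The kernel `u, y ↦ (h - 1/2) c_h (u - y)_+^{h - 3/2}` of `K_h^*`. -/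
noncomputable def kKer (h y u : ℝ) : ENNReal :=
  ENNReal.ofReal (kConst h * posPow (u - y) (h - 3 / 2))

/-- The kernel `h (2h - 1) |u - v|^{2h - 2}`. -/
noncomputable def wKer (h u v : ℝ) : ENNReal :=
  ENNReal.ofReal (h * (2 * h - 1) * |u - v| ^ (2 * h - 2))

@[fun_prop]
theorem measurable_kKer {α : Type*} [MeasurableSpace α] (h : ℝ) {f g : α → ℝ}
    (hf : Measurable f) (hg : Measurable g) : Measurable fun p => kKer h (f p) (g p) := by
  unfold kKer; fun_prop

@[fun_prop]
theorem measurable_wKer {α : Type*} [MeasurableSpace α] (h : ℝ) {f g : α → ℝ}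
    (hf : Measurable f) (hg : Measurable g) : Measurable fun p => wKer h (f p) (g p) := by
  unfold wKer; fun_prop

/-- Composing the kernel of `K_h^*` with its transpose gives `h (2h - 1) |u - v|^{2h - 2}`.
For `u = v` the left side is `∞` and the right side is the value of `0 ^ (2h - 2)`, which is `0`. -/
theorem lintegral_kKer_mul_kKer {h : ℝ} (h0 : 1 / 2 < h) (h1 : h < 1) {u v : ℝ} (huv : u ≠ v) :
    ∫⁻ y, kKer h y u * kKer h y v = wKer h u v := by
  have hk := kConst_pos h0 h1
  have e : ∀ y, kKer h y u * kKer h y v = ENNReal.ofReal (kConst h ^ 2) *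
      (ENNReal.ofReal (posPow (u - y) (h - 1 / 2 - 1)) *
        ENNReal.ofReal (posPow (v - y) (h - 1 / 2 - 1))) := fun y => by
    have := posPow_nonneg (u - y) (h - 1 / 2 - 1)
    have := posPow_nonneg (v - y) (h - 1 / 2 - 1)
    unfold kKer
    rw [show h - 3 / 2 = h - 1 / 2 - 1 by ring, ← ENNReal.ofReal_mul (by positivity),
      ← ENNReal.ofReal_mul (by positivity), ← ENNReal.ofReal_mul (by positivity)]
    congr 1; ring
  simp_rw [e]
  rw [lintegral_const_mul' _ _ ENNReal.ofReal_ne_top,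
    lintegral_posPow_mul_posPow (by linarith) (by linarith) huv,
    ← ENNReal.ofReal_mul (by positivity), wKer]
  congr 1
  rw [← kConst_sq_mul_beta h0 h1, show 2 * h - 2 = 2 * (h - 1 / 2) - 1 by ring]
  ring

/-! ### Integration against signed indicators -/

theorem signedInd_ae_eq_of_nonneg {x : ℝ} (hx : 0 ≤ x) :
    signedInd x =ᵐ[volume] (Ioc 0 x).indicator 1 := by
  filter_upwards [Measure.ae_ne volume 0] with t ht
  simp only [signedInd, indicator, mem_Ioc, Pi.one_apply]
  grind

theorem signedInd_ae_eq_of_nonpos {x : ℝ} (hx : x ≤ 0) :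
    signedInd x =ᵐ[volume] -(Ioc x 0).indicator 1 := by
  filter_upwards [Measure.ae_ne volume 0, Measure.ae_ne volume x] with t ht htx
  simp only [signedInd, indicator, mem_Ioc, Pi.one_apply, Pi.neg_apply]
  grind

theorem integrable_signedInd_mul {f : ℝ → ℝ} {x : ℝ} (hf : IntervalIntegrable f volume 0 x) :
    Integrable fun u => signedInd x u * f u := by
  rcases le_total 0 x with hx | hx
  · refine (((intervalIntegrable_iff_integrableOn_Ioc_of_le hx).1 hf).integrable_indicator
      measurableSet_Ioc).congr ?_
    filter_upwards [signedInd_ae_eq_of_nonneg hx] with u hu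
    rw [hu]; by_cases h : u ∈ Ioc 0 x <;> simp [h]
  · refine (((intervalIntegrable_iff_integrableOn_Ioc_of_le hx).1 hf.symm).integrable_indicator
      measurableSet_Ioc).neg.congr ?_
    filter_upwards [signedInd_ae_eq_of_nonpos hx] with u hu
    rw [hu]; by_cases h : u ∈ Ioc x 0 <;> simp [h]

theorem integral_signedInd_mul (f : ℝ → ℝ) (x : ℝ) :
    ∫ u, signedInd x u * f u = ∫ u in (0 : ℝ)..x, f u := by
  rcases le_total 0 x with hx | hx
  · rw [intervalIntegral.integral_of_le hx, ← integral_indicator measurableSet_Ioc]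
    refine integral_congr_ae ?_
    filter_upwards [signedInd_ae_eq_of_nonneg hx] with u hu
    rw [hu]; by_cases h : u ∈ Ioc 0 x <;> simp [h]
  · rw [intervalIntegral.integral_of_ge hx, ← integral_indicator measurableSet_Ioc, ← integral_neg]
    refine integral_congr_ae ?_
    filter_upwards [signedInd_ae_eq_of_nonpos hx] with u hu
    rw [hu]; by_cases h : u ∈ Ioc x 0 <;> simp [h]

/-! ### The Mandelbrot–van Ness kernel as a fractional integral -/

theorem intervalIntegrable_posPow {r : ℝ} (hr : -1 < r) (y a b : ℝ) :
    IntervalIntegrable (fun u => posPow (u - y) r) volume a b := by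
  have h : IntervalIntegrable (fun u => posPow u r) volume (a - y) (b - y) := by
    have := intervalIntegral.intervalIntegrable_rpow' (a := a - y) (b := b - y) hr
    rw [intervalIntegrable_iff] at this ⊢
    refine (this.indicator (measurableSet_Ioi (a := (0 : ℝ)))).congr_fun (fun u _ => ?_)
      measurableSet_uIoc
    by_cases hu : 0 < u <;> simp [posPow, hu]
  simpa using h.comp_sub_right y

theorem integral_posPow {r : ℝ} (hr : 0 < r) (y a b : ℝ) :
    ∫ u in a..b, posPow (u - y) (r - 1) = (posPow (b - y) r - posPow (a - y) r) / r := by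
  have hcont : Continuous fun u => posPow u r / r := by
    have : (fun u => posPow u r / r) = fun u => (max u 0) ^ r / r := by
      ext u
      rcases lt_or_ge 0 u with h | h
      · rw [posPow_of_pos h, max_eq_left h.le]
      · rw [posPow_of_nonpos h, max_eq_right h, Real.zero_rpow hr.ne']
    rw [this]
    exact ((continuous_id.max continuous_const).rpow_const fun _ => Or.inr hr.le).div_const _
  have hd : ∀ u ∈ Ioo (min a b) (max a b) \ {y},
      HasDerivAt (fun u => posPow (u - y) r / r) (posPow (u - y) (r - 1)) u := by
    intro u hu
    have huy : u ≠ y := hu.2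
    rcases lt_or_gt_of_ne huy with h | h
    · rw [posPow_of_nonpos (by linarith)]
      refine (hasDerivAt_const u (0 : ℝ)).congr_of_eventuallyEq ?_
      filter_upwards [Iio_mem_nhds h] with t ht
      have ht : t < y := ht
      rw [posPow_of_nonpos (by linarith), zero_div]
    · rw [posPow_of_pos (by linarith)]
      have h1 := ((Real.hasDerivAt_rpow_const (p := r) (x := u - y)
        (Or.inl (by linarith))).comp u ((hasDerivAt_id u).sub_const y)).div_const r
      have h2 : r * (u - y) ^ (r - 1) * 1 / r = (u - y) ^ (r - 1) := by field_simp
      rw [h2] at h1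
      refine h1.congr_of_eventuallyEq ?_
      filter_upwards [Ioi_mem_nhds h] with t ht
      have ht : y < t := ht
      rw [posPow_of_pos (by linarith)]; rfl
  rw [integral_eq_of_hasDerivAt_off_countable (fun u => posPow (u - y) r / r) _
    (countable_singleton y) (hcont.comp (continuous_id.sub continuous_const)).continuousOn hd
    (intervalIntegrable_posPow (by linarith) y a b)]
  ring

theorem mvnKernel_zero (h y : ℝ) : mvnKernel h 0 y = 0 := by
  simp [mvnKernel]

theorem measurable_mvnKernel (h x : ℝ) : Measurable (mvnKernel h x) :=
  (((measurable_posPow _).comp (measurable_const.sub measurable_id)).sub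
    ((measurable_posPow _).comp measurable_neg)).const_mul _

/-- The increment of the Mandelbrot–van Ness kernel is `K_h^*` applied to `1_{(a,b]}`. -/
theorem mvnKernel_sub_eq_integral {h : ℝ} (h0 : 1 / 2 < h) (a b y : ℝ) :
    mvnKernel h b y - mvnKernel h a y =
      kConst h * ∫ u in a..b, posPow (u - y) (h - 3 / 2) := by
  have h2 : h - 1 / 2 ≠ 0 := by linarith
  rw [show h - 3 / 2 = h - 1 / 2 - 1 by ring, integral_posPow (by linarith), mvnKernel, mvnKernel,
    kConst, mul_right_comm, mul_div_cancel₀ _ h2]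
  ring

theorem kConst_mul_integral_signedInd {h : ℝ} (h0 : 1 / 2 < h) (x y : ℝ) :
    kConst h * ∫ u, signedInd x u * posPow (u - y) (h - 3 / 2) = mvnKernel h x y := by
  rw [integral_signedInd_mul, ← mvnKernel_sub_eq_integral h0, mvnKernel_zero, sub_zero]

theorem mvnConst_half : mvnConst (1 / 2) = 1 := by
  have h1 : (2 : ℝ) * (1 / 2) + 1 = 1 + 1 := by norm_num
  have h2 : (1 : ℝ) / 2 + 1 / 2 = 1 := by norm_num
  have h3 : Real.pi * (1 / 2) = Real.pi / 2 := by ring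
  rw [mvnConst, h1, h2, h3, Real.sin_pi_div_two, Real.Gamma_add_one one_ne_zero, Real.Gamma_one]
  simp

/-- At `h = 1/2` the convention that `t_+^0` vanishes for `t ≤ 0` makes the kernel a difference of
indicators of half-lines. -/
theorem mvnKernel_half (x y : ℝ) :
    mvnKernel (1 / 2) x y = (Iio x).indicator 1 y - (Iio 0).indicator 1 y := by
  rw [mvnKernel, mvnConst_half]
  simp [posPow, indicator, sub_pos]

theorem mvnKernel_half_ae_eq (x : ℝ) : mvnKernel (1 / 2) x =ᵐ[volume] signedInd x := by
  filter_upwards [Measure.ae_ne volume 0, Measure.ae_ne volume x] with t ht htx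
  simp only [mvnKernel_half, signedInd, indicator, mem_Iio, Pi.one_apply]
  grind

/-! ### The second moments of the kernels -/

theorem lintegral_kKer_comp {h : ℝ} (h0 : 1 / 2 < h) (h1 : h < 1) {f : ℝ → ENNReal}
    (hf : Measurable f) (u : ℝ) :
    ∫⁻ y, (∫⁻ v, f v * kKer h y v) * kKer h y u = ∫⁻ v, f v * wKer h u v := by
  calc ∫⁻ y, (∫⁻ v, f v * kKer h y v) * kKer h y u
      = ∫⁻ y, ∫⁻ v, f v * (kKer h y u * kKer h y v) := by
        refine lintegral_congr fun y => ?_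
        rw [← lintegral_mul_const _ (by fun_prop)]
        exact lintegral_congr fun v => by ring
    _ = ∫⁻ v, ∫⁻ y, f v * (kKer h y u * kKer h y v) := by
        refine lintegral_lintegral_swap (Measurable.aemeasurable ?_)
        unfold Function.uncurry; fun_prop
    _ = ∫⁻ v, f v * wKer h u v := by
        refine lintegral_congr_ae ?_
        filter_upwards [Measure.ae_ne volume u] with v hv
        rw [lintegral_const_mul _ (by fun_prop),
          lintegral_kKer_mul_kKer h0 h1 hv.symm]

theorem intervalIntegrable_abs_sub_rpow {r : ℝ} (hr : -1 < r) (u a b : ℝ) :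
    IntervalIntegrable (fun v => |u - v| ^ r) volume a b := by
  have h : IntervalIntegrable (fun v => posPow (v - u) r + posPow (-v - -u) r) volume a b := by
    refine (intervalIntegrable_posPow hr u a b).add ?_
    have := (intervalIntegrable_posPow hr 0 (u - a) (u - b)).comp_sub_left u
    simp only [sub_sub_cancel, sub_zero] at this
    exact this.congr (fun v _ => by ring_nf)
  refine h.congr_ae ?_
  filter_upwards [ae_restrict_of_ae (Measure.ae_ne volume u)] with v hv
  rcases lt_or_gt_of_ne hv with h | h
  · rw [posPow_of_nonpos (by linarith), posPow_of_pos (by linarith), abs_of_pos (by linarith)]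
    ring_nf
  · rw [posPow_of_pos (by linarith), posPow_of_nonpos (by linarith), abs_of_neg (by linarith)]
    ring_nf

theorem integral_abs_sub_rpow {r : ℝ} (hr : 0 < r) {u a b : ℝ} (ha : a ≤ u) (hb : u ≤ b) :
    ∫ v in a..b, |u - v| ^ (r - 1) = ((u - a) ^ r + (b - u) ^ r) / r := by
  rw [← intervalIntegral.integral_add_adjacent_intervals
    (intervalIntegrable_abs_sub_rpow (by linarith) u a u)
    (intervalIntegrable_abs_sub_rpow (by linarith) u u b)]
  have e1 : ∫ v in a..u, |u - v| ^ (r - 1) = (u - a) ^ r / r := by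
    rw [intervalIntegral.integral_comp_sub_left (fun t => |t| ^ (r - 1)) u, sub_self,
      intervalIntegral.integral_congr (g := fun t => t ^ (r - 1)),
      integral_rpow (Or.inl (by linarith)), sub_add_cancel, Real.zero_rpow hr.ne', sub_zero]
    intro t ht
    rw [uIcc_of_le (by linarith)] at ht
    simp only [abs_of_nonneg ht.1]
  have e2 : ∫ v in u..b, |u - v| ^ (r - 1) = (b - u) ^ r / r := by
    simp_rw [abs_sub_comm u]
    rw [intervalIntegral.integral_comp_sub_right (fun t => |t| ^ (r - 1)) u, sub_self,
      intervalIntegral.integral_congr (g := fun t => t ^ (r - 1)),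
      integral_rpow (Or.inl (by linarith)), sub_add_cancel, Real.zero_rpow hr.ne', sub_zero]
    intro t ht
    rw [uIcc_of_le (by linarith)] at ht
    simp only [abs_of_nonneg ht.1]
  rw [e1, e2]; ring

theorem lintegral_ofReal_Ioc {f : ℝ → ℝ} {a b : ℝ} (hab : a ≤ b)
    (hf : IntervalIntegrable f volume a b) (h0 : ∀ u, 0 ≤ f u) :
    ∫⁻ u in Ioc a b, ENNReal.ofReal (f u) = ENNReal.ofReal (∫ u in a..b, f u) := by
  rw [intervalIntegral.integral_of_le hab, ofReal_integral_eq_lintegral_ofReal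
    ((intervalIntegrable_iff_integrableOn_Ioc_of_le hab).1 hf) (.of_forall h0)]

theorem lintegral_wKer_Ioc {h : ℝ} (h0 : 1 / 2 < h) {a b : ℝ} (hab : a ≤ b) :
    ∫⁻ u in Ioc a b, ∫⁻ v in Ioc a b, wKer h u v = ENNReal.ofReal ((b - a) ^ (2 * h)) := by
  have hr : 0 < 2 * h - 1 := by linarith
  have e : ∀ u ∈ Ioc a b, ∫⁻ v in Ioc a b, wKer h u v =
      ENNReal.ofReal (h * ((u - a) ^ (2 * h - 1) + (b - u) ^ (2 * h - 1))) := by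
    intro u hu
    have : ∀ v, 0 ≤ h * (2 * h - 1) * |u - v| ^ (2 * h - 2) := fun v => by positivity
    unfold wKer
    rw [lintegral_ofReal_Ioc hab
      ((intervalIntegrable_abs_sub_rpow (by linarith) u a b).const_mul _) this,
      intervalIntegral.integral_const_mul, show 2 * h - 2 = 2 * h - 1 - 1 by ring,
      integral_abs_sub_rpow hr hu.1.le hu.2]
    congr 1
    rw [mul_assoc, mul_div_cancel₀ _ hr.ne']
  rw [setLIntegral_congr_fun measurableSet_Ioc e]
  have i1 : IntervalIntegrable (fun u => (u - a) ^ (2 * h - 1)) volume a b := by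
    have := (intervalIntegral.intervalIntegrable_rpow' (a := 0) (b := b - a)
      (r := 2 * h - 1) (by linarith)).comp_sub_right a
    simpa using this
  have i2 : IntervalIntegrable (fun u => (b - u) ^ (2 * h - 1)) volume a b := by
    have := (intervalIntegral.intervalIntegrable_rpow' (a := b - a) (b := 0)
      (r := 2 * h - 1) (by linarith)).comp_sub_left b
    simpa using this
  have e1 : ∫ u in a..b, (u - a) ^ (2 * h - 1) = (b - a) ^ (2 * h) / (2 * h) := by
    rw [intervalIntegral.integral_comp_sub_right (fun t => t ^ (2 * h - 1)) a, sub_self,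
      integral_rpow (Or.inl (by linarith)), sub_add_cancel, Real.zero_rpow (by linarith), sub_zero]
  have e2 : ∫ u in a..b, (b - u) ^ (2 * h - 1) = (b - a) ^ (2 * h) / (2 * h) := by
    rw [intervalIntegral.integral_comp_sub_left (fun t => t ^ (2 * h - 1)) b, sub_self,
      integral_rpow (Or.inl (by linarith)), sub_add_cancel, Real.zero_rpow (by linarith), sub_zero]
  have hIoc : ∀ u ∈ Ioc a b, 0 ≤ h * ((u - a) ^ (2 * h - 1) + (b - u) ^ (2 * h - 1)) :=
    fun u hu => mul_nonneg (by linarith) (add_nonneg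
      (Real.rpow_nonneg (by linarith [hu.1]) _) (Real.rpow_nonneg (by linarith [hu.2]) _))
  rw [← ofReal_integral_eq_lintegral_ofReal
    ((intervalIntegrable_iff_integrableOn_Ioc_of_le hab).1 ((i1.add i2).const_mul h))
    ((ae_restrict_iff' measurableSet_Ioc).2 (.of_forall hIoc)),
    ← intervalIntegral.integral_of_le hab, intervalIntegral.integral_const_mul,
    intervalIntegral.integral_add i1 i2, e1, e2]
  congr 1
  field_simp
  ring

theorem mvnKernel_sub_nonneg {h : ℝ} (h0 : 1 / 2 ≤ h) (h1 : h < 1) {a b : ℝ} (hab : a ≤ b)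
    (y : ℝ) : 0 ≤ mvnKernel h b y - mvnKernel h a y := by
  have := mvnConst_pos h0 h1
  have hmono : posPow (a - y) (h - 1 / 2) ≤ posPow (b - y) (h - 1 / 2) := by
    rcases le_or_gt (a - y) 0 with h | h
    · rw [posPow_of_nonpos h]; exact posPow_nonneg _ _
    · rw [posPow_of_pos h, posPow_of_pos (by linarith)]
      exact Real.rpow_le_rpow h.le (by linarith) (by linarith)
  unfold mvnKernel
  nlinarith

theorem ofReal_mvnKernel_sub {h : ℝ} (h0 : 1 / 2 < h) (h1 : h < 1) {a b : ℝ} (hab : a ≤ b)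
    (y : ℝ) : ENNReal.ofReal (mvnKernel h b y - mvnKernel h a y) =
      ∫⁻ u, (Ioc a b).indicator 1 u * kKer h y u := by
  have hk := kConst_pos h0 h1
  rw [mvnKernel_sub_eq_integral h0, ← intervalIntegral.integral_const_mul,
    ← lintegral_ofReal_Ioc hab ((intervalIntegrable_posPow (by linarith) y a b).const_mul _)
    fun u => mul_nonneg hk.le (posPow_nonneg _ _), ← lintegral_indicator measurableSet_Ioc]
  refine lintegral_congr fun u => ?_
  by_cases hu : u ∈ Ioc a b <;> simp [hu, kKer]

/-- The variance of an increment of fractional Brownian motion. For `h > 1/2` the increment of the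
kernel is `K_h^* 1_{(a,b]}`, so that the energy identity reduces the integral to
`∬ h (2h - 1) |u - v|^{2h - 2} du dv` over `(a, b]²`. -/
theorem lintegral_mvnKernel_sub_sq {h : ℝ} (h0 : 1 / 2 ≤ h) (h1 : h < 1) {a b : ℝ} (hab : a ≤ b) :
    ∫⁻ y, ENNReal.ofReal ((mvnKernel h b y - mvnKernel h a y) ^ 2) =
      ENNReal.ofReal ((b - a) ^ (2 * h)) := by
  rcases h0.eq_or_lt with rfl | h0
  · have e : ∀ y, ENNReal.ofReal ((mvnKernel (1 / 2) b y - mvnKernel (1 / 2) a y) ^ 2) =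
        (Ico a b).indicator 1 y := fun y => by
      simp only [mvnKernel_half, indicator, mem_Iio, mem_Ico, Pi.one_apply]
      split_ifs <;> first | (exfalso; grind) | simp
    simp_rw [e]
    rw [lintegral_indicator_one measurableSet_Ico, Real.volume_Ico]
    norm_num
  · have hI : Measurable ((Ioc a b).indicator (1 : ℝ → ENNReal)) :=
      measurable_one.indicator measurableSet_Ioc
    rw [← lintegral_wKer_Ioc h0 hab]
    calc ∫⁻ y, ENNReal.ofReal ((mvnKernel h b y - mvnKernel h a y) ^ 2)
        = ∫⁻ y, ∫⁻ u, (Ioc a b).indicator 1 u *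
            ((∫⁻ v, (Ioc a b).indicator 1 v * kKer h y v) * kKer h y u) := by
          refine lintegral_congr fun y => ?_
          rw [sq, ENNReal.ofReal_mul (mvnKernel_sub_nonneg h0.le h1 hab y),
            ofReal_mvnKernel_sub h0 h1 hab, ← lintegral_const_mul _ (by fun_prop)]
          exact lintegral_congr fun u => by ring
      _ = ∫⁻ u, ∫⁻ y, (Ioc a b).indicator 1 u *
            ((∫⁻ v, (Ioc a b).indicator 1 v * kKer h y v) * kKer h y u) := by
          refine lintegral_lintegral_swap (Measurable.aemeasurable ?_)
          have : Measurable fun y => ∫⁻ v, (Ioc a b).indicator 1 v * kKer h y v :=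
            Measurable.lintegral_prod_right (by fun_prop)
          unfold Function.uncurry; fun_prop
      _ = ∫⁻ u in Ioc a b, ∫⁻ v in Ioc a b, wKer h u v := by
          rw [← lintegral_indicator measurableSet_Ioc]
          refine lintegral_congr fun u => ?_
          rw [lintegral_const_mul' _ _ (by by_cases hu : u ∈ Ioc a b <;> simp [hu]),
            lintegral_kKer_comp h0 h1 hI]
          by_cases hu : u ∈ Ioc a b
          · simp only [hu, indicator_of_mem, Pi.one_apply, one_mul]
            rw [← lintegral_indicator measurableSet_Ioc]
            refine lintegral_congr fun v => ?_
            by_cases hv : v ∈ Ioc a b <;> simp [hv]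
          · simp [hu]

theorem memLp_mvnKernel_sub {h : ℝ} (h0 : 1 / 2 ≤ h) (h1 : h < 1) (a b : ℝ) :
    MemLp (fun y => mvnKernel h b y - mvnKernel h a y) 2 volume := by
  wlog hab : a ≤ b generalizing a b
  · refine (this b a (le_of_not_ge hab)).neg.ae_eq (.of_forall fun y => ?_)
    simp
  have hm : Measurable fun y => mvnKernel h b y - mvnKernel h a y :=
    (measurable_mvnKernel h b).sub (measurable_mvnKernel h a)
  rw [memLp_two_iff_integrable_sq hm.aestronglyMeasurable]
  refine ⟨(hm.pow_const 2).aestronglyMeasurable, ?_⟩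
  rw [hasFiniteIntegral_iff_ofReal (.of_forall fun y => sq_nonneg _),
    lintegral_mvnKernel_sub_sq h0 h1 hab]
  exact ENNReal.ofReal_lt_top

theorem memLp_mvnKernel {h : ℝ} (h0 : 1 / 2 ≤ h) (h1 : h < 1) (x : ℝ) :
    MemLp (mvnKernel h x) 2 volume := by
  simpa [mvnKernel_zero] using memLp_mvnKernel_sub h0 h1 0 x

theorem integral_mvnKernel_sub_sq {h : ℝ} (h0 : 1 / 2 ≤ h) (h1 : h < 1) (a b : ℝ) :
    ∫ y, (mvnKernel h b y - mvnKernel h a y) ^ 2 = |b - a| ^ (2 * h) := by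
  wlog hab : a ≤ b generalizing a b
  · rw [abs_sub_comm, ← this b a (le_of_not_ge hab)]
    exact integral_congr_ae (.of_forall fun y => by simp only; ring)
  rw [integral_eq_lintegral_of_nonneg_ae (.of_forall fun y => sq_nonneg _)
    (memLp_mvnKernel_sub h0 h1 a b).integrable_sq.aestronglyMeasurable,
    lintegral_mvnKernel_sub_sq h0 h1 hab, abs_of_nonneg (by linarith), ENNReal.toReal_ofReal]
  exact Real.rpow_nonneg (by linarith) _

/-- The covariance of fractional Brownian motion, by polarisation from the variance of increments. -/
theorem integral_mvnKernel_mul_mvnKernel {h : ℝ} (h0 : 1 / 2 ≤ h) (h1 : h < 1) (s t : ℝ) :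
    ∫ y, mvnKernel h s y * mvnKernel h t y = covR h s t := by
  have e : ∀ y, mvnKernel h s y * mvnKernel h t y = ((mvnKernel h s y - mvnKernel h 0 y) ^ 2 +
      (mvnKernel h t y - mvnKernel h 0 y) ^ 2 - (mvnKernel h s y - mvnKernel h t y) ^ 2) / 2 :=
    fun y => by rw [mvnKernel_zero]; ring
  have i := fun a b => (memLp_mvnKernel_sub h0 h1 a b).integrable_sq
  simp_rw [e]
  have e2 := integral_sub ((i 0 s).add (i 0 t)) (i t s)
  simp only [Pi.add_apply] at e2
  rw [integral_div, e2, integral_add (i 0 s) (i 0 t)]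
  simp only [integral_mvnKernel_sub_sq h0 h1, sub_zero, covR]

theorem covR_half (s t : ℝ) : covR (1 / 2) s t = wedge s t := by
  have e : (2 : ℝ) * (1 / 2) = 1 := by norm_num
  simp only [covR, wedge, e, Real.rpow_one]
  grind

/-! ### Totality of the Mandelbrot–van Ness kernels in `L²(ℝ)` -/

open Filter Topology in
/-- By the Lebesgue differentiation theorem, a locally integrable function whose integral over
every closed ball vanishes is zero almost everywhere. -/
theorem ae_eq_zero_of_setIntegral_closedBall_eq_zero {X : Type*} [PseudoMetricSpace X]
    [MeasurableSpace X] [SecondCountableTopology X] [BorelSpace X] {μ : Measure X}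
    [IsLocallyFiniteMeasure μ] [IsUnifLocDoublingMeasure μ] {f : X → ℝ}
    (hf : LocallyIntegrable f μ) (h : ∀ x r, 0 < r → ∫ y in Metric.closedBall x r, f y ∂μ = 0) :
    f =ᵐ[μ] 0 := by
  filter_upwards [IsUnifLocDoublingMeasure.ae_tendsto_average μ hf 1] with x hx
  have h1 := hx (fun _ : ℝ => x) (fun r => r) (l := 𝓝[>] 0) tendsto_id (by
    filter_upwards [self_mem_nhdsWithin] with r hr
    exact Metric.mem_closedBall_self (by have : (0 : ℝ) < r := hr; linarith))
  refine tendsto_nhds_unique h1 (tendsto_const_nhds.congr' ?_)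
  filter_upwards [self_mem_nhdsWithin] with r hr
  rw [setAverage_eq, h x r hr, smul_zero, Pi.zero_apply]

theorem ae_eq_zero_of_integral_Ioc_eq_zero {f : ℝ → ℝ}
    (hf : ∀ a b, IntegrableOn f (Ioc a b)) (h : ∀ a b, a ≤ b → ∫ y in Ioc a b, f y = 0) :
    f =ᵐ[volume] 0 := by
  refine ae_eq_zero_of_setIntegral_closedBall_eq_zero ?_ fun x r hr => ?_
  · intro x
    exact ⟨Ioc (x - 1) (x + 1), Ioc_mem_nhds (by linarith) (by linarith), hf _ _⟩
  · rw [Real.closedBall_eq_Icc, integral_Icc_eq_integral_Ioc]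
    exact h _ _ (by linarith)

theorem ennreal_mul_le_sq_add_sq (a b : ENNReal) : a * b ≤ a ^ 2 + b ^ 2 := by
  rcases le_total a b with h | h
  · calc a * b ≤ b * b := by gcongr
      _ = b ^ 2 := (sq b).symm
      _ ≤ _ := le_add_self
  · calc a * b ≤ a * a := by gcongr
      _ = a ^ 2 := (sq a).symm
      _ ≤ _ := le_self_add

theorem lintegral_enorm_sq_lt_top {α : Type*} [MeasurableSpace α] {μ : Measure α} {f : α → ℝ}
    (hf : MemLp f 2 μ) : ∫⁻ y, ‖f y‖ₑ ^ 2 ∂μ < ⊤ := by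
  have := hf.integrable_sq.2
  unfold HasFiniteIntegral at this
  simpa [enorm_pow] using this

/-- The condition that makes Fubini's theorem applicable to `∬ f(y) φ(u) k(y,u) dy du`: the
integral of `|φ|` against the kernel is square integrable. -/
theorem integrable_mul_kernel {h : ℝ} (h0 : 1 / 2 < h) (h1 : h < 1) {f φ : ℝ → ℝ}
    (hf : MemLp f 2 volume) (hφ : Measurable φ)
    (hK : ∫⁻ y, (∫⁻ u, ‖φ u‖ₑ * kKer h y u) ^ 2 < ⊤) :
    Integrable (fun p : ℝ × ℝ => f p.1 * (φ p.2 * (kConst h * posPow (p.2 - p.1) (h - 3 / 2)))) := by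
  have hk := kConst_pos h0 h1
  have hm : AEStronglyMeasurable
      (fun p : ℝ × ℝ => f p.1 * (φ p.2 * (kConst h * posPow (p.2 - p.1) (h - 3 / 2))))
      (volume.prod volume) :=
    hf.1.comp_fst.mul (Measurable.aestronglyMeasurable (by fun_prop))
  refine ⟨hm, ?_⟩
  have e : ∀ y u, ‖f y * (φ u * (kConst h * posPow (u - y) (h - 3 / 2)))‖ₑ =
      ‖f y‖ₑ * (‖φ u‖ₑ * kKer h y u) := fun y u => by
    rw [enorm_mul, enorm_mul, kKer, Real.enorm_of_nonneg
      (mul_nonneg hk.le (posPow_nonneg _ _))]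
  unfold HasFiniteIntegral
  rw [Measure.volume_eq_prod, lintegral_prod _ hm.enorm]
  calc ∫⁻ y, ∫⁻ u, ‖f y * (φ u * (kConst h * posPow (u - y) (h - 3 / 2)))‖ₑ
      = ∫⁻ y, ‖f y‖ₑ * ∫⁻ u, ‖φ u‖ₑ * kKer h y u := by
        refine lintegral_congr fun y => ?_
        simp_rw [e]
        exact lintegral_const_mul' _ _ enorm_ne_top
    _ ≤ ∫⁻ y, (‖f y‖ₑ ^ 2 + (∫⁻ u, ‖φ u‖ₑ * kKer h y u) ^ 2) :=
        lintegral_mono fun y => ennreal_mul_le_sq_add_sq _ _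
    _ = (∫⁻ y, ‖f y‖ₑ ^ 2) + ∫⁻ y, (∫⁻ u, ‖φ u‖ₑ * kKer h y u) ^ 2 :=
        lintegral_add_left' (hf.1.enorm.pow_const 2) _
    _ < ⊤ := ENNReal.add_lt_top.2 ⟨lintegral_enorm_sq_lt_top hf, hK⟩

/-- Fubini for the pairing of `f` with `K_h^* φ`; the inner integral on the left is the forward
fractional integral of `f`. -/
theorem integrable_integral_mul_kernel {h : ℝ} (h0 : 1 / 2 < h) (h1 : h < 1) {f φ : ℝ → ℝ}
    (hf : MemLp f 2 volume) (hφ : Measurable φ)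
    (hK : ∫⁻ y, (∫⁻ u, ‖φ u‖ₑ * kKer h y u) ^ 2 < ⊤) :
    Integrable (fun u => φ u * ∫ y, f y * (kConst h * posPow (u - y) (h - 3 / 2))) ∧
    ∫ u, φ u * ∫ y, f y * (kConst h * posPow (u - y) (h - 3 / 2)) =
      ∫ y, f y * ∫ u, φ u * (kConst h * posPow (u - y) (h - 3 / 2)) := by
  have hi := integrable_mul_kernel h0 h1 hf hφ hK
  have e : ∀ u, φ u * ∫ y, f y * (kConst h * posPow (u - y) (h - 3 / 2)) =
      ∫ y, f y * (φ u * (kConst h * posPow (u - y) (h - 3 / 2))) := fun u => by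
    rw [← integral_const_mul]
    exact integral_congr_ae (.of_forall fun y => by simp only; ring)
  simp_rw [e]
  refine ⟨hi.integral_prod_right, ?_⟩
  rw [← integral_integral_swap hi]
  exact integral_congr_ae (.of_forall fun y => integral_const_mul _ _)

/-- Up to a constant, the fractional integral of `(b - u)_+^{1/2 - h}` is the indicator of
`(-∞, b)`; this inverts the fractional integral on indicators. -/
theorem lintegral_posPow_mul_kKer {h : ℝ} (h0 : 1 / 2 < h) (h1 : h < 1) (b y : ℝ) :
    ∫⁻ u, ENNReal.ofReal (posPow (b - u) (1 / 2 - h)) * kKer h y u =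
      (Iio b).indicator (fun _ => ENNReal.ofReal
        (kConst h * beta (h - 1 / 2) (1 - (h - 1 / 2)))) y := by
  have hk := kConst_pos h0 h1
  have e := lintegral_posPow_mul_posPow_compl (a := h - 1 / 2) (by linarith) (by linarith) y b
  rw [show -(h - 1 / 2) = 1 / 2 - h by ring, show h - 1 / 2 - 1 = h - 3 / 2 by ring] at e
  have e2 : ∀ u, ENNReal.ofReal (posPow (b - u) (1 / 2 - h)) * kKer h y u =
      ENNReal.ofReal (kConst h) * (ENNReal.ofReal (posPow (b - u) (1 / 2 - h)) *
        ENNReal.ofReal (posPow (u - y) (h - 3 / 2))) := fun u => by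
    rw [kKer, ENNReal.ofReal_mul hk.le]; ring
  simp_rw [e2]
  rw [lintegral_const_mul' _ _ ENNReal.ofReal_ne_top, e]
  by_cases hy : y ∈ Iio b
  · rw [indicator_of_mem hy, indicator_of_mem hy, ENNReal.ofReal_mul hk.le]
  · rw [indicator_of_notMem hy, indicator_of_notMem hy, mul_zero]

theorem integral_posPow_mul_kernel {h : ℝ} (h0 : 1 / 2 < h) (h1 : h < 1) (b y : ℝ) :
    Integrable (fun u => posPow (b - u) (1 / 2 - h) * (kConst h * posPow (u - y) (h - 3 / 2))) ∧
    ∫ u, posPow (b - u) (1 / 2 - h) * (kConst h * posPow (u - y) (h - 3 / 2)) =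
      (Iio b).indicator (fun _ => kConst h * beta (h - 1 / 2) (1 - (h - 1 / 2))) y := by
  have hk := kConst_pos h0 h1
  have hb := beta_pos (by linarith : 0 < h - 1 / 2) (by linarith : 0 < 1 - (h - 1 / 2))
  have hnn : ∀ u, 0 ≤ posPow (b - u) (1 / 2 - h) * (kConst h * posPow (u - y) (h - 3 / 2)) :=
    fun u => mul_nonneg (posPow_nonneg _ _) (mul_nonneg hk.le (posPow_nonneg _ _))
  have hm : Measurable fun u =>
      posPow (b - u) (1 / 2 - h) * (kConst h * posPow (u - y) (h - 3 / 2)) := by fun_prop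
  have e : ∫⁻ u, ENNReal.ofReal
      (posPow (b - u) (1 / 2 - h) * (kConst h * posPow (u - y) (h - 3 / 2))) =
      (Iio b).indicator (fun _ => ENNReal.ofReal
        (kConst h * beta (h - 1 / 2) (1 - (h - 1 / 2)))) y := by
    rw [← lintegral_posPow_mul_kKer h0 h1]
    exact lintegral_congr fun u => ENNReal.ofReal_mul (posPow_nonneg _ _)
  constructor
  · refine ⟨hm.aestronglyMeasurable, ?_⟩
    rw [hasFiniteIntegral_iff_ofReal (.of_forall hnn), e]
    by_cases hy : y ∈ Iio b <;> simp [hy]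
  · rw [integral_eq_lintegral_of_nonneg_ae (.of_forall hnn) hm.aestronglyMeasurable, e]
    by_cases hy : y ∈ Iio b
    · rw [indicator_of_mem hy, indicator_of_mem hy, ENNReal.toReal_ofReal (by positivity)]
    · rw [indicator_of_notMem hy, indicator_of_notMem hy, ENNReal.toReal_zero]

/-- The part of `(b - u)_+^{1/2 - h}` on `[a, b)` has a square integrable fractional integral. It
is bounded, vanishes beyond `b` and decays like `|y|^{h - 3/2}` at `-∞`. -/
theorem lintegral_kKer_sq_indicator_lt_top {h : ℝ} (h0 : 1 / 2 < h) (h1 : h < 1) {a b : ℝ}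
    (hab : a ≤ b) :
    ∫⁻ y, (∫⁻ u, (Ici a).indicator (fun u => ENNReal.ofReal (posPow (b - u) (1 / 2 - h))) u *
      kKer h y u) ^ 2 < ⊤ := by
  have hk := kConst_pos h0 h1
  set p : ℝ → ENNReal :=
    (Ici a).indicator fun u => ENNReal.ofReal (posPow (b - u) (1 / 2 - h)) with hp
  set M : ENNReal := ENNReal.ofReal (kConst h * beta (h - 1 / 2) (1 - (h - 1 / 2))) with hM
  have hpm : Measurable p := Measurable.indicator (by fun_prop) measurableSet_Ici
  have bound1 : ∀ y, ∫⁻ u, p u * kKer h y u ≤ (Iio b).indicator (fun _ => M) y := fun y => by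
    rw [← lintegral_posPow_mul_kKer h0 h1]
    refine lintegral_mono fun u => ?_
    gcongr
    exact indicator_le_self _ _ _
  have hpint : ∫⁻ u, p u < ⊤ := by
    have hI : IntervalIntegrable (fun u => posPow (b - u) (1 / 2 - h)) volume a b := by
      have := (intervalIntegrable_posPow (r := 1 / 2 - h) (by linarith) 0 (b - a)
        (b - b)).comp_sub_left b
      simpa using this
    have : ∀ u, p u ≤ (Ioc a b).indicator
        (fun u => ENNReal.ofReal (posPow (b - u) (1 / 2 - h))) u +
        ({a} : Set ℝ).indicator (fun u => ENNReal.ofReal (posPow (b - u) (1 / 2 - h))) u := by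
      intro u
      by_cases hu : a ≤ u
      · rcases hu.eq_or_lt with rfl | hu'
        · simp [hp]
        · by_cases hub : u ≤ b
          · simp [hp, hu, hu', hub]
          · simp [hp, hu, hub, posPow_of_nonpos (t := b - u) (by linarith)]
      · simp [hp, hu]
    refine (lintegral_mono this).trans_lt ?_
    rw [lintegral_add_right _ (Measurable.indicator (by fun_prop) (measurableSet_singleton a)),
      lintegral_indicator measurableSet_Ioc, lintegral_indicator (measurableSet_singleton a),
      lintegral_ofReal_Ioc hab hI fun u => posPow_nonneg _ _]
    simp
  have bound2 : ∀ y < a - 1, ∫⁻ u, p u * kKer h y u ≤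
      ENNReal.ofReal (kConst h * (a - y) ^ (h - 3 / 2)) * ∫⁻ u, p u := fun y hy => by
    rw [← lintegral_const_mul _ hpm]
    refine lintegral_mono fun u => ?_
    by_cases hu : a ≤ u
    · rw [mul_comm]
      gcongr
      unfold kKer
      rw [posPow_of_pos (by linarith)]
      gcongr ENNReal.ofReal (_ * ?_)
      exact Real.rpow_le_rpow_of_nonpos (by linarith) (by linarith) (by linarith)
    · simp [hp, hu]
  have hle : ∀ y, (∫⁻ u, p u * kKer h y u) ^ 2 ≤ (Ico (a - 1) b).indicator (fun _ => M ^ 2) y +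
      (Iio (a - 1)).indicator (fun y => ENNReal.ofReal (kConst h ^ 2 * (a - y) ^ (2 * h - 3)) *
        (∫⁻ u, p u) ^ 2) y := fun y => by
    rcases lt_or_ge y (a - 1) with hy | hy
    · rw [indicator_of_mem (s := Iio (a - 1)) hy]
      refine le_add_left ((pow_le_pow_left' (bound2 y hy) 2).trans_eq ?_)
      have : 0 < a - y := by linarith
      rw [mul_pow, ← ENNReal.ofReal_pow (by positivity), mul_pow, ← Real.rpow_mul_natCast this.le]
      congr 4
      push_cast; ring
    · refine le_add_right ?_
      by_cases hyb : y < b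
      · rw [indicator_of_mem (s := Ico (a - 1) b) ⟨hy, hyb⟩]
        refine pow_le_pow_left' ((bound1 y).trans_eq ?_) 2
        rw [indicator_of_mem (by exact hyb)]
      · have := bound1 y
        rw [indicator_of_notMem (by simpa using hyb)] at this
        simp [le_antisymm this bot_le]
  refine (lintegral_mono hle).trans_lt ?_
  rw [lintegral_add_left (measurable_const.indicator measurableSet_Ico),
    lintegral_indicator measurableSet_Ico, lintegral_indicator measurableSet_Iio,
    lintegral_mul_const _ (by fun_prop), lintegral_const]
  refine ENNReal.add_lt_top.2 ⟨ENNReal.mul_lt_top (by simp [hM]) (by simp),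
    ENNReal.mul_lt_top ?_ (ENNReal.pow_lt_top hpint)⟩
  have hi : IntegrableOn (fun y => kConst h ^ 2 * (a - y) ^ (2 * h - 3)) (Iio (a - 1)) := by
    have h2 := integrableOn_Ioi_rpow_of_lt (a := 2 * h - 3) (c := 1) (by linarith) one_pos
    rw [← integrable_indicator_iff measurableSet_Ioi] at h2
    have h3 := h2.comp_sub_left a
    rw [← integrable_indicator_iff measurableSet_Iio]
    refine (h3.const_mul (kConst h ^ 2)).congr (.of_forall fun y => ?_)
    by_cases hy : y < a - 1
    · have : (1 : ℝ) < a - y := by linarith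
      simp [hy, this]
    · have : ¬ (1 : ℝ) < a - y := by linarith
      simp [hy, this]
  have h4 := hi.2
  rw [hasFiniteIntegral_iff_ofReal] at h4
  · exact h4
  · refine (ae_restrict_iff' measurableSet_Iio).2 (.of_forall fun y hy => ?_)
    have hy : y < a - 1 := hy
    have : 0 < a - y := by linarith
    change 0 ≤ kConst h ^ 2 * (a - y) ^ (2 * h - 3)
    positivity

/-- The function `(b - u)_+^{1/2 - h} - (a - u)_+^{1/2 - h}`, a fractional derivative of the
indicator of `[a, b)`, has an absolute value with square integrable fractional integral. -/
theorem lintegral_kKer_sq_fracDeriv_lt_top {h : ℝ} (h0 : 1 / 2 < h) (h1 : h < 1) {a b : ℝ}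
    (hab : a ≤ b) :
    ∫⁻ y, (∫⁻ u, ‖posPow (b - u) (1 / 2 - h) - posPow (a - u) (1 / 2 - h)‖ₑ * kKer h y u) ^ 2
      < ⊤ := by
  -- With `p_c(u) = (c - u)_+^{1/2 - h}` one has `|p_b - p_a| + p_b = 2 p_b 1_{[a,∞)} + p_a`, and the
  -- fractional integral of `p_a` is at most that of `p_b`.
  have hpt : ∀ u, ‖posPow (b - u) (1 / 2 - h) - posPow (a - u) (1 / 2 - h)‖ₑ +
      ENNReal.ofReal (posPow (b - u) (1 / 2 - h)) =
      2 * (Ici a).indicator (fun u => ENNReal.ofReal (posPow (b - u) (1 / 2 - h))) u +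
      ENNReal.ofReal (posPow (a - u) (1 / 2 - h)) := fun u => by
    by_cases hu : a ≤ u
    · rw [posPow_of_nonpos (t := a - u) (by linarith), sub_zero,
        Real.enorm_of_nonneg (posPow_nonneg _ _)]
      simp [hu, two_mul]
    · have hle : posPow (b - u) (1 / 2 - h) ≤ posPow (a - u) (1 / 2 - h) := by
        rw [posPow_of_pos (by linarith), posPow_of_pos (by linarith)]
        exact Real.rpow_le_rpow_of_nonpos (by linarith) (by linarith) (by linarith)
      rw [← enorm_neg, neg_sub, Real.enorm_of_nonneg (by linarith),
        ← ENNReal.ofReal_add (by linarith) (posPow_nonneg _ _)]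
      simp [hu]
  have key : ∀ y, ∫⁻ u, ‖posPow (b - u) (1 / 2 - h) - posPow (a - u) (1 / 2 - h)‖ₑ * kKer h y u ≤
      2 * ∫⁻ u, (Ici a).indicator (fun u => ENNReal.ofReal (posPow (b - u) (1 / 2 - h))) u *
        kKer h y u := fun y => by
    have hle : ∫⁻ u, ENNReal.ofReal (posPow (a - u) (1 / 2 - h)) * kKer h y u ≤
        ∫⁻ u, ENNReal.ofReal (posPow (b - u) (1 / 2 - h)) * kKer h y u := by
      rw [lintegral_posPow_mul_kKer h0 h1, lintegral_posPow_mul_kKer h0 h1]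
      exact indicator_le_indicator_of_subset (Iio_subset_Iio hab) (fun _ => bot_le) y
    have hfin : ∫⁻ u, ENNReal.ofReal (posPow (b - u) (1 / 2 - h)) * kKer h y u ≠ ⊤ := by
      rw [lintegral_posPow_mul_kKer h0 h1]
      by_cases hy : y ∈ Iio b <;> simp [hy]
    have hsum : (∫⁻ u, ‖posPow (b - u) (1 / 2 - h) - posPow (a - u) (1 / 2 - h)‖ₑ * kKer h y u) +
        ∫⁻ u, ENNReal.ofReal (posPow (b - u) (1 / 2 - h)) * kKer h y u =
        2 * (∫⁻ u, (Ici a).indicator (fun u => ENNReal.ofReal (posPow (b - u) (1 / 2 - h))) u *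
          kKer h y u) + ∫⁻ u, ENNReal.ofReal (posPow (a - u) (1 / 2 - h)) * kKer h y u := by
      have hm : Measurable ((Ici a).indicator
          fun u => ENNReal.ofReal (posPow (b - u) (1 / 2 - h))) :=
        Measurable.indicator (by fun_prop) measurableSet_Ici
      rw [← lintegral_add_right _ (by fun_prop), ← lintegral_const_mul _ (by fun_prop),
        ← lintegral_add_right _ (by fun_prop)]
      refine lintegral_congr fun u => ?_
      rw [← add_mul, hpt, add_mul, mul_assoc]
    refine (ENNReal.add_le_add_iff_right hfin).1 (hsum.trans_le ?_)
    gcongr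
  calc _ ≤ ∫⁻ y, 4 * (∫⁻ u, (Ici a).indicator
        (fun u => ENNReal.ofReal (posPow (b - u) (1 / 2 - h))) u * kKer h y u) ^ 2 := by
        refine lintegral_mono fun y => (pow_le_pow_left' (key y) 2).trans_eq ?_
        rw [mul_pow]; norm_num
    _ < ⊤ := by
        rw [lintegral_const_mul' _ _ (by simp)]
        exact ENNReal.mul_lt_top (by simp) (lintegral_kKer_sq_indicator_lt_top h0 h1 hab)

/-- The Mandelbrot–van Ness kernels are total in `L²(ℝ)`. A function `f` orthogonal to them has a
vanishing forward fractional integral; testing this against a fractional derivative of the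
indicator of `[a, b)` shows that `f` has integral zero over `[a, b)`. -/
theorem ae_eq_zero_of_integral_mul_mvnKernel_eq_zero {h : ℝ} (h0 : 1 / 2 ≤ h) (h1 : h < 1)
    {f : ℝ → ℝ} (hf : MemLp f 2 volume) (hz : ∀ x, ∫ y, f y * mvnKernel h x y = 0) :
    f =ᵐ[volume] 0 := by
  have hz2 : ∀ a b, ∫ y, f y * (mvnKernel h b y - mvnKernel h a y) = 0 := fun a b => by
    have i : ∀ x, Integrable fun y => f y * mvnKernel h x y := fun x =>
      hf.integrable_mul (memLp_mvnKernel h0 h1 x)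
    simp_rw [mul_sub]
    rw [integral_sub (i b) (i a), hz, hz, sub_zero]
  have hfint : ∀ a b, IntegrableOn f (Ioc a b) := fun a b => by
    have : MemLp f 2 (volume.restrict (Ioc a b)) := hf.restrict _
    exact this.integrable (by norm_num)
  rcases h0.eq_or_lt with rfl | h0
  · refine ae_eq_zero_of_integral_Ioc_eq_zero hfint fun a b hab => ?_
    rw [← integral_Ico_eq_integral_Ioc, ← integral_indicator measurableSet_Ico, ← hz2 a b]
    refine integral_congr_ae (.of_forall fun y => ?_)
    simp only [mvnKernel_half, indicator, mem_Iio, mem_Ico, Pi.one_apply]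
    split_ifs <;> first | (exfalso; grind) | simp
  · have hk := kConst_pos h0 h1
    have hb := beta_pos (by linarith : 0 < h - 1 / 2) (by linarith : 0 < 1 - (h - 1 / 2))
    -- Testing against `1_{(a,b]}` shows that the forward fractional integral of `f` vanishes.
    have hKf : (fun u => ∫ y, f y * (kConst h * posPow (u - y) (h - 3 / 2))) =ᵐ[volume] 0 := by
      have hK : ∀ a b, a ≤ b →
          ∫⁻ y, (∫⁻ u, ‖(Ioc a b).indicator (1 : ℝ → ℝ) u‖ₑ * kKer h y u) ^ 2 < ⊤ := by
        intro a b hab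
        have e : ∀ y, (∫⁻ u, ‖(Ioc a b).indicator (1 : ℝ → ℝ) u‖ₑ * kKer h y u) ^ 2 =
            ENNReal.ofReal ((mvnKernel h b y - mvnKernel h a y) ^ 2) := fun y => by
          rw [ENNReal.ofReal_pow (mvnKernel_sub_nonneg h0.le h1 hab y),
            ofReal_mvnKernel_sub h0 h1 hab]
          congr 1
          refine lintegral_congr fun u => ?_
          by_cases hu : u ∈ Ioc a b <;> simp [hu]
        simp_rw [e]
        rw [lintegral_mvnKernel_sub_sq h0.le h1 hab]
        exact ENNReal.ofReal_lt_top
      have hfub := fun a b hab => integrable_integral_mul_kernel h0 h1 hf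
        (measurable_one.indicator (measurableSet_Ioc (a := a) (b := b))) (hK a b hab)
      have hind : ∀ (a b : ℝ) (g : ℝ → ℝ),
          (fun u => (Ioc a b).indicator (1 : ℝ → ℝ) u * g u) = (Ioc a b).indicator g := by
        intro a b g
        ext u
        by_cases hu : u ∈ Ioc a b <;> simp [hu]
      refine ae_eq_zero_of_integral_Ioc_eq_zero (fun a b => ?_) fun a b hab => ?_
      · rcases le_total a b with hab | hab
        · rw [← integrable_indicator_iff measurableSet_Ioc, ← hind]
          exact (hfub a b hab).1
        · simp [Ioc_eq_empty_of_le hab]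
      · rw [← integral_indicator measurableSet_Ioc, ← hind, (hfub a b hab).2, ← hz2 a b]
        refine integral_congr_ae (.of_forall fun y => ?_)
        simp only
        rw [hind, integral_indicator measurableSet_Ioc, ← intervalIntegral.integral_of_le hab,
          intervalIntegral.integral_const_mul, mvnKernel_sub_eq_integral h0]
    -- A fractional derivative of the indicator of `[a, b)` recovers the integral of `f` over it.
    refine ae_eq_zero_of_integral_Ioc_eq_zero hfint fun a b hab => ?_
    have hfub := (integrable_integral_mul_kernel h0 h1 hf (by fun_prop)
      (lintegral_kKer_sq_fracDeriv_lt_top h0 h1 hab)).2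
    have hz3 : ∫ u, (posPow (b - u) (1 / 2 - h) - posPow (a - u) (1 / 2 - h)) *
        ∫ y, f y * (kConst h * posPow (u - y) (h - 3 / 2)) = 0 := by
      refine integral_eq_zero_of_ae ?_
      filter_upwards [hKf] with u hu
      simp only [Pi.zero_apply] at hu ⊢
      rw [hu, mul_zero]
    rw [hz3] at hfub
    rw [← integral_Ico_eq_integral_Ioc, ← integral_indicator measurableSet_Ico]
    have hC : kConst h * beta (h - 1 / 2) (1 - (h - 1 / 2)) ≠ 0 := by positivity
    refine (mul_eq_zero.1 ?_).resolve_left hC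
    rw [← integral_const_mul]
    refine Eq.trans (integral_congr_ae (.of_forall fun y => ?_)) hfub.symm
    have hb' := integral_posPow_mul_kernel h0 h1 b y
    have ha' := integral_posPow_mul_kernel h0 h1 a y
    simp only [sub_mul]
    rw [integral_sub hb'.1 ha'.1, hb'.2, ha'.2]
    simp only [indicator, mem_Iio, mem_Ico]
    split_ifs <;> first | (exfalso; grind) | ring

/-! ### Classes of square integrable functions -/

section toL2

variable {α : Type*} [MeasurableSpace α] {μ : Measure α}

theorem toL2_eq_toLp {f : α → ℝ} (hf : MemLp f 2 μ) : toL2 μ f = hf.toLp f := dif_pos hf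

theorem coeFn_toL2 {f : α → ℝ} (hf : MemLp f 2 μ) : toL2 μ f =ᵐ[μ] f := by
  rw [toL2_eq_toLp hf]; exact hf.coeFn_toLp

theorem toL2_coeFn (f : Lp ℝ 2 μ) : toL2 μ f = f := by
  rw [toL2_eq_toLp (Lp.memLp f)]; exact Lp.toLp_coeFn f _

theorem toL2_congr {f g : α → ℝ} (h : f =ᵐ[μ] g) : toL2 μ f = toL2 μ g := by
  by_cases hf : MemLp f 2 μ
  · have hg : MemLp g 2 μ := (memLp_congr_ae h).1 hf
    rw [toL2_eq_toLp hf, toL2_eq_toLp hg, MemLp.toLp_eq_toLp_iff]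
    exact h
  · have hg : ¬ MemLp g 2 μ := fun hg => hf ((memLp_congr_ae h).2 hg)
    rw [toL2, toL2, dif_neg hf, dif_neg hg]

theorem inner_eq_integral_mul (f g : Lp ℝ 2 μ) : inner ℝ f g = ∫ y, f y * g y ∂μ := by
  rw [L2.inner_def]
  exact integral_congr_ae (.of_forall fun y => by simp [mul_comm])

theorem inner_toL2 {f g : α → ℝ} (hf : MemLp f 2 μ) (hg : MemLp g 2 μ) :
    inner ℝ (toL2 μ f) (toL2 μ g) = ∫ y, f y * g y ∂μ := by
  rw [inner_eq_integral_mul]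
  refine integral_congr_ae ?_
  filter_upwards [coeFn_toL2 hf, coeFn_toL2 hg] with y h1 h2
  rw [h1, h2]

theorem memLp_finsupp_sum {ι : Type*} {F : ι → α → ℝ} (hF : ∀ x, MemLp (F x) 2 μ)
    (c : ι →₀ ℝ) : MemLp (fun y => c.sum fun x a => a * F x y) 2 μ :=
  memLp_finsetSum _ fun x _ => (hF x).const_mul (c x)

theorem linearCombination_toL2 {ι : Type*} {F : ι → α → ℝ} (hF : ∀ x, MemLp (F x) 2 μ)
    (c : ι →₀ ℝ) : Finsupp.linearCombination ℝ (fun x => toL2 μ (F x)) c =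
      toL2 μ fun y => c.sum fun x a => a * F x y := by
  induction c using Finsupp.induction_linear with
  | zero =>
    have h0 : MemLp (fun _ : α => (0 : ℝ)) 2 μ := MemLp.zero
    simp only [map_zero, Finsupp.sum_zero_index, toL2_eq_toLp h0]
    exact (MemLp.toLp_zero h0).symm
  | add c d hc hd =>
    have e : (fun y => (c + d).sum fun x a => a * F x y) =
        (fun y => c.sum fun x a => a * F x y) + fun y => d.sum fun x a => a * F x y := by
      ext y
      exact Finsupp.sum_add_index' (by simp) (by simp [add_mul])
    have hc' := memLp_finsupp_sum hF c
    have hd' := memLp_finsupp_sum hF d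
    rw [map_add, hc, hd, e, toL2_eq_toLp hc', toL2_eq_toLp hd', toL2_eq_toLp (hc'.add hd'),
      MemLp.toLp_add]
  | single x a =>
    have e : (fun y => (Finsupp.single x a).sum fun x a => a * F x y) = a • F x := by
      ext y; simp
    rw [e, toL2_eq_toLp ((hF x).const_smul a), MemLp.toLp_const_smul, ← toL2_eq_toLp (hF x),
      Finsupp.linearCombination_single]
    exact hF x

end toL2

/-! ### Tensor products of square integrable functions -/

section tensor

variable {k : ℕ}

/-- The tensor product `η ↦ ∏ i, g_i(η_i)`. -/
def tensor (g : Fin k → ℝ → ℝ) (η : Fin k → ℝ) : ℝ := ∏ i, g i (η i)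

theorem ae_pi_eval {p : ℝ → Prop} (hp : ∀ᵐ t, p t) (i : Fin k) :
    ∀ᵐ η : Fin k → ℝ, p (η i) :=
  (Measure.quasiMeasurePreserving_eval (fun _ : Fin k => (volume : Measure ℝ)) i).ae hp

theorem tensor_ae_congr {f g : Fin k → ℝ → ℝ} (h : ∀ i, f i =ᵐ[volume] g i) :
    tensor f =ᵐ[volume] tensor g := by
  filter_upwards [ae_all_iff.2 fun i => ae_pi_eval (h i) i] with η hη
  exact Finset.prod_congr rfl fun i _ => hη i

theorem integral_tensor (f : Fin k → ℝ → ℝ) : ∫ η, tensor f η = ∏ i, ∫ t, f i t :=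
  integral_fintype_prod_volume_eq_prod f

theorem tensor_mul_tensor (f g : Fin k → ℝ → ℝ) (η : Fin k → ℝ) :
    tensor f η * tensor g η = tensor (fun i t => f i t * g i t) η := Finset.prod_mul_distrib.symm

theorem memLp_tensor {g : Fin k → ℝ → ℝ} (hg : ∀ i, MemLp (g i) 2 volume) :
    MemLp (tensor g) 2 volume := by
  have hm : AEStronglyMeasurable (tensor g) volume := by
    refine Finset.aestronglyMeasurable_fun_prod _ fun i _ => ?_
    exact (hg i).1.comp_quasiMeasurePreserving
      (Measure.quasiMeasurePreserving_eval (fun _ : Fin k => (volume : Measure ℝ)) i)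
  rw [memLp_two_iff_integrable_sq hm]
  have : Integrable (tensor fun i t => g i t ^ 2) :=
    Integrable.fintype_prod fun i => (hg i).integrable_sq
  refine this.congr (.of_forall fun η => ?_)
  simp only [tensor, Finset.prod_pow]

theorem inner_toL2_tensor {f g : Fin k → ℝ → ℝ} (hf : ∀ i, MemLp (f i) 2 volume)
    (hg : ∀ i, MemLp (g i) 2 volume) :
    inner ℝ (toL2 volume (tensor f)) (toL2 volume (tensor g)) = ∏ i, ∫ t, f i t * g i t := by
  rw [inner_toL2 (memLp_tensor hf) (memLp_tensor hg), ← integral_tensor]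
  simp_rw [tensor_mul_tensor]

theorem tensor_update (g : Fin k → ℝ → ℝ) (i : Fin k) (f : ℝ → ℝ) (η : Fin k → ℝ) :
    tensor (Function.update g i f) η = f (η i) * ∏ j ∈ Finset.univ.erase i, g j (η j) := by
  rw [tensor, ← Finset.mul_prod_erase _ _ (Finset.mem_univ i), Function.update_self]
  congr 1
  refine Finset.prod_congr rfl fun j hj => ?_
  rw [Function.update_of_ne (Finset.ne_of_mem_erase hj)]

theorem memLp_update {g : Fin k → ℝ → ℝ} (hg : ∀ i, MemLp (g i) 2 volume) (i : Fin k) {f : ℝ → ℝ}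
    (hf : MemLp f 2 volume) (j : Fin k) : MemLp (Function.update g i f j) 2 volume := by
  rcases eq_or_ne j i with rfl | h
  · rwa [Function.update_self]
  · rw [Function.update_of_ne h]; exact hg j

/-- The continuous linear map `f ↦ g_1 ⊗ ⋯ ⊗ f ⊗ ⋯ ⊗ g_k` with `f` in the `i`-th place. -/
noncomputable def tensorSlot {g : Fin k → ℝ → ℝ} (hg : ∀ i, MemLp (g i) 2 volume) (i : Fin k) :
    Lp ℝ 2 (volume : Measure ℝ) →L[ℝ] Lp ℝ 2 (volume : Measure (Fin k → ℝ)) :=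
  LinearMap.mkContinuous
    { toFun := fun f => toL2 volume (tensor (Function.update g i f))
      map_add' := fun f f' => by
        have h := fun f : Lp ℝ 2 (volume : Measure ℝ) =>
          memLp_tensor (memLp_update hg i (Lp.memLp f))
        rw [toL2_eq_toLp (h f), toL2_eq_toLp (h f'), ← MemLp.toLp_add,
          ← toL2_eq_toLp ((h f).add (h f'))]
        refine toL2_congr ?_
        filter_upwards [ae_pi_eval (Lp.coeFn_add f f') i] with η hη
        simp only [Pi.add_apply, tensor_update] at hη ⊢
        rw [hη, add_mul]
      map_smul' := fun a f => by
        have h := memLp_tensor (memLp_update hg i (Lp.memLp f))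
        rw [toL2_eq_toLp h, RingHom.id_apply, ← MemLp.toLp_const_smul,
          ← toL2_eq_toLp (h.const_smul a)]
        refine toL2_congr ?_
        filter_upwards [ae_pi_eval (Lp.coeFn_smul a f) i] with η hη
        simp only [Pi.smul_apply, smul_eq_mul, tensor_update] at hη ⊢
        rw [hη, mul_assoc] }
    (√(∏ j ∈ Finset.univ.erase i, ∫ t, g j t * g j t))
    (fun f => by
      have h := memLp_update hg i (Lp.memLp f)
      have e : ‖toL2 volume (tensor (Function.update g i f))‖ ^ 2 =
          ‖f‖ ^ 2 * ∏ j ∈ Finset.univ.erase i, ∫ t, g j t * g j t := by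
        rw [← real_inner_self_eq_norm_sq, ← real_inner_self_eq_norm_sq, inner_toL2_tensor h h,
          inner_eq_integral_mul, ← Finset.mul_prod_erase _ _ (Finset.mem_univ i),
          Function.update_self]
        congr 1
        refine Finset.prod_congr rfl fun j hj => ?_
        rw [Function.update_of_ne (Finset.ne_of_mem_erase hj)]
      have h0 : 0 ≤ ∏ j ∈ Finset.univ.erase i, ∫ t, g j t * g j t :=
        Finset.prod_nonneg fun j _ => integral_nonneg fun t => mul_self_nonneg _
      refine le_of_sq_le_sq ?_ (by positivity)
      change ‖toL2 volume (tensor (Function.update g i f))‖ ^ 2 ≤ _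
      rw [e, mul_pow, Real.sq_sqrt h0, mul_comm])

theorem tensorSlot_toL2 {g : Fin k → ℝ → ℝ} (hg : ∀ i, MemLp (g i) 2 volume) (i : Fin k)
    {f : ℝ → ℝ} (hf : MemLp f 2 volume) :
    tensorSlot hg i (toL2 volume f) = toL2 volume (tensor (Function.update g i f)) := by
  change toL2 volume (tensor (Function.update g i (toL2 volume f))) = _
  refine toL2_congr (tensor_ae_congr fun j => ?_)
  rcases eq_or_ne j i with rfl | h
  · rw [Function.update_self, Function.update_self]; exact coeFn_toL2 hf
  · rw [Function.update_of_ne h, Function.update_of_ne h]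

/-- A closed subspace of `L²(ℝ^k)` that contains the tensor products of the members of total sets
contains all tensor products. -/
theorem toL2_tensor_mem {M : Submodule ℝ (Lp ℝ 2 (volume : Measure (Fin k → ℝ)))}
    (hM : IsClosed (M : Set (Lp ℝ 2 (volume : Measure (Fin k → ℝ)))))
    {D : Fin k → Set (ℝ → ℝ)} (hD : ∀ i, ∀ d ∈ D i, MemLp d 2 volume)
    (htot : ∀ i, ∀ f : ℝ → ℝ, MemLp f 2 volume → (∀ d ∈ D i, ∫ t, f t * d t = 0) →
      f =ᵐ[volume] 0)
    (h : ∀ d : Fin k → ℝ → ℝ, (∀ i, d i ∈ D i) → toL2 volume (tensor d) ∈ M)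
    {g : Fin k → ℝ → ℝ} (hg : ∀ i, MemLp (g i) 2 volume) : toL2 volume (tensor g) ∈ M := by
  classical
  -- The coordinates in `s` carry arbitrary square integrable factors, the others members of `D i`.
  have key : ∀ s : Finset (Fin k), ∀ g : Fin k → ℝ → ℝ, (∀ i, MemLp (g i) 2 volume) →
      (∀ i ∉ s, g i ∈ D i) → toL2 volume (tensor g) ∈ M := by
    intro s
    induction s using Finset.induction_on with
    | empty => exact fun g _ hgD => h g fun i => hgD i (Finset.notMem_empty i)
    | insert i s hi ih =>
      intro g hg hgD
      set N : Submodule ℝ (Lp ℝ 2 (volume : Measure ℝ)) :=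
        M.comap (tensorSlot hg i).toLinearMap with hN
      have hNc : IsClosed (N : Set (Lp ℝ 2 (volume : Measure ℝ))) :=
        hM.preimage (tensorSlot hg i).continuous
      have hDN : ∀ d ∈ D i, toL2 volume d ∈ N := by
        intro d hd
        change tensorSlot hg i (toL2 volume d) ∈ M
        rw [tensorSlot_toL2 hg i (hD i d hd)]
        refine ih _ (memLp_update hg i (hD i d hd)) fun j hj => ?_
        rcases eq_or_ne j i with rfl | hji
        · rwa [Function.update_self]
        · rw [Function.update_of_ne hji]
          exact hgD j (by simp [hji, hj])
      have hNtop : N = ⊤ := by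
        have : CompleteSpace N := hNc.completeSpace_coe
        rw [← Submodule.orthogonal_eq_bot_iff, Submodule.eq_bot_iff]
        intro f hf
        rw [Lp.eq_zero_iff_ae_eq_zero]
        refine htot i f (Lp.memLp f) fun d hd => ?_
        have := (Submodule.mem_orthogonal' _ _).1 hf _ (hDN d hd)
        rwa [← toL2_coeFn f, inner_toL2 (Lp.memLp f) (hD i d hd)] at this
      have : toL2 volume (g i) ∈ N := hNtop ▸ Submodule.mem_top
      change tensorSlot hg i (toL2 volume (g i)) ∈ M at this
      rwa [tensorSlot_toL2 hg i (hg i), Function.update_eq_self] at this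
  exact key Finset.univ g hg fun i hi => absurd (Finset.mem_univ i) hi

end tensor

/-! ### The images of the indicators under `K_H^{*,(k)}` -/

section box

variable {k : ℕ}

theorem memLp_signedInd (x : ℝ) : MemLp (signedInd x) 2 volume :=
  (memLp_congr_ae (mvnKernel_half_ae_eq x)).1 (memLp_mvnKernel le_rfl (by norm_num) x)

theorem memLp_boxInd (x : Fin k → ℝ) : MemLp (boxInd x) 2 volume :=
  memLp_tensor fun i => memLp_signedInd (x i)

/-- The function `K_h^* 1_{[0,x]}` on the line. -/
noncomputable def kInd (h x : ℝ) : ℝ → ℝ := if h = 1 / 2 then signedInd x else mvnKernel h x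

theorem kInd_ae_eq (h x : ℝ) : kInd h x =ᵐ[volume] mvnKernel h x := by
  unfold kInd
  split_ifs with hh
  · rw [hh]; exact (mvnKernel_half_ae_eq x).symm
  · rfl

theorem memLp_kInd (h : Hurst) (x : ℝ) : MemLp (kInd h x) 2 volume :=
  (memLp_congr_ae (kInd_ae_eq h x)).2 (memLp_mvnKernel h.2.1 h.2.2 x)

/-- `K_h^*` in the `i`-th coordinate, on a linear combination of tensor products whose `i`-th
factors are signed indicators, replaces these factors by their one-dimensional images. -/
theorem kStarOne_finsupp_sum {ι : Type*} (c : ι →₀ ℝ) (h : Hurst) (i : Fin k)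
    (g : ι → Fin k → ℝ → ℝ) (x : ι → ℝ) (hg : ∀ j, g j i = signedInd (x j)) :
    kStarOne h i (fun η => c.sum fun j a => a * tensor (g j) η) =
      fun η => c.sum fun j a => a * tensor (Function.update (g j) i (kInd h (x j))) η := by
  ext η
  unfold kStarOne kInd
  split_ifs with hh
  · refine Finsupp.sum_congr fun j _ => ?_
    rw [← hg, Function.update_eq_self]
  · have h0 : (1 / 2 : ℝ) < h := lt_of_le_of_ne h.2.1 (Ne.symm hh)
    have e : ∀ u, (c.sum fun j a => a * tensor (g j) (Function.update η i u)) *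
        posPow (u - η i) ((h : ℝ) - 3 / 2) = ∑ j ∈ c.support,
          (c j * ∏ l ∈ Finset.univ.erase i, g j l (η l)) *
            (signedInd (x j) u * posPow (u - η i) ((h : ℝ) - 3 / 2)) := fun u => by
      rw [Finsupp.sum, Finset.sum_mul]
      refine Finset.sum_congr rfl fun j _ => ?_
      rw [tensor, ← Finset.mul_prod_erase _ _ (Finset.mem_univ i), Function.update_self, hg]
      have : ∏ l ∈ Finset.univ.erase i, g j l (Function.update η i u l) =
          ∏ l ∈ Finset.univ.erase i, g j l (η l) :=
        Finset.prod_congr rfl fun l hl => by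
          rw [Function.update_of_ne (Finset.ne_of_mem_erase hl)]
      rw [this]; ring
    simp_rw [e]
    rw [integral_finsetSum _ fun j _ => (integrable_signedInd_mul
      (intervalIntegrable_posPow (by linarith) (η i) 0 (x j))).const_mul _, Finset.mul_sum]
    refine Finset.sum_congr rfl fun j _ => ?_
    simp only
    rw [integral_const_mul, tensor_update, ← kConst_mul_integral_signedInd h0, kConst]
    ring

theorem kStar_finsupp_sum (H : Fin k → Hurst) (c : (Fin k → ℝ) →₀ ℝ) :
    kStar H (fun η => c.sum fun x a => a * boxInd x η) =
      fun η => c.sum fun x a => a * tensor (fun i => kInd (H i) (x i)) η := by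
  have key : ∀ (l : List (Fin k)), l.Nodup → ∀ g : (Fin k → ℝ) → Fin k → ℝ → ℝ,
      (∀ x, ∀ i ∈ l, g x i = signedInd (x i)) →
      l.foldl (fun ψ i => kStarOne (H i) i ψ) (fun η => c.sum fun x a => a * tensor (g x) η) =
        fun η => c.sum fun x a =>
          a * tensor (fun i => if i ∈ l then kInd (H i) (x i) else g x i) η := by
    intro l
    induction l with
    | nil => intro _ g _; simp
    | cons i l ih =>
      intro hl g hg
      rw [List.nodup_cons] at hl
      rw [List.foldl_cons, kStarOne_finsupp_sum c (H i) i g (fun x => x i)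
        (fun x => hg x i List.mem_cons_self), ih hl.2]
      · ext η
        refine Finsupp.sum_congr fun x _ => ?_
        congr 2
        ext j
        rcases eq_or_ne j i with rfl | hj
        · simp [hl.1]
        · simp [hj]
      · intro x j hj
        have : j ≠ i := fun hji => hl.1 (hji ▸ hj)
        rw [Function.update_of_ne this]
        exact hg x j (List.mem_cons_of_mem _ hj)
  have := key (List.finRange k) (List.nodup_finRange k) (fun x i => signedInd (x i))
    fun _ _ _ => rfl
  simpa using! this

theorem kStar_boxInd (H : Fin k → Hurst) (x : Fin k → ℝ) :
    kStar H (boxInd x) = tensor fun i => kInd (H i) (x i) := by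
  have := kStar_finsupp_sum H (Finsupp.single x 1)
  simpa using this

theorem memLp_kStar_boxInd (H : Fin k → Hurst) (x : Fin k → ℝ) :
    MemLp (kStar H (boxInd x)) 2 volume := by
  rw [kStar_boxInd]; exact memLp_tensor fun i => memLp_kInd (H i) (x i)

/-- The two sides differ only at finitely many values of the coordinates with `H_i = 1/2`, where
`K_h^*` is the identity and `1_{[0,x]}` is closed at both ends. -/
theorem kStar_boxInd_ae_eq (H : Fin k → Hurst) (x : Fin k → ℝ) :
    kStar H (boxInd x) =ᵐ[volume] fieldKernel H x := by
  rw [kStar_boxInd]; exact tensor_ae_congr fun i => kInd_ae_eq (H i) (x i)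

theorem inner_kStar_boxInd (H : Fin k → Hurst) (x y : Fin k → ℝ) :
    inner ℝ (toL2 volume (kStar H (boxInd x))) (toL2 volume (kStar H (boxInd y))) =
      fieldCov H x y := by
  rw [kStar_boxInd, kStar_boxInd, inner_toL2_tensor (fun i => memLp_kInd (H i) (x i))
    fun i => memLp_kInd (H i) (y i)]
  refine Finset.prod_congr rfl fun i _ => ?_
  rw [← integral_mvnKernel_mul_mvnKernel (H i).2.1 (H i).2.2]
  refine integral_congr_ae ?_
  filter_upwards [kInd_ae_eq (H i) (x i), kInd_ae_eq (H i) (y i)] with t h1 h2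
  rw [h1, h2]

theorem inner_boxInd (x y : Fin k → ℝ) :
    inner ℝ (toL2 volume (boxInd x)) (toL2 volume (boxInd y)) = ∏ i, wedge (x i) (y i) := by
  refine (inner_toL2_tensor (fun i => memLp_signedInd (x i))
    fun i => memLp_signedInd (y i)).trans ?_
  refine Finset.prod_congr rfl fun i _ => ?_
  rw [← covR_half, ← integral_mvnKernel_mul_mvnKernel le_rfl (by norm_num)]
  refine integral_congr_ae ?_
  filter_upwards [mvnKernel_half_ae_eq (x i), mvnKernel_half_ae_eq (y i)] with t h1 h2
  rw [h1, h2]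

/-- The coefficients of an elementary function. -/
def Elem.coeff {H : Fin k → Hurst} (c : Elem H) : (Fin k → ℝ) →₀ ℝ := c

theorem Elem.lift_eq {H : Fin k → Hurst} {M : Type*} [AddCommGroup M] [Module ℝ M]
    (f : (Fin k → ℝ) → M) (c : Elem H) :
    Elem.lift f c = Finsupp.linearCombination ℝ f c.coeff := rfl

theorem Elem.toFun_eq_sum {H : Fin k → Hurst} (c : Elem H) :
    c.toFun = fun η => c.coeff.sum fun x a => a * boxInd x η := by
  ext η
  rw [Elem.toFun, Elem.lift_eq, Finsupp.linearCombination_apply, Finsupp.sum, Finset.sum_apply]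
  rfl

/-- The signed indicators are total: their rectangular increments are the indicators of cubes. -/
theorem dense_span_boxInd :
    (Submodule.span ℝ (range fun x : Fin k → ℝ => toL2 volume (boxInd x))).topologicalClosure
      = ⊤ := by
  rw [Submodule.topologicalClosure_eq_top_iff, Submodule.eq_bot_iff]
  intro f hf
  have hbox : ∀ x : Fin k → ℝ, inner ℝ f (toL2 volume (boxInd x)) = 0 := fun x =>
    (Submodule.mem_orthogonal' _ _).1 hf _ (Submodule.subset_span ⟨x, rfl⟩)
  have hsum : ∀ c : (Fin k → ℝ) →₀ ℝ,
      ∫ η, f η * (c.sum fun x a => a * boxInd x η) = 0 := fun c => by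
    rw [← inner_toL2 (Lp.memLp f) (memLp_finsupp_sum memLp_boxInd c),
      ← linearCombination_toL2 memLp_boxInd, toL2_coeFn, Finsupp.linearCombination_apply,
      Finsupp.sum, inner_sum]
    refine Finset.sum_eq_zero fun x _ => ?_
    rw [inner_smul_right, hbox, mul_zero]
  rw [Lp.eq_zero_iff_ae_eq_zero]
  have hloc : LocallyIntegrable f volume := (Lp.memLp f).locallyIntegrable (by norm_num)
  refine ae_eq_zero_of_setIntegral_closedBall_eq_zero hloc fun x r hr => ?_
  have hball : Metric.closedBall x r = Icc (fun i => x i - r) (fun i => x i + r) := by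
    rw [closedBall_pi _ hr.le, ← pi_univ_Icc]
    simp only [Real.closedBall_eq_Icc]
  have hxy : (fun i => x i - r) ≤ fun i => x i + r := fun i => by simp only; linarith
  set c : Elem (fun _ : Fin k => (⟨1 / 2, by norm_num, by norm_num⟩ : Hurst)) :=
    Elem.rect (fun i => x i - r) (fun i => x i + r)
  rw [hball, ← integral_indicator measurableSet_Icc, ← hsum c.coeff]
  refine integral_congr_ae ?_
  filter_upwards [Elem.toFun_rect_ae (H := fun _ : Fin k =>
    (⟨1 / 2, by norm_num, by norm_num⟩ : Hurst)) hxy] with η hη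
  rw [Elem.toFun_eq_sum] at hη
  simp only at hη
  rw [hη]
  by_cases hm : η ∈ Icc (fun i => x i - r) (fun i => x i + r) <;> simp [hm]

/-- The functions `K_H^{*,(k)} 1_{[0,x]}` are total in `L²(ℝ^k)`: they are tensor products of
members of the one-dimensional total sets. -/
theorem dense_span_kStar_boxInd (H : Fin k → Hurst) :
    (Submodule.span ℝ
      (range fun x : Fin k → ℝ => toL2 volume (kStar H (boxInd x)))).topologicalClosure = ⊤ := by
  rw [eq_top_iff, ← dense_span_boxInd]
  refine Submodule.topologicalClosure_minimal _ (Submodule.span_le.2 ?_)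
    (Submodule.isClosed_topologicalClosure _)
  rintro _ ⟨x, rfl⟩
  refine toL2_tensor_mem (Submodule.isClosed_topologicalClosure _)
    (D := fun i => range fun x => kInd (H i) x) ?_ ?_ ?_ fun i => memLp_signedInd (x i)
  · rintro i _ ⟨x, rfl⟩
    exact memLp_kInd (H i) x
  · intro i f hf h
    refine ae_eq_zero_of_integral_mul_mvnKernel_eq_zero (H i).2.1 (H i).2.2 hf fun x => ?_
    rw [← h _ ⟨x, rfl⟩]
    refine integral_congr_ae ?_
    filter_upwards [kInd_ae_eq (H i) x] with t ht
    rw [ht]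
  · intro d hd
    choose x hx using hd
    refine Submodule.le_topologicalClosure _ (Submodule.subset_span ⟨x, ?_⟩)
    simp only [kStar_boxInd]
    congr 2
    ext i : 1
    exact hx i

end box

/-! ### Integral operators in one coordinate -/

section sliceOp

variable {k : ℕ}

/-- The integral operator with nonnegative kernel `a`, acting in the `i`-th coordinate. -/
noncomputable def sliceOp (a : ℝ → ℝ → ENNReal) (i : Fin k) (ψ : (Fin k → ℝ) → ENNReal)
    (η : Fin k → ℝ) : ENNReal :=
  ∫⁻ u, ψ (Function.update η i u) * a (η i) u

/-- The composition of the operators `sliceOp (a i) i` over a list of coordinates. -/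
noncomputable def sliceOps (a : Fin k → ℝ → ℝ → ENNReal) (l : List (Fin k))
    (ψ : (Fin k → ℝ) → ENNReal) : (Fin k → ℝ) → ENNReal :=
  l.foldl (fun ψ i => sliceOp (a i) i ψ) ψ

theorem sliceOps_cons (a : Fin k → ℝ → ℝ → ENNReal) (i : Fin k) (l : List (Fin k))
    (ψ : (Fin k → ℝ) → ENNReal) :
    sliceOps a (i :: l) ψ = sliceOps a l (sliceOp (a i) i ψ) := rfl

theorem measurable_update_comp {β : Type*} [MeasurableSpace β] {ψ : (Fin k → ℝ) → ENNReal}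
    (hψ : Measurable ψ) (i : Fin k) {f : β → Fin k → ℝ} {g : β → ℝ} (hf : Measurable f)
    (hg : Measurable g) : Measurable fun b => ψ (Function.update (f b) i (g b)) :=
  hψ.comp (measurable_update'.comp (hf.prodMk hg))

theorem measurable_kernel_comp {β : Type*} [MeasurableSpace β] {a : ℝ → ℝ → ENNReal}
    (ha : Measurable (Function.uncurry a)) {f g : β → ℝ} (hf : Measurable f)
    (hg : Measurable g) : Measurable fun b => a (f b) (g b) :=
  ha.comp (hf.prodMk hg)

theorem measurable_update_section {ψ : (Fin k → ℝ) → ENNReal} (hψ : Measurable ψ) (i : Fin k)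
    (η : Fin k → ℝ) : Measurable fun u => ψ (Function.update η i u) :=
  measurable_update_comp hψ i measurable_const measurable_id

theorem measurable_slice {a : ℝ → ℝ → ENNReal} (ha : Measurable (Function.uncurry a))
    {ψ : (Fin k → ℝ) → ENNReal} (hψ : Measurable ψ) (i : Fin k) (η : Fin k → ℝ) (s : ℝ) :
    Measurable fun u => ψ (Function.update η i u) * a s u :=
  (measurable_update_section hψ i η).mul
    (measurable_kernel_comp ha measurable_const measurable_id)

theorem measurable_sliceOp {a : ℝ → ℝ → ENNReal} (ha : Measurable (Function.uncurry a))
    (i : Fin k) {ψ : (Fin k → ℝ) → ENNReal} (hψ : Measurable ψ) : Measurable (sliceOp a i ψ) :=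
  Measurable.lintegral_prod_right' (f := fun p : (Fin k → ℝ) × ℝ =>
    ψ (Function.update p.1 i p.2) * a (p.1 i) p.2)
    ((measurable_update_comp hψ i measurable_fst measurable_snd).mul
      (measurable_kernel_comp ha ((measurable_pi_apply i).comp measurable_fst) measurable_snd))

theorem measurable_sliceOps {a : Fin k → ℝ → ℝ → ENNReal}
    (ha : ∀ i, Measurable (Function.uncurry (a i))) (l : List (Fin k))
    {ψ : (Fin k → ℝ) → ENNReal} (hψ : Measurable ψ) : Measurable (sliceOps a l ψ) := by
  induction l generalizing ψ with
  | nil => exact hψ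
  | cons i l ih => exact ih (measurable_sliceOp (ha i) i hψ)

theorem sliceOp_comm {a b : ℝ → ℝ → ENNReal} (ha : Measurable (Function.uncurry a))
    (hb : Measurable (Function.uncurry b)) {i j : Fin k} (hij : i ≠ j)
    {ψ : (Fin k → ℝ) → ENNReal} (hψ : Measurable ψ) :
    sliceOp a i (sliceOp b j ψ) = sliceOp b j (sliceOp a i ψ) := by
  ext η
  have hm : Measurable fun p : ℝ × ℝ =>
      ψ (Function.update (Function.update η i p.1) j p.2) * (b (η j) p.2 * a (η i) p.1) :=
    (measurable_update_comp hψ j (measurable_update _ |>.comp measurable_fst) measurable_snd).mul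
      ((measurable_kernel_comp hb measurable_const measurable_snd).mul
        (measurable_kernel_comp ha measurable_const measurable_fst))
  have e1 : sliceOp a i (sliceOp b j ψ) η = ∫⁻ u, ∫⁻ v,
      ψ (Function.update (Function.update η i u) j v) * (b (η j) v * a (η i) u) := by
    refine lintegral_congr fun u => ?_
    simp only [sliceOp, Function.update_of_ne hij.symm]
    rw [← lintegral_mul_const _ (measurable_slice hb hψ j _ _)]
    exact lintegral_congr fun v => mul_assoc _ _ _
  have e2 : sliceOp b j (sliceOp a i ψ) η = ∫⁻ v, ∫⁻ u,
      ψ (Function.update (Function.update η i u) j v) * (b (η j) v * a (η i) u) := by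
    refine lintegral_congr fun v => ?_
    simp only [sliceOp, Function.update_of_ne hij]
    rw [← lintegral_mul_const _ (measurable_slice ha hψ i _ _)]
    refine lintegral_congr fun u => ?_
    rw [Function.update_comm hij.symm]; ring
  rw [e1, e2]
  exact lintegral_lintegral_swap hm.aemeasurable

theorem sliceOps_comm_sliceOp {a : Fin k → ℝ → ℝ → ENNReal}
    (ha : ∀ i, Measurable (Function.uncurry (a i))) {b : ℝ → ℝ → ENNReal}
    (hb : Measurable (Function.uncurry b)) {i : Fin k} {l : List (Fin k)} (hi : i ∉ l)
    {ψ : (Fin k → ℝ) → ENNReal} (hψ : Measurable ψ) :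
    sliceOps a l (sliceOp b i ψ) = sliceOp b i (sliceOps a l ψ) := by
  induction l generalizing ψ with
  | nil => rfl
  | cons j l ih =>
    rw [List.mem_cons, not_or] at hi
    rw [sliceOps_cons, sliceOps_cons, sliceOp_comm (ha j) hb (Ne.symm hi.1) hψ,
      ih hi.2 (measurable_sliceOp (ha j) j hψ)]

/-- The transpose of `sliceOp a i` has the transposed kernel. -/
theorem lintegral_mul_sliceOp {a : ℝ → ℝ → ENNReal} (ha : Measurable (Function.uncurry a))
    (i : Fin k) {ψ₁ ψ₂ : (Fin k → ℝ) → ENNReal} (h₁ : Measurable ψ₁) (h₂ : Measurable ψ₂) :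
    ∫⁻ η, ψ₁ η * sliceOp a i ψ₂ η = ∫⁻ η, sliceOp (fun u v => a v u) i ψ₁ η * ψ₂ η := by
  have ha' : Measurable (Function.uncurry fun u v => a v u) := ha.comp measurable_swap
  refine lintegral_eq_of_lmarginal_eq {i} (h₁.mul (measurable_sliceOp ha i h₂))
    ((measurable_sliceOp ha' i h₁).mul h₂) ?_
  rw [lmarginal_singleton, lmarginal_singleton]
  ext η
  simp only [sliceOp, Function.update_self, Function.update_idem]
  have hm₁ : Measurable fun t => ψ₁ (Function.update η i t) :=
    measurable_update_comp h₁ i measurable_const measurable_id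
  have hm₂ : Measurable fun t => ψ₂ (Function.update η i t) :=
    measurable_update_comp h₂ i measurable_const measurable_id
  calc ∫⁻ t, ψ₁ (Function.update η i t) * ∫⁻ u, ψ₂ (Function.update η i u) * a t u
      = ∫⁻ t, ∫⁻ u, ψ₁ (Function.update η i t) * (ψ₂ (Function.update η i u) * a t u) :=
        lintegral_congr fun t => (lintegral_const_mul _
          (hm₂.mul (measurable_kernel_comp ha measurable_const measurable_id))).symm
    _ = ∫⁻ u, ∫⁻ t, ψ₁ (Function.update η i t) * (ψ₂ (Function.update η i u) * a t u) :=
        lintegral_lintegral_swap (Measurable.aemeasurable ((hm₁.comp measurable_fst).mul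
          ((hm₂.comp measurable_snd).mul ha)))
    _ = ∫⁻ u, (∫⁻ t, ψ₁ (Function.update η i t) * a t u) * ψ₂ (Function.update η i u) := by
        refine lintegral_congr fun u => ?_
        rw [← lintegral_mul_const _ (measurable_slice ha' h₁ i η u)]
        exact lintegral_congr fun t => by ring

theorem sliceOp_transpose_sliceOp {a w : ℝ → ℝ → ENNReal}
    (haw : ∀ f : ℝ → ENNReal, Measurable f → ∀ u,
      ∫⁻ y, (∫⁻ v, f v * a y v) * a y u = ∫⁻ v, f v * w u v)
    (i : Fin k) {ψ : (Fin k → ℝ) → ENNReal} (hψ : Measurable ψ) :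
    sliceOp (fun u v => a v u) i (sliceOp a i ψ) = sliceOp w i ψ := by
  ext η
  simp only [sliceOp, Function.update_self, Function.update_idem]
  exact haw _ (measurable_update_section hψ i η) _

/-- The energy identity: if `w` is the kernel of `aᵀ a` in each coordinate, then
`⟨A ψ₁, A ψ₂⟩ = ⟨ψ₁, W ψ₂⟩` for the iterated operators. -/
theorem lintegral_sliceOps_mul_sliceOps {a w : Fin k → ℝ → ℝ → ENNReal}
    (ha : ∀ i, Measurable (Function.uncurry (a i)))
    (hw : ∀ i, Measurable (Function.uncurry (w i))) {l : List (Fin k)} (hl : l.Nodup)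
    (haw : ∀ i ∈ l, ∀ f : ℝ → ENNReal, Measurable f → ∀ u,
      ∫⁻ y, (∫⁻ v, f v * a i y v) * a i y u = ∫⁻ v, f v * w i u v)
    {ψ₁ ψ₂ : (Fin k → ℝ) → ENNReal} (h₁ : Measurable ψ₁) (h₂ : Measurable ψ₂) :
    ∫⁻ η, sliceOps a l ψ₁ η * sliceOps a l ψ₂ η = ∫⁻ η, ψ₁ η * sliceOps w l ψ₂ η := by
  induction l generalizing ψ₁ ψ₂ with
  | nil => rfl
  | cons i l ih =>
    rw [List.nodup_cons] at hl
    have hW := measurable_sliceOps hw l h₂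
    have hT : Measurable (Function.uncurry fun u v => a i v u) := (ha i).comp measurable_swap
    simp only [sliceOps_cons]
    rw [ih hl.2 (fun j hj => haw j (List.mem_cons_of_mem _ hj)) (measurable_sliceOp (ha i) i h₁)
      (measurable_sliceOp (ha i) i h₂), sliceOps_comm_sliceOp hw (ha i) hl.1 h₂,
      sliceOps_comm_sliceOp hw (hw i) hl.1 h₂,
      ← sliceOp_transpose_sliceOp (haw i List.mem_cons_self) i hW,
      lintegral_mul_sliceOp hT i h₁ (measurable_sliceOp (ha i) i hW)]

theorem sliceOp_ae_eq_zero {a : ℝ → ℝ → ENNReal} (ha : Measurable (Function.uncurry a))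
    (i : Fin k) {ψ : (Fin k → ℝ) → ENNReal} (hψ : Measurable ψ) (h : ψ =ᵐ[volume] 0) :
    sliceOp a i ψ =ᵐ[volume] 0 := by
  rw [← lintegral_eq_zero_iff (measurable_sliceOp ha i hψ)]
  have := lintegral_mul_sliceOp ha i (measurable_const (a := (1 : ENNReal))) hψ
  simp only [one_mul] at this
  rw [this]
  refine lintegral_eq_zero_of_ae_eq_zero ?_
  filter_upwards [h] with η hη
  simp only [Pi.zero_apply] at hη ⊢
  rw [hη, mul_zero]

theorem sliceOps_ae_eq_zero {a : Fin k → ℝ → ℝ → ENNReal}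
    (ha : ∀ i, Measurable (Function.uncurry (a i))) (l : List (Fin k))
    {ψ : (Fin k → ℝ) → ENNReal} (hψ : Measurable ψ) (h : ψ =ᵐ[volume] 0) :
    sliceOps a l ψ =ᵐ[volume] 0 := by
  induction l generalizing ψ with
  | nil => exact h
  | cons i l ih => exact ih (measurable_sliceOp (ha i) i hψ) (sliceOp_ae_eq_zero (ha i) i hψ h)

theorem ae_ae_update {p : (Fin k → ℝ) → Prop} (hp : ∀ᵐ η, p η) (i : Fin k) :
    ∀ᵐ η : Fin k → ℝ, ∀ᵐ u : ℝ, p (Function.update η i u) := by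
  set N := toMeasurable volume {η | ¬ p η}
  have hN : volume N = 0 := by rw [measure_toMeasurable]; exact hp
  have hm : Measurable (N.indicator (1 : (Fin k → ℝ) → ENNReal)) :=
    measurable_one.indicator (measurableSet_toMeasurable _ _)
  have hz : N.indicator (1 : (Fin k → ℝ) → ENNReal) =ᵐ[volume] 0 := indicator_meas_zero hN
  filter_upwards [sliceOp_ae_eq_zero (a := fun _ _ => 1) measurable_const i hm hz] with η hη
  simp only [sliceOp, mul_one, Pi.zero_apply] at hη
  rw [lintegral_eq_zero_iff (measurable_update_section hm i η)] at hη
  filter_upwards [hη] with u hu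
  by_contra hpu
  have : Function.update η i u ∈ N := subset_toMeasurable _ _ hpu
  simp [this] at hu

/-- An iterated operator as a single integral over the coordinates in the list. -/
theorem sliceOps_eq_lmarginal {a : Fin k → ℝ → ℝ → ENNReal}
    (ha : ∀ i, Measurable (Function.uncurry (a i))) {l : List (Fin k)} (hl : l.Nodup)
    {ψ : (Fin k → ℝ) → ENNReal} (hψ : Measurable ψ) (η : Fin k → ℝ) :
    sliceOps a l ψ η =
      lmarginal (fun _ => volume) l.toFinset
        (fun z => ψ z * ∏ i ∈ l.toFinset, a i (η i) (z i)) η := by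
  induction l generalizing ψ with
  | nil => simp [sliceOps]
  | cons i l ih =>
    rw [List.nodup_cons] at hl
    have hi : i ∉ l.toFinset := by simpa using hl.1
    have hm : Measurable fun z => ψ z * ∏ j ∈ insert i l.toFinset, a j (η j) (z j) :=
      hψ.mul (Finset.measurable_fun_prod _ fun j _ =>
        measurable_kernel_comp (ha j) measurable_const (measurable_pi_apply j))
    rw [sliceOps_cons, ih hl.2 (measurable_sliceOp (ha i) i hψ), List.toFinset_cons,
      lmarginal_insert' _ hm hi]
    refine lintegral_congr fun y => ?_
    simp only [sliceOp]
    set z := Function.updateFinset η l.toFinset y with hz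
    have hzi : z i = η i := by simp [hz, Function.updateFinset, hl.1]
    rw [hzi, ← lintegral_mul_const _ (measurable_slice (ha i) hψ i _ _)]
    refine lintegral_congr fun u => ?_
    rw [Finset.prod_insert hi, Function.update_self, mul_assoc]
    congr 2
    refine Finset.prod_congr rfl fun j hj => ?_
    rw [Function.update_of_ne (ne_of_mem_of_not_mem hj hi)]

end sliceOp

/-! ### The operator `K_H^{*,(k)}` on `|𝓗^H|` -/

section absSpace

variable {k : ℕ} (H : Fin k → Hurst)

/-- The coordinates in `C^{(>)}`, in increasing order. -/
noncomputable def bigList : List (Fin k) := (List.finRange k).filter fun i => (1 / 2 : ℝ) < H i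

theorem mem_bigList {i : Fin k} : i ∈ bigList H ↔ (1 / 2 : ℝ) < H i := by
  simp [bigList]

theorem nodup_bigList : (bigList H).Nodup := (List.nodup_finRange k).filter _

theorem kStar_eq_foldl_bigList (φ : (Fin k → ℝ) → ℝ) :
    kStar H φ = (bigList H).foldl (fun ψ i => kStarOne (H i) i ψ) φ := by
  rw [kStar, bigList, List.foldl_filter]
  congr 1
  ext ψ i : 2
  by_cases hi : (1 / 2 : ℝ) < H i
  · simp only [hi, decide_true, if_true]
  · have : (H i : ℝ) = 1 / 2 := le_antisymm (not_lt.1 hi) (H i).2.1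
    ext η
    simp [kStarOne, this]

/-- The iterated operator of `K_H^{*,(k)}` on nonnegative functions. -/
noncomputable def kOps (ψ : (Fin k → ℝ) → ENNReal) : (Fin k → ℝ) → ENNReal :=
  sliceOps (fun i => kKer (H i)) (bigList H) ψ

theorem measurable_uncurry_kKer (h : ℝ) : Measurable (Function.uncurry (kKer h)) :=
  measurable_kKer h measurable_fst measurable_snd

theorem measurable_uncurry_wKer (h : ℝ) : Measurable (Function.uncurry (wKer h)) :=
  measurable_wKer h measurable_fst measurable_snd

theorem measurable_kOps {ψ : (Fin k → ℝ) → ENNReal} (hψ : Measurable ψ) :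
    Measurable (kOps H ψ) :=
  measurable_sliceOps (fun i => measurable_uncurry_kKer (H i)) _ hψ

theorem measurable_mix : Measurable fun p : (Fin k → ℝ) × (Big H → ℝ) => mix H p.1 p.2 := by
  refine measurable_pi_lambda _ fun i => ?_
  unfold mix
  split_ifs with hi <;> fun_prop

theorem measurable_weight : Measurable fun p : (Fin k → ℝ) × (Big H → ℝ) => weight H p.1 p.2 := by
  unfold weight
  fun_prop

/-- Integrating out `v` in a product kernel iterates the one-coordinate operators over `C^{(>)}`. -/
theorem lintegral_mix (a : Fin k → ℝ → ℝ → ENNReal)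
    (ha : ∀ i, Measurable (Function.uncurry (a i))) {ψ : (Fin k → ℝ) → ENNReal}
    (hψ : Measurable ψ) (u : Fin k → ℝ) :
    ∫⁻ v : Big H → ℝ, ψ (mix H u v) * ∏ i : Big H, a i (u i) (v i) =
      sliceOps a (bigList H) ψ u := by
  have hS : ∀ i, i ∈ (bigList H).toFinset ↔ (1 / 2 : ℝ) < H i := fun i => by
    rw [List.mem_toFinset, mem_bigList]
  let e : {i // i ∈ (bigList H).toFinset} ≃ Big H := Equiv.subtypeEquivRight hS
  have hmp := measurePreserving_piCongrLeft (fun _ : Big H => (volume : Measure ℝ)) e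
  rw [sliceOps_eq_lmarginal ha (nodup_bigList H) hψ, lmarginal, volume_pi,
    hmp.lintegral_map_equiv]
  refine lintegral_congr fun y => ?_
  have hv : ∀ i (hi : i ∈ (bigList H).toFinset),
      (MeasurableEquiv.piCongrLeft (fun _ : Big H => ℝ) e) y ⟨i, (hS i).1 hi⟩ = y ⟨i, hi⟩ :=
    fun i hi => Equiv.piCongrLeft_apply_apply (fun _ : Big H => ℝ) e y ⟨i, hi⟩
  have hmix : mix H u ((MeasurableEquiv.piCongrLeft (fun _ : Big H => ℝ) e) y) =
      Function.updateFinset u (bigList H).toFinset y := by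
    ext i
    by_cases hi : i ∈ (bigList H).toFinset
    · rw [mix, dif_pos ((hS i).1 hi), hv i hi, Function.updateFinset, dif_pos hi]
    · rw [mix, dif_neg (fun h => hi ((hS i).2 h)), Function.updateFinset, dif_neg hi]
  rw [hmix, Finset.prod_subtype _ hS]
  congr 1
  refine Finset.prod_congr rfl fun i _ => ?_
  rw [hv i ((hS i).2 i.2), Function.updateFinset, dif_pos ((hS i).2 i.2)]

/-- `(u, v) ↦ w(u, v)` pulls null sets back to null sets. -/
theorem ae_mix {p : (Fin k → ℝ) → Prop} (hp : ∀ᵐ η, p η) :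
    ∀ᵐ q : (Fin k → ℝ) × (Big H → ℝ), p (mix H q.1 q.2) := by
  set N := toMeasurable volume {η | ¬ p η}
  have hN : volume N = 0 := by rw [measure_toMeasurable]; exact hp
  have hm : Measurable (N.indicator (1 : (Fin k → ℝ) → ENNReal)) :=
    measurable_one.indicator (measurableSet_toMeasurable _ _)
  have hz : N.indicator (1 : (Fin k → ℝ) → ENNReal) =ᵐ[volume] 0 := indicator_meas_zero hN
  have hm2 : Measurable fun q : (Fin k → ℝ) × (Big H → ℝ) =>
      N.indicator (1 : (Fin k → ℝ) → ENNReal) (mix H q.1 q.2) := hm.comp (measurable_mix H)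
  have h0 : ∫⁻ q : (Fin k → ℝ) × (Big H → ℝ),
      N.indicator (1 : (Fin k → ℝ) → ENNReal) (mix H q.1 q.2) = 0 := by
    rw [Measure.volume_eq_prod, lintegral_prod _ hm2.aemeasurable]
    refine lintegral_eq_zero_of_ae_eq_zero ?_
    filter_upwards [sliceOps_ae_eq_zero (a := fun _ _ _ => 1) (fun _ => measurable_const)
      (bigList H) hm hz] with u hu
    rw [← lintegral_mix H (fun _ _ _ => 1) (fun _ => measurable_const) hm] at hu
    simpa using hu
  rw [lintegral_eq_zero_iff hm2] at h0
  filter_upwards [h0] with q hq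
  by_contra hpq
  have : mix H q.1 q.2 ∈ N := subset_toMeasurable _ _ hpq
  simp [this] at hq

/-- The energy `∬ ψ₁(u) ψ₂(w(u,v)) ∏ H_i (2 H_i - 1) |u_i - v_i|^{2 H_i - 2} du dv` of nonnegative
functions. -/
noncomputable def energy (ψ₁ ψ₂ : (Fin k → ℝ) → ENNReal) : ENNReal :=
  ∫⁻ p : (Fin k → ℝ) × (Big H → ℝ),
    ENNReal.ofReal (weight H p.1 p.2) * (ψ₁ p.1 * ψ₂ (mix H p.1 p.2))

theorem weight_factor_nonneg (i : Big H) (s : ℝ) :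
    0 ≤ (H i : ℝ) * (2 * H i - 1) * |s| ^ (2 * (H i : ℝ) - 2) := by
  have := i.2
  exact mul_nonneg (mul_nonneg (by linarith) (by linarith)) (by positivity)

theorem weight_nonneg (u : Fin k → ℝ) (v : Big H → ℝ) : 0 ≤ weight H u v :=
  Finset.prod_nonneg fun i _ => weight_factor_nonneg H i _

/-- The energy of two nonnegative functions is the `L²` pairing of their images. -/
theorem energy_eq_lintegral_kOps_mul_kOps {ψ₁ ψ₂ : (Fin k → ℝ) → ENNReal} (h₁ : Measurable ψ₁)
    (h₂ : Measurable ψ₂) : energy H ψ₁ ψ₂ = ∫⁻ η, kOps H ψ₁ η * kOps H ψ₂ η := by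
  have hm : Measurable fun p : (Fin k → ℝ) × (Big H → ℝ) =>
      ENNReal.ofReal (weight H p.1 p.2) * (ψ₁ p.1 * ψ₂ (mix H p.1 p.2)) :=
    (measurable_weight H).ennreal_ofReal.mul
      ((h₁.comp measurable_fst).mul (h₂.comp (measurable_mix H)))
  rw [kOps, kOps, lintegral_sliceOps_mul_sliceOps (w := fun i => wKer (H i))
    (fun i => measurable_uncurry_kKer (H i)) (fun i => measurable_uncurry_wKer (H i))
    (nodup_bigList H)
    (fun i hi f hf u => lintegral_kKer_comp ((mem_bigList H).1 hi) (H i).2.2 hf u) h₁ h₂,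
    energy, Measure.volume_eq_prod, lintegral_prod _ hm.aemeasurable]
  refine lintegral_congr fun u => ?_
  rw [← lintegral_mix H _ (fun i => measurable_uncurry_wKer (H i)) h₂,
    ← lintegral_const_mul]
  · refine lintegral_congr fun v => ?_
    rw [weight, ENNReal.ofReal_prod_of_nonneg fun i _ => weight_factor_nonneg H i _]
    simp only [wKer]
    ring
  · refine (h₂.comp ((measurable_mix H).comp (measurable_const.prodMk measurable_id))).mul ?_
    refine Finset.measurable_fun_prod _ fun i _ => ?_
    exact measurable_wKer _ measurable_const (measurable_pi_apply i)

theorem lintegral_kKer_ne_zero {h : ℝ} (h0 : 1 / 2 < h) (h1 : h < 1) (u : ℝ) :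
    ∫⁻ y, kKer h y u ≠ 0 := by
  intro h'
  have hm : Measurable fun y => kKer h y u := by fun_prop
  rw [lintegral_eq_zero_iff hm] at h'
  have : volume (Iio u) = 0 := by
    refine measure_mono_null (fun y hy => ?_) h'
    have hy : 0 < u - y := by have : y < u := hy; linarith
    have := mul_pos (kConst_pos h0 h1) (Real.rpow_pos_of_pos hy (h - 3 / 2))
    simpa [kKer, posPow_of_pos hy] using this
  simp at this

/-- If no column of the kernel vanishes and the image of `ψ` is finite almost everywhere, then so
is `ψ`. -/
theorem ae_lt_top_of_sliceOp_ae_lt_top {a : ℝ → ℝ → ENNReal}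
    (ha : Measurable (Function.uncurry a)) (hpos : ∀ u, ∫⁻ y, a y u ≠ 0) (i : Fin k)
    {ψ : (Fin k → ℝ) → ENNReal} (hψ : Measurable ψ) (h : ∀ᵐ η, sliceOp a i ψ η < ⊤) :
    ∀ᵐ η, ψ η < ⊤ := by
  set N := {η | ψ η = ⊤}
  have hNm : MeasurableSet N := hψ (measurableSet_singleton ⊤)
  have hm : Measurable (N.indicator (1 : (Fin k → ℝ) → ENNReal)) := measurable_one.indicator hNm
  have hz : sliceOp a i (N.indicator 1) =ᵐ[volume] 0 := by
    filter_upwards [h] with η hη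
    -- The part of the integral over `{ψ = ∞}` is `0` or `∞`, so finiteness forces it to be `0`.
    have hle : ⊤ * sliceOp a i (N.indicator 1) η ≤ sliceOp a i ψ η := by
      rw [sliceOp, ← lintegral_const_mul _ (measurable_slice ha hm i η _)]
      refine lintegral_mono fun u => ?_
      rw [← mul_assoc]
      gcongr
      by_cases hu : Function.update η i u ∈ N
      · have : ψ (Function.update η i u) = ⊤ := hu
        simp [this]
      · simp [hu]
    by_contra hne
    rw [ENNReal.top_mul hne] at hle
    exact absurd hη (not_lt.2 hle)
  have hT : Measurable (Function.uncurry fun u v => a v u) := ha.comp measurable_swap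
  have h0 := lintegral_mul_sliceOp ha i (measurable_const (a := (1 : ENNReal))) hm
  rw [lintegral_eq_zero_of_ae_eq_zero (by
    filter_upwards [hz] with η hη; simp only [Pi.zero_apply] at hη ⊢; rw [hη, mul_zero])] at h0
  have h1 := (lintegral_eq_zero_iff ((measurable_sliceOp hT i measurable_const).mul hm)).1 h0.symm
  filter_upwards [h1] with η hη
  rw [lt_top_iff_ne_top]
  intro htop
  have : η ∈ N := htop
  have h2 := hpos (η i)
  simp [this, sliceOp] at hη
  exact h2 hη

theorem ae_lt_top_of_sliceOps_ae_lt_top {a : Fin k → ℝ → ℝ → ENNReal}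
    (ha : ∀ i, Measurable (Function.uncurry (a i))) {l : List (Fin k)}
    (hpos : ∀ i ∈ l, ∀ u, ∫⁻ y, a i y u ≠ 0)
    {ψ : (Fin k → ℝ) → ENNReal} (hψ : Measurable ψ) (h : ∀ᵐ η, sliceOps a l ψ η < ⊤) :
    ∀ᵐ η, ψ η < ⊤ := by
  induction l generalizing ψ with
  | nil => exact h
  | cons i l ih =>
    exact ae_lt_top_of_sliceOp_ae_lt_top (ha i) (hpos i List.mem_cons_self) i hψ
      (ih (fun j hj => hpos j (List.mem_cons_of_mem _ hj)) (measurable_sliceOp (ha i) i hψ) h)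

theorem kStarOne_ae_eq {h : ℝ} (h0 : 1 / 2 < h) (h1 : h < 1) (i : Fin k)
    {A B : (Fin k → ℝ) → ENNReal} (hA : Measurable A) (hB : Measurable B)
    (hA' : ∀ᵐ η, sliceOp (kKer h) i A η < ⊤) (hB' : ∀ᵐ η, sliceOp (kKer h) i B η < ⊤)
    {φ : (Fin k → ℝ) → ℝ} (hφ : φ =ᵐ[volume] fun η => (A η).toReal - (B η).toReal) :
    kStarOne h i φ =ᵐ[volume]
      fun η => (sliceOp (kKer h) i A η).toReal - (sliceOp (kKer h) i B η).toReal := by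
  have hk := measurable_uncurry_kKer h
  filter_upwards [hA', hB', ae_ae_update hφ i] with η hAη hBη hφη
  have mA := measurable_slice hk hA i η (η i)
  have mB := measurable_slice hk hB i η (η i)
  rw [kStarOne, if_neg h0.ne', sliceOp, sliceOp,
    ← integral_toReal mA.aemeasurable (ae_lt_top mA hAη.ne),
    ← integral_toReal mB.aemeasurable (ae_lt_top mB hBη.ne),
    ← integral_sub (integrable_toReal_of_lintegral_ne_top mA.aemeasurable hAη.ne)
      (integrable_toReal_of_lintegral_ne_top mB.aemeasurable hBη.ne), ← integral_const_mul]
  refine integral_congr_ae ?_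
  filter_upwards [hφη] with u hu
  rw [hu, ENNReal.toReal_mul, ENNReal.toReal_mul, kKer,
    ENNReal.toReal_ofReal (mul_nonneg (kConst_pos h0 h1).le (posPow_nonneg _ _)), kConst]
  ring

/-- If the last iterates of `A` and `B` are finite almost everywhere, then so are all intermediate
ones; hence every Bochner integral in `K_H^{*,(k)}(A - B)` converges absolutely for almost every
argument and the signed operator is the difference of the positive ones. -/
theorem kStar_ae_eq {A B : (Fin k → ℝ) → ENNReal} (hA : Measurable A) (hB : Measurable B)
    (hA' : ∀ᵐ η, kOps H A η < ⊤) (hB' : ∀ᵐ η, kOps H B η < ⊤)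
    {φ : (Fin k → ℝ) → ℝ} (hφ : φ =ᵐ[volume] fun η => (A η).toReal - (B η).toReal) :
    kStar H φ =ᵐ[volume] fun η => (kOps H A η).toReal - (kOps H B η).toReal := by
  rw [kStar_eq_foldl_bigList]
  unfold kOps at *
  have hbig : ∀ i ∈ bigList H, (1 / 2 : ℝ) < H i := fun i hi => (mem_bigList H).1 hi
  generalize bigList H = l at *
  induction l generalizing A B φ with
  | nil => exact hφ
  | cons i l ih =>
    have hk := measurable_uncurry_kKer (H i)
    have hi := hbig i List.mem_cons_self
    have hl : ∀ j ∈ l, (1 / 2 : ℝ) < H j := fun j hj => hbig j (List.mem_cons_of_mem _ hj)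
    have hfin : ∀ {C : (Fin k → ℝ) → ENNReal}, Measurable C →
        (∀ᵐ η, sliceOps (fun i => kKer (H i)) (i :: l) C η < ⊤) →
        ∀ᵐ η, sliceOp (kKer (H i)) i C η < ⊤ := fun hC hC' =>
      ae_lt_top_of_sliceOps_ae_lt_top (fun j => measurable_uncurry_kKer (H j))
        (fun j hj u => lintegral_kKer_ne_zero (hl j hj) (H j).2.2 u)
        (measurable_sliceOp hk i hC) hC'
    exact ih (measurable_sliceOp hk i hA) (measurable_sliceOp hk i hB)
      (kStarOne_ae_eq hi (H i).2.2 i hA hB (hfin hA hA') (hfin hB hB') hφ) hA' hB' hl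

/-- Nonnegative measurable functions of finite energy. -/
structure FiniteEnergy (f : (Fin k → ℝ) → ℝ) : Prop where
  measurable : Measurable f
  nonneg : ∀ η, 0 ≤ f η
  energy_lt_top : energy H (fun η => ENNReal.ofReal (f η)) (fun η => ENNReal.ofReal (f η)) < ⊤

/-- The function `K_H^{*,(k)} f` for nonnegative `f`. -/
noncomputable def kPos (f : (Fin k → ℝ) → ℝ) (η : Fin k → ℝ) : ℝ :=
  (kOps H (fun η => ENNReal.ofReal (f η)) η).toReal

variable {H}

namespace FiniteEnergy

variable {f f₁ f₂ : (Fin k → ℝ) → ℝ}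

theorem measurable_kOps_ofReal (hf : FiniteEnergy H f) :
    Measurable (kOps H fun η => ENNReal.ofReal (f η)) :=
  measurable_kOps H hf.measurable.ennreal_ofReal

theorem lintegral_kOps_sq_lt_top (hf : FiniteEnergy H f) :
    ∫⁻ η, kOps H (fun η => ENNReal.ofReal (f η)) η ^ 2 < ⊤ := by
  simp_rw [sq]
  rw [← energy_eq_lintegral_kOps_mul_kOps H hf.measurable.ennreal_ofReal
    hf.measurable.ennreal_ofReal]
  exact hf.energy_lt_top

theorem kOps_ae_lt_top (hf : FiniteEnergy H f) :
    ∀ᵐ η, kOps H (fun η => ENNReal.ofReal (f η)) η < ⊤ := by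
  filter_upwards [ae_lt_top (hf.measurable_kOps_ofReal.pow_const 2)
    hf.lintegral_kOps_sq_lt_top.ne] with η hη
  by_contra h
  rw [not_lt, top_le_iff] at h
  simp [h] at hη

theorem energy_pair_lt_top (h₁ : FiniteEnergy H f₁) (h₂ : FiniteEnergy H f₂) :
    energy H (fun η => ENNReal.ofReal (f₁ η)) (fun η => ENNReal.ofReal (f₂ η)) < ⊤ := by
  rw [energy_eq_lintegral_kOps_mul_kOps H h₁.measurable.ennreal_ofReal
    h₂.measurable.ennreal_ofReal]
  refine (lintegral_mono fun η => ennreal_mul_le_sq_add_sq _ _).trans_lt ?_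
  rw [lintegral_add_left (h₁.measurable_kOps_ofReal.pow_const 2)]
  exact ENNReal.add_lt_top.2 ⟨h₁.lintegral_kOps_sq_lt_top, h₂.lintegral_kOps_sq_lt_top⟩

theorem memLp_kPos (hf : FiniteEnergy H f) : MemLp (kPos H f) 2 volume := by
  have hm : Measurable (kPos H f) := hf.measurable_kOps_ofReal.ennreal_toReal
  rw [memLp_two_iff_integrable_sq hm.aestronglyMeasurable]
  have := integrable_toReal_of_lintegral_ne_top
    (hf.measurable_kOps_ofReal.pow_const 2).aemeasurable hf.lintegral_kOps_sq_lt_top.ne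
  simpa [kPos, ENNReal.toReal_pow] using this

theorem integrable_weight (h₁ : FiniteEnergy H f₁) (h₂ : FiniteEnergy H f₂) :
    Integrable (fun p : (Fin k → ℝ) × (Big H → ℝ) =>
      weight H p.1 p.2 * (f₁ p.1 * f₂ (mix H p.1 p.2))) ∧
    ∫ y, kPos H f₁ y * kPos H f₂ y = ∫ p : (Fin k → ℝ) × (Big H → ℝ),
      weight H p.1 p.2 * (f₁ p.1 * f₂ (mix H p.1 p.2)) := by
  have hm : Measurable fun p : (Fin k → ℝ) × (Big H → ℝ) =>
      weight H p.1 p.2 * (f₁ p.1 * f₂ (mix H p.1 p.2)) :=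
    (measurable_weight H).mul ((h₁.measurable.comp measurable_fst).mul
      (h₂.measurable.comp (measurable_mix H)))
  have hnn : ∀ p : (Fin k → ℝ) × (Big H → ℝ),
      0 ≤ weight H p.1 p.2 * (f₁ p.1 * f₂ (mix H p.1 p.2)) := fun p =>
    mul_nonneg (weight_nonneg H _ _) (mul_nonneg (h₁.nonneg _) (h₂.nonneg _))
  have e : ∫⁻ p : (Fin k → ℝ) × (Big H → ℝ),
      ENNReal.ofReal (weight H p.1 p.2 * (f₁ p.1 * f₂ (mix H p.1 p.2))) =
      energy H (fun η => ENNReal.ofReal (f₁ η)) (fun η => ENNReal.ofReal (f₂ η)) := by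
    refine lintegral_congr fun p => ?_
    rw [ENNReal.ofReal_mul (weight_nonneg H _ _), ENNReal.ofReal_mul (h₁.nonneg _)]
  refine ⟨⟨hm.aestronglyMeasurable, ?_⟩, ?_⟩
  · rw [hasFiniteIntegral_iff_ofReal (.of_forall hnn), e]
    exact energy_pair_lt_top h₁ h₂
  · rw [integral_eq_lintegral_of_nonneg_ae (.of_forall hnn) hm.aestronglyMeasurable, e,
      energy_eq_lintegral_kOps_mul_kOps H h₁.measurable.ennreal_ofReal
        h₂.measurable.ennreal_ofReal]
    refine Eq.trans ?_ (integral_toReal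
      (h₁.measurable_kOps_ofReal.mul h₂.measurable_kOps_ofReal).aemeasurable ?_)
    · simp only [kPos, ENNReal.toReal_mul]
    · filter_upwards [h₁.kOps_ae_lt_top, h₂.kOps_ae_lt_top] with η a b
      exact ENNReal.mul_lt_top a b

end FiniteEnergy

/-- A member of `|𝓗^H|` is a difference of nonnegative measurable functions of finite energy, and
`K_H^{*,(k)}` acts on it accordingly. -/
theorem MemAbsHSpace.exists_sub {φ : (Fin k → ℝ) → ℝ} (hφ : MemAbsHSpace H φ) :
    ∃ f g : (Fin k → ℝ) → ℝ, FiniteEnergy H f ∧ FiniteEnergy H g ∧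
      (φ =ᵐ[volume] fun η => f η - g η) ∧
      kStar H φ =ᵐ[volume] fun η => kPos H f η - kPos H g η := by
  obtain ⟨ψ, hψm, hψ⟩ := hφ.aemeasurable
  have hfin : ∀ f : (Fin k → ℝ) → ℝ, Measurable f → (∀ η, 0 ≤ f η) → (∀ η, f η ≤ |ψ η|) →
      FiniteEnergy H f := fun f hfm hf0 hfψ => by
    refine ⟨hfm, hf0, lt_of_le_of_lt ?_ hφ.lintegral_lt_top⟩
    refine lintegral_mono_ae ?_
    have h1 : ∀ᵐ p : (Fin k → ℝ) × (Big H → ℝ), φ p.1 = ψ p.1 :=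
      Measure.quasiMeasurePreserving_fst.ae hψ
    filter_upwards [h1, ae_mix H hψ] with p hp1 hp2
    rw [hp1, hp2, ← ENNReal.ofReal_mul (hf0 _), ← ENNReal.ofReal_mul (weight_nonneg H _ _)]
    refine ENNReal.ofReal_le_ofReal (mul_le_mul_of_nonneg_left ?_ (weight_nonneg H _ _))
    exact mul_le_mul (hfψ _) (hfψ _) (hf0 _) (abs_nonneg _)
  have hf := hfin (fun η => max (ψ η) 0) (hψm.max measurable_const) (fun η => le_max_right _ _)
    fun η => max_le (le_abs_self _) (abs_nonneg _)
  have hg := hfin (fun η => max (-ψ η) 0) (hψm.neg.max measurable_const)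
    (fun η => le_max_right _ _) fun η => max_le (neg_le_abs _) (abs_nonneg _)
  have hsub : φ =ᵐ[volume] fun η => max (ψ η) 0 - max (-ψ η) 0 := by
    filter_upwards [hψ] with η hη
    rw [hη, max_zero_sub_max_neg_zero_eq_self]
  refine ⟨_, _, hf, hg, hsub, ?_⟩
  refine kStar_ae_eq H hf.measurable.ennreal_ofReal hg.measurable.ennreal_ofReal
    hf.kOps_ae_lt_top hg.kOps_ae_lt_top ?_
  filter_upwards [hsub] with η hη
  rw [hη, ENNReal.toReal_ofReal (hf.nonneg η), ENNReal.toReal_ofReal (hg.nonneg η)]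

theorem MemAbsHSpace.memLp_kStar {φ : (Fin k → ℝ) → ℝ} (hφ : MemAbsHSpace H φ) :
    MemLp (kStar H φ) 2 volume := by
  obtain ⟨f, g, hf, hg, -, h⟩ := hφ.exists_sub
  exact (memLp_congr_ae h).2 (hf.memLp_kPos.sub hg.memLp_kPos)

theorem MemAbsHSpace.integrable_weight {φ₁ φ₂ : (Fin k → ℝ) → ℝ} (h₁ : MemAbsHSpace H φ₁)
    (h₂ : MemAbsHSpace H φ₂) :
    Integrable (fun p : (Fin k → ℝ) × (Big H → ℝ) =>
      weight H p.1 p.2 * (φ₁ p.1 * φ₂ (mix H p.1 p.2))) ∧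
    ∫ y, kStar H φ₁ y * kStar H φ₂ y = ∫ p : (Fin k → ℝ) × (Big H → ℝ),
      weight H p.1 p.2 * (φ₁ p.1 * φ₂ (mix H p.1 p.2)) := by
  obtain ⟨f₁, g₁, hf₁, hg₁, e₁, K₁⟩ := h₁.exists_sub
  obtain ⟨f₂, g₂, hf₂, hg₂, e₂, K₂⟩ := h₂.exists_sub
  have h1 : ∀ᵐ p : (Fin k → ℝ) × (Big H → ℝ), φ₁ p.1 = f₁ p.1 - g₁ p.1 :=
    Measure.quasiMeasurePreserving_fst.ae e₁
  have a1 := hf₁.integrable_weight hf₂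
  have a2 := hf₁.integrable_weight hg₂
  have a3 := hg₁.integrable_weight hf₂
  have a4 := hg₁.integrable_weight hg₂
  have E : (fun p : (Fin k → ℝ) × (Big H → ℝ) =>
      weight H p.1 p.2 * (φ₁ p.1 * φ₂ (mix H p.1 p.2))) =ᵐ[volume] fun p =>
      (weight H p.1 p.2 * (f₁ p.1 * f₂ (mix H p.1 p.2)) -
        weight H p.1 p.2 * (f₁ p.1 * g₂ (mix H p.1 p.2))) -
      (weight H p.1 p.2 * (g₁ p.1 * f₂ (mix H p.1 p.2)) -
        weight H p.1 p.2 * (g₁ p.1 * g₂ (mix H p.1 p.2))) := by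
    filter_upwards [h1, ae_mix H e₂] with p hp1 hp2
    rw [hp1, hp2]; ring
  have F : (fun y => kStar H φ₁ y * kStar H φ₂ y) =ᵐ[volume] fun y =>
      (kPos H f₁ y * kPos H f₂ y - kPos H f₁ y * kPos H g₂ y) -
      (kPos H g₁ y * kPos H f₂ y - kPos H g₁ y * kPos H g₂ y) := by
    filter_upwards [K₁, K₂] with y hy1 hy2
    rw [hy1, hy2]; ring
  have i : ∀ {f g : (Fin k → ℝ) → ℝ}, FiniteEnergy H f → FiniteEnergy H g →
      Integrable fun y => kPos H f y * kPos H g y := fun hf hg =>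
    hf.memLp_kPos.integrable_mul hg.memLp_kPos
  refine ⟨((a1.1.sub a2.1).sub (a3.1.sub a4.1)).congr E.symm, ?_⟩
  have e1 := integral_sub (a1.1.sub a2.1) (a3.1.sub a4.1)
  have e2 := integral_sub ((i hf₁ hf₂).sub (i hf₁ hg₂)) ((i hg₁ hf₂).sub (i hg₁ hg₂))
  simp only [Pi.sub_apply] at e1 e2
  rw [integral_congr_ae E, integral_congr_ae F, e1, e2,
    integral_sub a1.1 a2.1, integral_sub a3.1 a4.1,
    integral_sub (i hf₁ hf₂) (i hf₁ hg₂), integral_sub (i hg₁ hf₂) (i hg₁ hg₂),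
    a1.2, a2.2, a3.2, a4.2]

/-- The case where every `H_i` exceeds `1/2`: there the second variable ranges over `ℝ^k`. -/
theorem MemAbsHSpace.integrable_weight_of_forall_half_lt (hH : ∀ i, (1 / 2 : ℝ) < H i)
    {φ₁ φ₂ : (Fin k → ℝ) → ℝ} (h₁ : MemAbsHSpace H φ₁) (h₂ : MemAbsHSpace H φ₂) :
    Integrable (fun p : (Fin k → ℝ) × (Fin k → ℝ) => φ₁ p.1 * φ₂ p.2 *
      ∏ i, ((H i : ℝ) * (2 * H i - 1) * |p.1 i - p.2 i| ^ (2 * (H i : ℝ) - 2))) ∧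
    ∫ y, kStar H φ₁ y * kStar H φ₂ y = ∫ p : (Fin k → ℝ) × (Fin k → ℝ), φ₁ p.1 * φ₂ p.2 *
      ∏ i, ((H i : ℝ) * (2 * H i - 1) * |p.1 i - p.2 i| ^ (2 * (H i : ℝ) - 2)) := by
  let e : Big H ≃ Fin k := Equiv.subtypeUnivEquiv hH
  let E : (Big H → ℝ) ≃ᵐ (Fin k → ℝ) := MeasurableEquiv.piCongrLeft (fun _ => ℝ) e
  have hE : MeasurePreserving E volume volume :=
    volume_measurePreserving_piCongrLeft (fun _ => ℝ) e
  have hP : MeasurePreserving (Prod.map (id : (Fin k → ℝ) → Fin k → ℝ) E) volume volume :=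
    (MeasurePreserving.id volume).prod hE
  have hPe : MeasurableEmbedding (Prod.map (id : (Fin k → ℝ) → Fin k → ℝ) E) :=
    ((MeasurableEquiv.refl _).prodCongr E).measurableEmbedding
  have hEv : ∀ (v : Big H → ℝ) (i : Fin k), E v i = v ⟨i, hH i⟩ := fun v i =>
    Equiv.piCongrLeft_apply_apply (fun _ : Fin k => ℝ) e v ⟨i, hH i⟩
  have hfun : (fun p : (Fin k → ℝ) × (Fin k → ℝ) => φ₁ p.1 * φ₂ p.2 *
      ∏ i, ((H i : ℝ) * (2 * H i - 1) * |p.1 i - p.2 i| ^ (2 * (H i : ℝ) - 2))) ∘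
      Prod.map id E = fun p => weight H p.1 p.2 * (φ₁ p.1 * φ₂ (mix H p.1 p.2)) := by
    ext p
    have hm : mix H p.1 p.2 = E p.2 := by
      ext i; rw [mix, dif_pos (hH i), hEv]
    simp only [Function.comp_apply, Prod.map_fst, Prod.map_snd, id, hm, weight]
    rw [mul_comm]
    congr 1
    refine (Fintype.prod_equiv e _ _ fun i => ?_).symm
    rw [hEv]; rfl
  have h := h₁.integrable_weight h₂
  rw [← hfun] at h
  refine ⟨(hP.integrable_comp_emb hPe).1 h.1, h.2.trans ?_⟩
  exact hP.integral_comp hPe fun p : (Fin k → ℝ) × (Fin k → ℝ) => φ₁ p.1 * φ₂ p.2 *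
    ∏ i, ((H i : ℝ) * (2 * H i - 1) * |p.1 i - p.2 i| ^ (2 * (H i : ℝ) - 2))

end absSpace

/-! ### Isometric extensions -/

section extension

variable {k : ℕ} {H : Fin k → Hurst} {V : Type*} [NormedAddCommGroup V] [InnerProductSpace ℝ V]
  {F : (Fin k → ℝ) → V}

theorem norm_lift_of_inner (hF : ∀ x y, inner ℝ (F x) (F y) = fieldCov H x y) (c : Elem H) :
    ‖Elem.lift F c‖ = ‖c‖ := by
  have h : ‖Elem.lift F c‖ ^ 2 = ‖c‖ ^ 2 := by
    rw [← real_inner_self_eq_norm_sq, ← real_inner_self_eq_norm_sq]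
    change _ = gram H c.coeff c.coeff
    rw [Elem.lift_eq, Finsupp.linearCombination_apply, Finsupp.sum, sum_inner, gram, Finsupp.sum]
    refine Finset.sum_congr rfl fun x _ => ?_
    rw [inner_sum, Finsupp.sum]
    refine Finset.sum_congr rfl fun y _ => ?_
    rw [real_inner_smul_left, real_inner_smul_right, hF]
    ring
  exact (sq_eq_sq₀ (norm_nonneg _) (norm_nonneg _)).1 h

variable [CompleteSpace V]

/-- The continuous linear extension to `𝓗^H` of the map `1_{[0,x]} ↦ F x`. -/
noncomputable def extendElem (H : Fin k → Hurst) (F : (Fin k → ℝ) → V) : HSpace H →L[ℝ] V :=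
  (Elem.lift F).extendOfNorm
    (UniformSpace.Completion.toComplL : Elem H →L[ℝ] HSpace H).toLinearMap

theorem extendElem_coe (hF : ∀ x y, inner ℝ (F x) (F y) = fieldCov H x y) (c : Elem H) :
    extendElem H F (c : HSpace H) = Elem.lift F c :=
  LinearMap.extendOfNorm_eq (e := (UniformSpace.Completion.toComplL :
      Elem H →L[ℝ] HSpace H).toLinearMap) UniformSpace.Completion.denseRange_coe
    ⟨1, fun c => by
      rw [one_mul, norm_lift_of_inner hF]
      exact (UniformSpace.Completion.norm_coe c).ge⟩ c

theorem Elem.lift_box {M : Type*} [AddCommGroup M] [Module ℝ M] (f : (Fin k → ℝ) → M)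
    (x : Fin k → ℝ) : Elem.lift f (Elem.box x : Elem H) = f x := by
  change Finsupp.linearCombination ℝ f (Finsupp.single x (1 : ℝ)) = _
  simp

theorem extendElem_box (hF : ∀ x y, inner ℝ (F x) (F y) = fieldCov H x y) (x : Fin k → ℝ) :
    extendElem H F ((Elem.box x : Elem H) : HSpace H) = F x := by
  rw [extendElem_coe hF, Elem.lift_box]

theorem norm_extendElem (hF : ∀ x y, inner ℝ (F x) (F y) = fieldCov H x y) (φ : HSpace H) :
    ‖extendElem H F φ‖ = ‖φ‖ := by
  induction φ using UniformSpace.Completion.induction_on with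
  | hp => exact isClosed_eq (by fun_prop) continuous_norm
  | ih c => rw [extendElem_coe hF, norm_lift_of_inner hF, UniformSpace.Completion.norm_coe]

/-- An isometric extension has closed range, so a total family `F` makes it surjective. -/
theorem extendElem_surjective (hF : ∀ x y, inner ℝ (F x) (F y) = fieldCov H x y)
    (hd : (Submodule.span ℝ (range F)).topologicalClosure = ⊤) :
    Function.Surjective (extendElem H F) := by
  have hiso : Isometry (extendElem H F) :=
    AddMonoidHomClass.isometry_of_norm _ (norm_extendElem hF)
  have hcl : IsClosed ((extendElem H F).range : Set V) :=
    hiso.isClosedEmbedding.isClosed_range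
  have : (⊤ : Submodule ℝ V) ≤ (extendElem H F).range := by
    rw [← hd]
    refine Submodule.topologicalClosure_minimal _ (Submodule.span_le.2 ?_) hcl
    rintro _ ⟨x, rfl⟩
    exact ⟨_, extendElem_box hF x⟩
  exact fun v => this (Submodule.mem_top (x := v))

theorem extendElem_mem_topologicalClosure
    (hF : ∀ x y, inner ℝ (F x) (F y) = fieldCov H x y) (φ : HSpace H) :
    extendElem H F φ ∈ (Submodule.span ℝ (range F)).topologicalClosure := by
  induction φ using UniformSpace.Completion.induction_on with
  | hp => exact (Submodule.isClosed_topologicalClosure _).preimage (extendElem H F).continuous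
  | ih c =>
    rw [extendElem_coe hF, Elem.lift_eq]
    refine Submodule.le_topologicalClosure _ ?_
    rw [← Finsupp.range_linearCombination]
    exact ⟨_, rfl⟩

end extension

/-! ### Closed Gaussian subspaces of `L²(Ω)` -/

section gaussian

variable {Ω : Type*} [MeasurableSpace Ω] {P : Measure Ω}

theorem norm_cexp_mul_I_sub_le (x y : ℝ) :
    ‖Complex.exp (x * Complex.I) - Complex.exp (y * Complex.I)‖ ≤ |x - y| := by
  have e : Complex.exp (x * Complex.I) - Complex.exp (y * Complex.I) =
      Complex.exp (y * Complex.I) * (Complex.exp (Complex.I * ((x - y : ℝ) : ℂ)) - 1) := by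
    rw [mul_sub, ← Complex.exp_add, mul_one]
    congr 2
    push_cast; ring
  rw [e, norm_mul, Complex.norm_exp_ofReal_mul_I, one_mul]
  exact Real.norm_exp_I_mul_ofReal_sub_one_le

theorem memLp_of_isGaussianProcess {T : Type*} {B : T → Ω → ℝ} (hB : IsGaussianProcess B P)
    (x : T) : MemLp (B x) 2 P := (hB.hasGaussianLaw_eval x).memLp_two

/-- A family in a subspace of centred Gaussian variables is a Gaussian process. -/
theorem isGaussianProcess_of_mem {T : Type*} {V : Submodule ℝ (Lp ℝ 2 P)}
    (hV : ∀ X ∈ V, P.map X = gaussianReal 0 (‖X‖ ^ 2).toNNReal) {W : T → Lp ℝ 2 P}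
    (hW : ∀ x, W x ∈ V) : IsGaussianProcess (fun x ω => W x ω) P := by
  classical
  refine ⟨fun I => ⟨isGaussian_of_map_eq_gaussianReal fun L => ?_⟩⟩
  have hm : AEMeasurable (fun ω => I.restrict fun x => W x ω) P :=
    aemeasurable_pi_lambda _ fun i => (Lp.memLp (W i)).1.aemeasurable
  set Z : Lp ℝ 2 P := ∑ i : I, L (Pi.single i 1) • W i with hZ
  have hZV : Z ∈ V := Submodule.sum_mem _ fun i _ => Submodule.smul_mem _ _ (hW i)
  refine ⟨0, (‖Z‖ ^ 2).toNNReal, ?_⟩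
  rw [AEMeasurable.map_map_of_aemeasurable L.continuous.measurable.aemeasurable hm, ← hV Z hZV]
  refine Measure.map_congr ?_
  have hsum : ∀ s : Finset I, ((∑ i ∈ s, L (Pi.single i 1) • W i : Lp ℝ 2 P) : Ω → ℝ) =ᵐ[P]
      fun ω => ∑ i ∈ s, L (Pi.single i 1) * W i ω := by
    intro s
    induction s using Finset.induction_on with
    | empty => simp only [Finset.sum_empty]; exact Lp.coeFn_zero ℝ 2 P
    | insert i s hi ih =>
      rw [Finset.sum_insert hi]
      filter_upwards [Lp.coeFn_add (L (Pi.single i 1) • W i) (∑ i ∈ s, L (Pi.single i 1) • W i),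
        Lp.coeFn_smul (L (Pi.single i 1)) (W i), ih] with ω h1 h2 h3
      rw [h1, Pi.add_apply, h2, h3, Finset.sum_insert hi]
      simp
  filter_upwards [hsum Finset.univ] with ω hω
  rw [hω]
  simp only [Function.comp_apply]
  conv_lhs => rw [← Finset.univ_sum_single (I.restrict fun x => W x ω)]
  rw [map_sum]
  refine Finset.sum_congr rfl fun i _ => ?_
  have : (Pi.single i (I.restrict (fun x => W x ω) i) : I → ℝ) =
      W i ω • (Pi.single i 1 : I → ℝ) := by
    rw [← Pi.single_smul]; simp [Finset.restrict]
  rw [this, map_smul, smul_eq_mul, mul_comm]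

variable [IsProbabilityMeasure P]

theorem integrable_cexp_mul_I {X : Ω → ℝ} (hX : AEStronglyMeasurable X P) :
    Integrable (fun ω => Complex.exp (X ω * Complex.I)) P := by
  refine Integrable.of_bound (C := 1) ?_ (.of_forall fun ω => ?_)
  · exact (by fun_prop : Continuous fun x : ℝ =>
      Complex.exp (x * Complex.I)).comp_aestronglyMeasurable hX
  · rw [Complex.norm_exp_ofReal_mul_I]

theorem integral_abs_le_norm (Z : Lp ℝ 2 P) : ∫ ω, |Z ω| ∂P ≤ ‖Z‖ := by
  have h := eLpNorm_le_eLpNorm_of_exponent_le (p := 1) (q := 2) (by norm_num) (Lp.memLp Z).1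
  rw [Lp.norm_def]
  simp_rw [← Real.norm_eq_abs]
  rw [integral_norm_eq_lintegral_enorm (Lp.memLp Z).1, ← eLpNorm_one_eq_lintegral_enorm]
  exact ENNReal.toReal_mono (Lp.memLp Z).2.ne h

theorem continuous_integral_cexp_mul_I :
    Continuous fun X : Lp ℝ 2 P => ∫ ω, Complex.exp (X ω * Complex.I) ∂P := by
  refine LipschitzWith.continuous (K := 1) (LipschitzWith.of_dist_le_mul fun X Y => ?_)
  rw [dist_eq_norm, dist_eq_norm, NNReal.coe_one, one_mul, ← integral_sub
    (integrable_cexp_mul_I (Lp.memLp X).1) (integrable_cexp_mul_I (Lp.memLp Y).1)]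
  refine (norm_integral_le_integral_norm _).trans (le_trans ?_ (integral_abs_le_norm (X - Y)))
  have hint : Integrable (fun ω => |(X - Y : Lp ℝ 2 P) ω|) P :=
    ((Lp.memLp (X - Y)).integrable (by norm_num)).abs
  refine integral_mono_ae ((integrable_cexp_mul_I (Lp.memLp X).1).sub
    (integrable_cexp_mul_I (Lp.memLp Y).1)).norm hint ?_
  filter_upwards [Lp.coeFn_sub X Y] with ω hω
  rw [hω]
  exact norm_cexp_mul_I_sub_le _ _

/-- Limits in `L²` of centred Gaussian variables are centred Gaussian, because the
characteristic function at a point is a continuous function on `L²(Ω)`. -/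
theorem map_eq_gaussianReal_of_mem_topologicalClosure {V : Submodule ℝ (Lp ℝ 2 P)}
    (hV : ∀ X ∈ V, ∫ ω, Complex.exp (X ω * Complex.I) ∂P = Complex.exp (-(‖X‖ : ℂ) ^ 2 / 2))
    {X : Lp ℝ 2 P} (hX : X ∈ V.topologicalClosure) :
    P.map X = gaussianReal 0 (‖X‖ ^ 2).toNNReal := by
  have key : ∀ Y ∈ V.topologicalClosure,
      ∫ ω, Complex.exp (Y ω * Complex.I) ∂P = Complex.exp (-(‖Y‖ : ℂ) ^ 2 / 2) := by
    have hcl : IsClosed {Y : Lp ℝ 2 P |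
        ∫ ω, Complex.exp (Y ω * Complex.I) ∂P = Complex.exp (-(‖Y‖ : ℂ) ^ 2 / 2)} :=
      isClosed_eq continuous_integral_cexp_mul_I (by fun_prop)
    exact closure_minimal hV hcl
  have hm : AEMeasurable X P := (Lp.memLp X).1.aemeasurable
  have : IsProbabilityMeasure (P.map X) := Measure.isProbabilityMeasure_map hm
  refine Measure.ext_of_charFun (funext fun t => ?_)
  rw [charFun_apply_real, charFun_gaussianReal, integral_map hm (by fun_prop)]
  have ht := key (t • X) (Submodule.smul_mem _ t hX)
  have e : ∫ ω, Complex.exp ((t • X : Lp ℝ 2 P) ω * Complex.I) ∂P =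
      ∫ ω, Complex.exp (t * X ω * Complex.I) ∂P := by
    refine integral_congr_ae ?_
    filter_upwards [Lp.coeFn_smul t X] with ω hω
    rw [hω]; simp
  rw [← e, ht, norm_smul, Real.coe_toNNReal _ (by positivity)]
  congr 1
  have h2 : ((|t| : ℝ) : ℂ) ^ 2 = (t : ℂ) ^ 2 := by exact_mod_cast sq_abs t
  rw [Real.norm_eq_abs]
  push_cast
  rw [mul_pow, h2]
  ring

/-- Linear combinations of a centred Gaussian process are centred Gaussian, expressed by the value
of the characteristic function at `1`. -/
theorem integral_cexp_of_mem_span {T : Type*} {B : T → Ω → ℝ} (hB : IsGaussianProcess B P)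
    (hmean : ∀ x, ∫ ω, B x ω ∂P = 0) {X : Lp ℝ 2 P}
    (hX : X ∈ Submodule.span ℝ (range fun x => toL2 P (B x))) :
    ∫ ω, Complex.exp (X ω * Complex.I) ∂P = Complex.exp (-(‖X‖ : ℂ) ^ 2 / 2) := by
  rw [← Finsupp.range_linearCombination] at hX
  obtain ⟨c, rfl⟩ := hX
  have hmem := memLp_of_isGaussianProcess hB
  rw [linearCombination_toL2 hmem]
  set Y : Ω → ℝ := fun ω => c.sum fun x a => a * B x ω with hY
  have hYm : MemLp Y 2 P := memLp_finsupp_sum hmem c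
  have hlaw : HasGaussianLaw Y P := by
    let L : ((i : c.support) → ℝ) →L[ℝ] ℝ :=
      ∑ i : c.support, c i • ContinuousLinearMap.proj i
    have := (hB.hasGaussianLaw c.support).map L
    refine this.congr (.of_forall fun ω => ?_)
    simp only [L, hY, Function.comp_apply, Finsupp.sum, sum_apply,
      smul_apply, ContinuousLinearMap.proj_apply, Finset.restrict, smul_eq_mul]
    exact Finset.sum_coe_sort c.support fun x => c x * B x ω
  have hY0 : ∫ ω, Y ω ∂P = 0 := by
    simp only [hY, Finsupp.sum]
    rw [integral_finsetSum _ fun x _ => ((hmem x).integrable (by norm_num)).const_mul _]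
    refine Finset.sum_eq_zero fun x _ => ?_
    rw [integral_const_mul, hmean, mul_zero]
  have hvar : Var[Y; P] = ‖toL2 P Y‖ ^ 2 := by
    rw [variance_eq_integral hlaw.aemeasurable, hY0, ← real_inner_self_eq_norm_sq,
      inner_toL2 hYm hYm]
    simp [sq]
  have h := congrArg (fun μ => charFun μ 1) hlaw.map_eq_gaussianReal
  simp only [charFun_gaussianReal] at h
  rw [charFun_apply_real, integral_map hlaw.aemeasurable (by fun_prop), hY0, hvar,
    Real.coe_toNNReal _ (by positivity)] at h
  have e : ∫ ω, Complex.exp (toL2 P Y ω * Complex.I) ∂P =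
      ∫ ω, Complex.exp ((1 : ℝ) * Y ω * Complex.I) ∂P := by
    refine integral_congr_ae ?_
    filter_upwards [coeFn_toL2 hYm] with ω hω
    rw [hω]; simp
  rw [e, h]
  congr 1
  push_cast
  ring

end gaussian

/-- An isometry that maps each `1_{[0,x]}` to `W x` is the Wiener integral, because the signed
indicators are total. -/
theorem wienerIntegral_eq {Ω : Type*} [MeasurableSpace Ω] {P : Measure Ω} {k : ℕ}
    {W : (Fin k → ℝ) → Ω → ℝ}
    {U : Lp ℝ 2 (volume : Measure (Fin k → ℝ)) →L[ℝ] Lp ℝ 2 P} (hU : ∀ f, ‖U f‖ = ‖f‖)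
    (hW : ∀ x, U (toL2 volume (boxInd x)) = toL2 P (W x)) : wienerIntegral P W = U := by
  have hlin : ∀ c : (Fin k → ℝ) →₀ ℝ, U (Finsupp.linearCombination ℝ
      (fun x => toL2 volume (boxInd x)) c) =
      Finsupp.linearCombination ℝ (fun x => toL2 P (W x)) c := fun c => by
    rw [Finsupp.linearCombination_apply, Finsupp.linearCombination_apply, Finsupp.sum, map_sum]
    refine Finset.sum_congr rfl fun x _ => ?_
    rw [map_smul, hW]
  refine LinearMap.extendOfNorm_unique ?_ 1 (fun c => ?_) U (LinearMap.ext hlin)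
  · have := dense_span_boxInd (k := k)
    rw [← Submodule.dense_iff_topologicalClosure_eq_top, ← Finsupp.range_linearCombination] at this
    exact this
  · rw [one_mul, ← hlin, hU]

end FracField

/-! ### The Wiener field of a fractional Brownian field -/

theorem propositionp2p1 {k : ℕ} (H : Fin k → FracField.Hurst)
    {Ω : Type*} [MeasurableSpace Ω] (P : Measure Ω) [IsProbabilityMeasure P]
    (B : (Fin k → ℝ) → Ω → ℝ) (hB : FracField.IsFractionalBrownianField H P B) :
    ∃ W : (Fin k → ℝ) → Ω → ℝ, FracField.IsStandardWienerField P W ∧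
      -- `f ↦ ∫ f dW` is the linear isometry `L²(ℝ^k) → L²(Ω)` with `∫ 1_{[0,x]} dW = W x`
      (∀ x, FracField.wienerIntegral P W (FracField.toL2 volume (FracField.boxInd x))
        =ᵐ[P] W x) ∧
      (∀ f, ‖FracField.wienerIntegral P W f‖ = ‖f‖) ∧
      -- (1) the representation of `B`
      (∀ x, MemLp (FracField.fieldKernel H x) 2 volume ∧
        MemLp (FracField.kStar H (FracField.boxInd x)) 2 volume ∧
        B x =ᵐ[P] FracField.wienerIntegral P W
          (FracField.toL2 volume (FracField.fieldKernel H x)) ∧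
        B x =ᵐ[P] FracField.wienerIntegral P W
          (FracField.toL2 volume (FracField.kStar H (FracField.boxInd x)))) ∧
      -- (2) `K_H^{*,(k)}` and `𝓘` extend from elementary functions to isometries on `𝓗^H`,
      -- and `𝓘(φ) = ∫ K_H^{*,(k)} φ dW` in `L²(Ω)` for all `φ ∈ 𝓗^H`
      (∀ c : FracField.Elem H, MemLp (FracField.kStar H c.toFun) 2 volume ∧
        FracField.kStarExt H (c : FracField.HSpace H) =ᵐ[volume] FracField.kStar H c.toFun) ∧
      (∀ φ, ‖FracField.kStarExt H φ‖ = ‖φ‖) ∧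
      (∀ x, FracField.fieldIntegral H P B
        ((FracField.Elem.box x : FracField.Elem H) : FracField.HSpace H) =ᵐ[P] B x) ∧
      (∀ φ, ‖FracField.fieldIntegral H P B φ‖ = ‖φ‖) ∧
      (∀ φ, FracField.fieldIntegral H P B φ =
        FracField.wienerIntegral P W (FracField.kStarExt H φ)) ∧
      -- (3) each `φ ∈ |𝓗^H|` is, through `K_H^{*,(k)}`, exactly one element of `𝓗^H`
      (∀ φ, FracField.MemAbsHSpace H φ → MemLp (FracField.kStar H φ) 2 volume ∧
        ∃! h : FracField.HSpace H, FracField.kStarExt H h =ᵐ[volume] FracField.kStar H φ) ∧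
      -- and the isometry formula holds
      (∀ φ₁ φ₂, FracField.MemAbsHSpace H φ₁ → FracField.MemAbsHSpace H φ₂ →
        ∀ h₁ h₂ : FracField.HSpace H,
        FracField.kStarExt H h₁ =ᵐ[volume] FracField.kStar H φ₁ →
        FracField.kStarExt H h₂ =ᵐ[volume] FracField.kStar H φ₂ →
        ∫ ω, FracField.fieldIntegral H P B h₁ ω * FracField.fieldIntegral H P B h₂ ω ∂P =
            ∫ y, FracField.kStar H φ₁ y * FracField.kStar H φ₂ y ∧
        Integrable (fun p : (Fin k → ℝ) × (FracField.Big H → ℝ) =>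
          FracField.weight H p.1 p.2 * (φ₁ p.1 * φ₂ (FracField.mix H p.1 p.2))) ∧
        ∫ ω, FracField.fieldIntegral H P B h₁ ω * FracField.fieldIntegral H P B h₂ ω ∂P =
          ∫ p : (Fin k → ℝ) × (FracField.Big H → ℝ),
            FracField.weight H p.1 p.2 * (φ₁ p.1 * φ₂ (FracField.mix H p.1 p.2)) ∧
        ((∀ i, (1 / 2 : ℝ) < H i) →
          Integrable (fun p : (Fin k → ℝ) × (Fin k → ℝ) => φ₁ p.1 * φ₂ p.2 *
            ∏ i, ((H i : ℝ) * (2 * H i - 1) * |p.1 i - p.2 i| ^ (2 * (H i : ℝ) - 2))) ∧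
          ∫ ω, FracField.fieldIntegral H P B h₁ ω * FracField.fieldIntegral H P B h₂ ω ∂P =
            ∫ p : (Fin k → ℝ) × (Fin k → ℝ), φ₁ p.1 * φ₂ p.2 *
              ∏ i, ((H i : ℝ) * (2 * H i - 1) * |p.1 i - p.2 i| ^ (2 * (H i : ℝ) - 2)))) := by
  have hmem : ∀ x, MemLp (B x) 2 P := FracField.memLp_of_isGaussianProcess hB.gaussian
  have hBin : ∀ x y, inner ℝ (FracField.toL2 P (B x)) (FracField.toL2 P (B y)) =
      FracField.fieldCov H x y := fun x y => by
    rw [FracField.inner_toL2 (hmem x) (hmem y), hB.cov]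
  have hKin := FracField.inner_kStar_boxInd H
  -- Both extensions are the isometric extension of a family with Gram matrix `R_H`.
  have hKnorm : ∀ φ, ‖FracField.kStarExt H φ‖ = ‖φ‖ := FracField.norm_extendElem hKin
  have hInorm : ∀ φ, ‖FracField.fieldIntegral H P B φ‖ = ‖φ‖ := FracField.norm_extendElem hBin
  have hKbox : ∀ x, FracField.kStarExt H
      ((FracField.Elem.box x : FracField.Elem H) : FracField.HSpace H) =
      FracField.toL2 volume (FracField.kStar H (FracField.boxInd x)) :=
    FracField.extendElem_box hKin
  have hIbox : ∀ x, FracField.fieldIntegral H P B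
      ((FracField.Elem.box x : FracField.Elem H) : FracField.HSpace H) =
      FracField.toL2 P (B x) := FracField.extendElem_box hBin
  have hKsurj : Function.Surjective (FracField.kStarExt H) :=
    FracField.extendElem_surjective hKin (FracField.dense_span_kStar_boxInd H)
  -- Totality makes `K` onto, which is what allows it to be inverted.
  let K : FracField.HSpace H ≃ₗᵢ[ℝ] Lp ℝ 2 (volume : Measure (Fin k → ℝ)) :=
    LinearIsometryEquiv.ofSurjective ⟨(FracField.kStarExt H).toLinearMap, hKnorm⟩ hKsurj
  let J : FracField.HSpace H →ₗᵢ[ℝ] Lp ℝ 2 P :=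
    ⟨(FracField.fieldIntegral H P B).toLinearMap, hInorm⟩
  -- `𝓘 ∘ K⁻¹` is to be the Wiener integral, and `W x` is its value at `1_{[0,x]}`.
  let U : Lp ℝ 2 (volume : Measure (Fin k → ℝ)) →ₗᵢ[ℝ] Lp ℝ 2 P :=
    J.comp K.symm.toLinearIsometry
  have hUK : ∀ φ, U (FracField.kStarExt H φ) = FracField.fieldIntegral H P B φ := fun φ =>
    congrArg J (K.symm_apply_apply φ)
  let W : (Fin k → ℝ) → Ω → ℝ := fun x => U (FracField.toL2 volume (FracField.boxInd x))
  have hUW : FracField.wienerIntegral P W = U.toContinuousLinearMap :=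
    FracField.wienerIntegral_eq U.norm_map fun x => (FracField.toL2_coeFn _).symm
  have hwK : ∀ φ, FracField.fieldIntegral H P B φ =
      FracField.wienerIntegral P W (FracField.kStarExt H φ) := fun φ => by
    rw [hUW, ← hUK]; rfl
  have hlaw : ∀ X ∈ (Submodule.span ℝ
      (Set.range fun x => FracField.toL2 P (B x))).topologicalClosure,
      P.map X = gaussianReal 0 (‖X‖ ^ 2).toNNReal := fun X hX =>
    FracField.map_eq_gaussianReal_of_mem_topologicalClosure
      (fun Y hY => FracField.integral_cexp_of_mem_span hB.gaussian hB.mean hY) hX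
  have hWmem : ∀ x, U (FracField.toL2 volume (FracField.boxInd x)) ∈ (Submodule.span ℝ
      (Set.range fun x => FracField.toL2 P (B x))).topologicalClosure := fun x =>
    FracField.extendElem_mem_topologicalClosure hBin _
  have hIJ : ∀ h₁ h₂, ∫ ω, FracField.fieldIntegral H P B h₁ ω *
      FracField.fieldIntegral H P B h₂ ω ∂P =
      ∫ y, FracField.kStarExt H h₁ y * FracField.kStarExt H h₂ y := fun h₁ h₂ => by
    rw [← FracField.inner_eq_integral_mul, ← FracField.inner_eq_integral_mul]
    exact (J.inner_map_map h₁ h₂).trans (K.inner_map_map h₁ h₂).symm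
  have hfk : ∀ x, MemLp (FracField.fieldKernel H x) 2 volume := fun x =>
    (memLp_congr_ae (FracField.kStar_boxInd_ae_eq H x)).1 (FracField.memLp_kStar_boxInd H x)
  have hrep : ∀ x, B x =ᵐ[P] FracField.wienerIntegral P W
      (FracField.toL2 volume (FracField.kStar H (FracField.boxInd x))) := fun x => by
    rw [← hKbox, ← hwK, hIbox]
    exact (FracField.coeFn_toL2 (hmem x)).symm
  refine ⟨W, ⟨FracField.isGaussianProcess_of_mem hlaw hWmem, fun x => ?_, fun x y => ?_⟩,
    fun x => ?_, fun f => ?_, fun x => ⟨hfk x, FracField.memLp_kStar_boxInd H x, ?_, hrep x⟩,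
    fun c => ?_, hKnorm, fun x => ?_, hInorm, hwK, fun φ hφ => ⟨hφ.memLp_kStar, ?_⟩,
    fun φ₁ φ₂ hφ₁ hφ₂ h₁ h₂ e₁ e₂ => ?_⟩
  · -- The mean is read off from the law `N(0, ‖W x‖²)`.
    have hm := (Lp.memLp (U (FracField.toL2 volume (FracField.boxInd x)))).1.aemeasurable
    have := integral_map hm (f := fun t : ℝ => t) (by fun_prop)
    rw [hlaw _ (hWmem x)] at this
    exact this.symm.trans integral_id_gaussianReal
  · exact (FracField.inner_eq_integral_mul _ _).symm.trans
      ((U.inner_map_map _ _).trans (FracField.inner_boxInd x y))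
  · rw [hUW]; exact Filter.EventuallyEq.rfl
  · rw [hUW]; exact U.norm_map f
  · rw [← FracField.toL2_congr (FracField.kStar_boxInd_ae_eq H x)]
    exact hrep x
  · have hfun : FracField.kStar H c.toFun = fun η =>
        c.coeff.sum fun x a => a * FracField.kStar H (FracField.boxInd x) η := by
      rw [FracField.Elem.toFun_eq_sum, FracField.kStar_finsupp_sum]
      simp only [FracField.kStar_boxInd]
    have hm : MemLp (FracField.kStar H c.toFun) 2 volume := by
      rw [hfun]
      exact FracField.memLp_finsupp_sum (FracField.memLp_kStar_boxInd H) c.coeff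
    refine ⟨hm, ?_⟩
    have hc : FracField.kStarExt H (c : FracField.HSpace H) =
        FracField.toL2 volume (FracField.kStar H c.toFun) := by
      rw [hfun, ← FracField.linearCombination_toL2 (FracField.memLp_kStar_boxInd H),
        ← FracField.Elem.lift_eq]
      exact FracField.extendElem_coe hKin c
    rw [hc]
    exact FracField.coeFn_toL2 hm
  · rw [hIbox]; exact FracField.coeFn_toL2 (hmem x)
  · obtain ⟨h, hh⟩ := hKsurj (FracField.toL2 volume (FracField.kStar H φ))
    refine ⟨h, ?_, fun h' hh' => K.injective (Lp.ext ?_)⟩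
    · simp only [hh]; exact FracField.coeFn_toL2 hφ.memLp_kStar
    · refine hh'.trans ((FracField.coeFn_toL2 hφ.memLp_kStar).symm.trans ?_)
      rw [← hh]; exact Filter.EventuallyEq.rfl
  · have hE : ∫ ω, FracField.fieldIntegral H P B h₁ ω * FracField.fieldIntegral H P B h₂ ω ∂P =
        ∫ y, FracField.kStar H φ₁ y * FracField.kStar H φ₂ y := by
      rw [hIJ]
      exact integral_congr_ae (e₁.mul e₂)
    obtain ⟨hi, he⟩ := hφ₁.integrable_weight hφ₂
    refine ⟨hE, hi, hE.trans he, fun hH => ?_⟩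
    obtain ⟨hi', he'⟩ := hφ₁.integrable_weight_of_forall_half_lt hH hφ₂
    exact ⟨hi', hE.trans he'⟩
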